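/- An instance of $P\,|\,r_j,\text{or-prec},\text{pmtn}\,|\,C_{\max}$ consists of $m\ge 1$ identical parallel machines, jobs $[n]=\{1,\dots,n\}$ with positive integral processing times $p_j$ and non-negative integral release dates $r_j$, and a directed graph $G=([n],E)$; let $\mathcal P(j)=\{i : (i,j)\in E\}$. A preemptive schedule processes every job $j$ for $p_j$ units of time in finitely many pieces (time intervals, with real end points, on machines), such that no machine processes two jobs at once and no job is processed on two machines at once. Let $S_j$ and $C_j$ be the start and completion time of $j$. The schedule is feasible if $S_j\ge r_j$ for all $j$ and $S_j\ge\min\{C_i : i\in\mathcal P(j)\}$ for all $j$ with $\mathcal P(j)\ne\emptyset$, and optimal if it minimizes $C_{\max}=\max_j C_j$ among the feasible ones. With AND-precedence constraints, the last condition is replaced by $S_j\ge C_i$ for all $(i,j)\in E$. Suppose the instance admits a feasible schedule. In the earliest start schedule (unboundedly many machines), job $j$ starts at $S_j=r_j$ if $\mathcal P(j)=\emptyset$ and at $S_j=\max\{r_j,\min_{i\in\mathcal P(j)}(S_i+p_i)\}$ otherwise. A minimal chain of $k$ is an inclusion-minimal set among the vertex sets $\{j_1,\dots,j_\ell\}$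 of paths in $G$ with $\mathcal P(j_1)=\emptyset$, $j_\ell=k$, $S_{j_1}=r_{j_1}$ and $S_{j_q}=\max\{r_{j_q},S_{j_{q-1}}+p_{j_{q-1}}\}$ for $2\le q\le\ell$. A collection $\{L_j\}_{j\in[n]}$, where $L_j$ is a minimal chain of $j$, is closed if $i\in L_j$ implies $L_i\subseteq L_j$. Let $G_L$ be the graph obtained from $G$ by deleting all arcs $(i,j)$ with $i\notin L_j$, and all loops. Theorem. (a) There is an algorithm, running in time polynomial in the length of the binary encoding of the instance (on a random access machine with logarithmic cost), that for every instance reports that no feasible schedule exists if this is the case, and otherwise returns an optimal preemptive schedule; the returned schedule is moreover, for some closed collection of minimal chains $\{L_j\}$, an optimal preemptive schedule of the instance with AND-precedence constraints $G_L$. (b) For every instance that admits a feasible schedule, a closed collection of minimal chains exists. For every such collection $\{L_j\}$, the graph $G_L$ is an outforest (every vertex has at most one incoming arc and there is no directed cycle), the instance with AND-precedence constraints $G_L$ has an optimal preemptive schedule, each of its feasible preemptive schedules is feasible for the OR-precedence constraints $G$, and each of its optimal preemptive schedules is optimal for the OR-precedence constraints $G$. -/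

import Mathlib

namespace OrSched

/-! ### Random access machines with logarithmic cost

Programs act on finitely many (those named in the program) unbounded arrays of natural numbers of
unbounded size. Every evaluation of a subexpression is charged the number of bits of its value
(plus one), so addresses, operands and results are all paid for bit by bit. -/

/-- A memory state: `s a k` is the content of cell `k` of array `a`. -/
abbrev State := ℕ → ℕ → ℕ

/-- Arithmetic expressions; `get a e` reads the cell of array `a` whose address is the value
of `e`. -/
inductive Expr where
  | const (k : ℕ)
  | get (a : ℕ) (e : Expr)
  | add (e₁ e₂ : Expr)
  | sub (e₁ e₂ : Expr)
  | mul (e₁ e₂ : Expr)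
  | div (e₁ e₂ : Expr)

/-- The value of an expression (truncated subtraction, division rounded down). -/
def Expr.eval (s : State) : Expr → ℕ
  | .const k => k
  | .get a e => s a (e.eval s)
  | .add e₁ e₂ => e₁.eval s + e₂.eval s
  | .sub e₁ e₂ => e₁.eval s - e₂.eval s
  | .mul e₁ e₂ => e₁.eval s * e₂.eval s
  | .div e₁ e₂ => e₁.eval s / e₂.eval s

/-- The logarithmic cost of evaluating an expression. -/
def Expr.cost (s : State) : Expr → ℕ
  | .const k => 1 + Nat.size k
  | .get a e => 1 + Nat.size ((Expr.get a e).eval s) + e.cost s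
  | .add e₁ e₂ => 1 + Nat.size ((Expr.add e₁ e₂).eval s) + e₁.cost s + e₂.cost s
  | .sub e₁ e₂ => 1 + Nat.size ((Expr.sub e₁ e₂).eval s) + e₁.cost s + e₂.cost s
  | .mul e₁ e₂ => 1 + Nat.size ((Expr.mul e₁ e₂).eval s) + e₁.cost s + e₂.cost s
  | .div e₁ e₂ => 1 + Nat.size ((Expr.div e₁ e₂).eval s) + e₁.cost s + e₂.cost s

/-- Programs. `store a e₁ e₂` writes the value of `e₂` into cell `e₁` of array `a`; tests succeed
when the value is nonzero. -/
inductive Program where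
  | skip
  | store (a : ℕ) (e₁ e₂ : Expr)
  | seq (c₁ c₂ : Program)
  | cond (e : Expr) (c₁ c₂ : Program)
  | loop (e : Expr) (c : Program)

/-- The state after writing `v` into cell `k` of array `a`. -/
def State.write (s : State) (a k v : ℕ) : State :=
  fun b l => if b = a ∧ l = k then v else s b l

/-- `Exec c s s' t`: the program `c`, started in state `s`, halts in state `s'` after a run of
total logarithmic cost `t`. -/
inductive Exec : Program → State → State → ℕ → Prop
  | skip (s : State) : Exec .skip s s 1
  | store (a : ℕ) (e₁ e₂ : Expr) (s : State) :
      Exec (.store a e₁ e₂) s (s.write a (e₁.eval s) (e₂.eval s)) (1 + e₁.cost s + e₂.cost s)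
  | seq {c₁ c₂ : Program} {s s' s'' : State} {t₁ t₂ : ℕ} :
      Exec c₁ s s' t₁ → Exec c₂ s' s'' t₂ → Exec (.seq c₁ c₂) s s'' (1 + t₁ + t₂)
  | cond_true {e : Expr} {c₁ c₂ : Program} {s s' : State} {t : ℕ} :
      e.eval s ≠ 0 → Exec c₁ s s' t → Exec (.cond e c₁ c₂) s s' (1 + e.cost s + t)
  | cond_false {e : Expr} {c₁ c₂ : Program} {s s' : State} {t : ℕ} :
      e.eval s = 0 → Exec c₂ s s' t → Exec (.cond e c₁ c₂) s s' (1 + e.cost s + t)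
  | loop_stop {e : Expr} {c : Program} {s : State} :
      e.eval s = 0 → Exec (.loop e c) s s (1 + e.cost s)
  | loop_step {e : Expr} {c : Program} {s s' s'' : State} {t₁ t₂ : ℕ} :
      e.eval s ≠ 0 → Exec c s s' t₁ → Exec (.loop e c) s' s'' t₂ →
      Exec (.loop e c) s s'' (1 + e.cost s + t₁ + t₂)

/-- The initial state on input `l`: array `0` holds the length of `l` followed by the entries of
`l`; every other cell is zero. -/
def inputState (l : List ℕ) : State :=
  fun a k => if a = 0 then (l.length :: l).getD k 0 else 0

/-- The output of a halted program is `l`: array `1` starts with the length of `l`, followed by the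
entries of `l`. -/
def HasOutput (s : State) (l : List ℕ) : Prop :=
  ∀ (k : ℕ) (h : k < (l.length :: l).length), s 1 k = (l.length :: l)[k]

/-- The length of the binary encoding of a list of natural numbers (one separator per entry). -/
def bitLength (l : List ℕ) : ℕ := (l.map fun x => Nat.size x + 1).sum

/-! ### Instances and preemptive schedules -/

/-- Scheduling data for `n` jobs on `m` identical parallel machines: positive integral processing
times, non-negative integral release dates and a directed precedence graph on the jobs. -/
structure Problem (n m : ℕ) where
  p : Fin n → ℕ
  p_pos : ∀ j, 0 < p j
  r : Fin n → ℕ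
  G : Digraph (Fin n)

/-- The job `job` runs on `machine` during the time interval from `start` to `finish`. -/
structure Piece (n m : ℕ) where
  job : Fin n
  machine : Fin m
  start : ℝ
  finish : ℝ

/-- A preemptive schedule is a finite list of pieces of jobs. -/
abbrev Schedule (n m : ℕ) := List (Piece n m)

variable {n m : ℕ}

/-- The start time of job `j`. -/
noncomputable def Schedule.startTime (σ : Schedule n m) (j : Fin n) : ℝ :=
  sInf {t | ∃ x ∈ σ, x.job = j ∧ x.start = t}

/-- The completion time of job `j`. -/
noncomputable def Schedule.completionTime (σ : Schedule n m) (j : Fin n) : ℝ :=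
  sSup {t | ∃ x ∈ σ, x.job = j ∧ x.finish = t}

/-- The makespan, the maximum of all completion times. -/
noncomputable def Schedule.makespan (σ : Schedule n m) : ℝ :=
  ⨆ j, σ.completionTime j

namespace Problem

/-- `σ` is a preemptive schedule of the jobs: pieces have positive length and do not start before
time `0`, two pieces on the same machine or of the same job do not overlap, and every job `j` is
processed for `p j` units of time. -/
structure IsSchedule (I : Problem n m) (σ : Schedule n m) : Prop where
  start_nonneg : ∀ x ∈ σ, 0 ≤ x.start
  start_lt_finish : ∀ x ∈ σ, x.start < x.finish
  no_overlap : σ.Pairwise fun x y =>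
    (x.machine = y.machine ∨ x.job = y.job) → x.finish ≤ y.start ∨ y.finish ≤ x.start
  processed : ∀ j, ((σ.filter fun x => x.job = j).map fun x => x.finish - x.start).sum = I.p j

/-- The job `j` has no predecessors. -/
def IsSource (I : Problem n m) (j : Fin n) : Prop := ∀ i, ¬ I.G.Adj i j

/-- Feasibility for OR-precedence constraints: no job starts before its release date, and every job
with predecessors starts after the completion of at least one of them. -/
structure OrFeasible (I : Problem n m) (σ : Schedule n m) : Prop where
  isSchedule : I.IsSchedule σ
  release : ∀ j, (I.r j : ℝ) ≤ σ.startTime j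
  prec : ∀ j, ¬ I.IsSource j → ∃ i, I.G.Adj i j ∧ σ.completionTime i ≤ σ.startTime j

/-- Feasibility for AND-precedence constraints: no job starts before its release date, and every
job starts after the completion of all its predecessors. -/
structure AndFeasible (I : Problem n m) (σ : Schedule n m) : Prop where
  isSchedule : I.IsSchedule σ
  release : ∀ j, (I.r j : ℝ) ≤ σ.startTime j
  prec : ∀ i j, I.G.Adj i j → σ.completionTime i ≤ σ.startTime j

/-- `σ` minimizes the makespan among all OR-feasible preemptive schedules. -/
def OrOptimal (I : Problem n m) (σ : Schedule n m) : Prop :=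
  I.OrFeasible σ ∧ ∀ τ, I.OrFeasible τ → σ.makespan ≤ τ.makespan

/-- `σ` minimizes the makespan among all AND-feasible preemptive schedules. -/
def AndOptimal (I : Problem n m) (σ : Schedule n m) : Prop :=
  I.AndFeasible σ ∧ ∀ τ, I.AndFeasible τ → σ.makespan ≤ τ.makespan

/-! ### Minimal chains -/

/-- `S` gives the start times of the earliest start schedule (on unboundedly many machines): a job
without predecessors starts at its release date, any other job `j` at the maximum of its release
date and the smallest completion time `S i + p i` of a predecessor `i`. -/
def IsEarliestStart (I : Problem n m) (S : Fin n → ℕ) : Prop :=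
  (∀ j, I.IsSource j → S j = I.r j) ∧
  ∀ j, ¬ I.IsSource j → S j = max (I.r j) (sInf {c | ∃ i, I.G.Adj i j ∧ c = S i + I.p i})

/-- `L` is the set of jobs of a path in the precedence graph from a job without predecessors to `k`
along which every job starts, in the earliest start schedule, at the maximum of its release date
and the completion time of the job before it. -/
def IsTightPath (I : Problem n m) (S : Fin n → ℕ) (k : Fin n) (L : Finset (Fin n)) : Prop :=
  ∃ (j₁ : Fin n) (l : List (Fin n)), (j₁ :: l).toFinset = L ∧
    I.IsSource j₁ ∧ S j₁ = I.r j₁ ∧ (j₁ :: l).getLast? = some k ∧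
    List.IsChain (fun i j => I.G.Adj i j ∧ S j = max (I.r j) (S i + I.p i)) (j₁ :: l)

/-- `L` is a minimal chain of `k`. -/
def IsMinimalChain (I : Problem n m) (k : Fin n) (L : Finset (Fin n)) : Prop :=
  ∃ S, I.IsEarliestStart S ∧ Minimal (I.IsTightPath S k) L

/-- `L` is a closed collection of minimal chains. -/
def IsClosedCollection (I : Problem n m) (L : Fin n → Finset (Fin n)) : Prop :=
  (∀ j, I.IsMinimalChain j (L j)) ∧ ∀ j, ∀ i ∈ L j, L i ⊆ L j

/-- The data obtained by deleting every arc `(i, j)` that is not in line with `L j` (and every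
loop). -/
def prune (I : Problem n m) (L : Fin n → Finset (Fin n)) : Problem n m :=
  { I with G := Digraph.mk fun i j => I.G.Adj i j ∧ i ∈ L j ∧ i ≠ j }

open Classical in
/-- The input: `n`, `m`, the processing times, the release dates and the adjacency matrix. -/
noncomputable def code (I : Problem n m) : List ℕ :=
  [n, m] ++ List.ofFn I.p ++ List.ofFn I.r ++
    (List.ofFn fun i => List.ofFn fun j => if I.G.Adj i j then 1 else 0).flatten

end Problem

/-- Every vertex has at most one incoming arc and there is no directed cycle. -/
def IsOutforest {V : Type*} (G : Digraph V) : Prop :=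
  (∀ i i' j, G.Adj i j → G.Adj i' j → i = i') ∧ ∀ v, ¬ Relation.TransGen G.Adj v v

/-- A piece with rational start `a / d` and finish `b / d`, as it is written by a program. -/
structure CodedPiece (n m : ℕ) where
  job : Fin n
  machine : Fin m
  a : ℕ
  b : ℕ
  d : ℕ
  d_pos : 0 < d

/-- The piece described by a coded piece. -/
noncomputable def CodedPiece.toPiece (x : CodedPiece n m) : Piece n m where
  job := x.job
  machine := x.machine
  start := (x.a : ℝ) / x.d
  finish := (x.b : ℝ) / x.d

/-- The numbers that represent a coded piece. -/
def CodedPiece.code (x : CodedPiece n m) : List ℕ := [x.job, x.machine, x.a, x.b, x.d]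

end OrSched

/-!
Lower bound. Let `S` be the earliest start times, and let the `u`-th unit of work on job `j` have
*head* `S j + u`. No unit of work can be done before its head, so the work with head at least `x`
has to be processed by `m` machines between `x` and the makespan
(`Problem.IsSchedule.headWork_le`). Together with the heads of whole jobs this gives a lower bound
on the makespan of every feasible schedule for the OR-precedence constraints; it is a maximum over
the values `x = S j`, and `m` times this bound is the integer `Problem.bound`.

Reduction to forests. In a minimal chain of `j`, the job before `j` is the only one with an arc to
`j`, and this arc is tight, that is, it determines `S j`
(`Problem.IsMinimalChain.exists_unique_adj`). Hence pruning with a closed collection leaves a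
forest of tight arcs (`IsTightForest`). Conversely, if each job chooses a tight arc from a job
with the smallest earliest start, then the chains of the resulting forest are minimal and closed
(`IsTightForest.isClosedCollection`). A schedule that respects the forest satisfies the
OR-precedence constraints, so everything follows once there is a schedule for an arbitrary forest
of tight arcs whose makespan equals the lower bound (`IsTail.optimal`).

The level algorithm. Such a schedule is built backwards in time, from the lower bound towards
zero. At each time the pending jobs, of which none of the successors has any work left, are
processed in the order of the heads of their remaining work, and jobs with equal heads share the
machines evenly. The invariant (`IsTail`) is that, for all `x`, the remaining work with head at
least `x` fits on `m` machines between `x` and the current time; it is kept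
(`IsPhase.headWork_le`), since either all machines are busy with work of the largest heads, or at
most `m` jobs have work left with large heads, and this work lies on their chains, which are short
because the arcs are tight. When nothing is left, no piece starts before its head, so release
dates and precedences are respected.

Running time. The situation changes only when a job is completed or two levels meet, and each such
event decreases a potential of at most `n * (n + 2)` (`potential_lt`). Between two events,
McNaughton's wrap-around rule turns the amounts of work into pieces (`IsTail.wrap`). All times are
kept as integers over a common denominator, which grows by a factor of at most `n ^ 2` per event,
so that all numbers have polynomially many bits. The algorithm is a program whose loops are all
bounded; `Cmd.Yields` is a Hoare logic for such programs that accounts for logarithmic cost: it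
suffices to bound the number of rounds of each loop and the bits of every number that is stored.
-/

namespace OrSched

section

/-! ### Structured programs and their cost -/

instance : OfNat Expr 0 := ⟨.const 0⟩
instance : OfNat Expr 1 := ⟨.const 1⟩
instance : Add Expr := ⟨.add⟩
instance : Sub Expr := ⟨.sub⟩
instance : Mul Expr := ⟨.mul⟩
instance : Div Expr := ⟨.div⟩

/-- The scalar variable kept in cell `0` of array `v`. -/
def Expr.var (v : ℕ) : Expr := .get v 0

/-- The test `e < f`, with value `0` or `1`. -/
def Expr.lt (e f : Expr) : Expr := 1 - (1 - (f - e))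

/-- The test `e ≤ f`, with value `0` or `1`. -/
def Expr.le (e f : Expr) : Expr := 1 - (e - f)

/-- The smaller one of two values. -/
def Expr.min (e f : Expr) : Expr := e - (e - f)

/-- The larger one of two values. -/
def Expr.max (e f : Expr) : Expr := e + (f - e)

section eval

variable (s : State) (e f : Expr)

@[simp] theorem Expr.eval_zero : (0 : Expr).eval s = 0 := rfl
@[simp] theorem Expr.eval_one : (1 : Expr).eval s = 1 := rfl
@[simp] theorem Expr.eval_const (k : ℕ) : (Expr.const k).eval s = k := rfl
@[simp] theorem Expr.eval_get (a : ℕ) : (Expr.get a e).eval s = s a (e.eval s) := rfl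
@[simp] theorem Expr.eval_var (v : ℕ) : (Expr.var v).eval s = s v 0 := rfl
@[simp] theorem Expr.eval_add : (e + f).eval s = e.eval s + f.eval s := rfl
@[simp] theorem Expr.eval_sub : (e - f).eval s = e.eval s - f.eval s := rfl
@[simp] theorem Expr.eval_mul : (e * f).eval s = e.eval s * f.eval s := rfl
@[simp] theorem Expr.eval_div : (e / f).eval s = e.eval s / f.eval s := rfl

@[simp] theorem Expr.eval_lt : (e.lt f).eval s = if e.eval s < f.eval s then 1 else 0 := by
  simp only [Expr.lt, eval_sub, eval_one]; split_ifs <;> omega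

@[simp] theorem Expr.eval_le : (e.le f).eval s = if e.eval s ≤ f.eval s then 1 else 0 := by
  simp only [Expr.le, eval_sub, eval_one]; split_ifs <;> omega

@[simp] theorem Expr.eval_min : (e.min f).eval s = Min.min (e.eval s) (f.eval s) := by
  simp only [Expr.min, eval_sub]; omega

@[simp] theorem Expr.eval_max : (e.max f).eval s = Max.max (e.eval s) (f.eval s) := by
  simp only [Expr.max, eval_sub, eval_add]; omega

end eval

@[simp] theorem State.write_self (s : State) (a k v : ℕ) : s.write a k v a k = v := by
  simp [State.write]

@[simp] theorem State.write_of_ne (s : State) {a b : ℕ} (k v : ℕ) (h : b ≠ a) :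
    s.write a k v b = s b := by
  funext l; simp [State.write, h]

theorem State.write_apply (s : State) (a k v l : ℕ) :
    s.write a k v a l = if l = k then v else s a l := by
  simp [State.write]

/-- All memory cells hold numbers of at most `b` bits. -/
def Bdd (b : ℕ) (s : State) : Prop := ∀ a k, s a k < 2 ^ b

theorem Bdd.write {b : ℕ} {s : State} (h : Bdd b s) {a k v : ℕ} (hv : v < 2 ^ b) :
    Bdd b (s.write a k v) := by
  intro a' k'
  unfold State.write
  split_ifs
  · exact hv
  · exact h _ _

/-- The bit length of the value of `e` is at most `e.weight * (b + 1)` if every memory cell holds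
at most `b` bits. -/
def Expr.weight : Expr → ℕ
  | .const k => Nat.size k
  | .get _ _ => 1
  | .add e f => e.weight + f.weight + 1
  | .sub e _ => e.weight
  | .mul e f => e.weight + f.weight
  | .div e _ => e.weight

/-- The cost of evaluating `e` is at most `e.charge * (b + 1)` if every memory cell holds at most
`b` bits. -/
def Expr.charge : Expr → ℕ
  | .const k => 1 + Nat.size k
  | .get _ e => 2 + e.charge
  | .add e f => 1 + (Expr.add e f).weight + e.charge + f.charge
  | .sub e f => 1 + (Expr.sub e f).weight + e.charge + f.charge
  | .mul e f => 1 + (Expr.mul e f).weight + e.charge + f.charge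
  | .div e f => 1 + (Expr.div e f).weight + e.charge + f.charge

theorem Expr.size_eval_le {b : ℕ} {s : State} (h : Bdd b s) (e : Expr) :
    Nat.size (e.eval s) ≤ e.weight * (b + 1) := by
  induction e with
  | const k => simp only [Expr.eval, Expr.weight]; nlinarith [Nat.zero_le (Nat.size k)]
  | get a e _ =>
    have := Nat.size_le.2 (h a (e.eval s))
    simp only [Expr.eval, Expr.weight]; omega
  | add e f he hf =>
    have h1 := Nat.size_le.1 he
    have h2 := Nat.size_le.1 hf
    refine Nat.size_le.2 ?_
    simp only [Expr.eval, Expr.weight]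
    have h3 : e.eval s + f.eval s < 2 ^ (e.weight * (b + 1) + f.weight * (b + 1) + 1) := by
      have a1 : 2 ^ (e.weight * (b + 1)) ≤ 2 ^ (e.weight * (b + 1) + f.weight * (b + 1)) :=
        Nat.pow_le_pow_right (by norm_num) (by omega)
      have a2 : 2 ^ (f.weight * (b + 1)) ≤ 2 ^ (e.weight * (b + 1) + f.weight * (b + 1)) :=
        Nat.pow_le_pow_right (by norm_num) (by omega)
      rw [pow_succ]; omega
    refine h3.trans_le (Nat.pow_le_pow_right (by norm_num) ?_)
    nlinarith
  | sub e f he hf => exact (Nat.size_le_size (Nat.sub_le _ _)).trans he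
  | mul e f he hf =>
    refine Nat.size_le.2 ?_
    simp only [Expr.eval, Expr.weight, add_mul, pow_add _ (e.weight * (b + 1))]
    exact Nat.mul_lt_mul'' (Nat.size_le.1 he) (Nat.size_le.1 hf)
  | div e f he hf => exact (Nat.size_le_size (Nat.div_le_self _ _)).trans he

theorem Expr.cost_le {b : ℕ} {s : State} (h : Bdd b s) (e : Expr) :
    e.cost s ≤ e.charge * (b + 1) := by
  induction e with
  | const k => simp only [Expr.cost, Expr.charge]; nlinarith [Nat.zero_le (Nat.size k)]
  | get a e ih =>
    have := Expr.size_eval_le h (.get a e)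
    simp only [Expr.cost, Expr.charge, Expr.weight] at *; nlinarith
  | add e f he hf =>
    have := Expr.size_eval_le h (.add e f)
    simp only [Expr.cost, Expr.charge] at *; nlinarith
  | sub e f he hf =>
    have := Expr.size_eval_le h (.sub e f)
    simp only [Expr.cost, Expr.charge] at *; nlinarith
  | mul e f he hf =>
    have := Expr.size_eval_le h (.mul e f)
    simp only [Expr.cost, Expr.charge] at *; nlinarith
  | div e f he hf =>
    have := Expr.size_eval_le h (.div e f)
    simp only [Expr.cost, Expr.charge] at *; nlinarith

/-- Programs whose only loops are bounded: `iter i N c` runs `c` with the scalar variable `i` taking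
the values `0, 1, …` below the value of the scalar variable `N`. -/
inductive Cmd where
  | nop
  | set (a : ℕ) (i v : Expr)
  | seq (c d : Cmd)
  | ite (e : Expr) (c d : Cmd)
  | iter (i N : ℕ) (c : Cmd)

namespace Cmd

/-- The program that a command stands for; a bounded loop counts its variable up from `0`. -/
def toProgram : Cmd → Program
  | nop => .skip
  | set a i v => .store a i v
  | seq c d => .seq c.toProgram d.toProgram
  | ite e c d => .cond e c.toProgram d.toProgram
  | iter i N c => .seq (.store i 0 0)
      (.loop (.var N - .var i) (.seq c.toProgram (.store i 0 (.var i + 1))))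

/-- The arrays to which a command may write. -/
def writes : Cmd → List ℕ
  | nop => []
  | set a _ _ => [a]
  | seq c d => c.writes ++ d.writes
  | ite _ c d => c.writes ++ d.writes
  | iter i _ c => i :: c.writes

/-- The cost of running `c` is at most `c.charge.eval M * (b + 1)` if no loop has more than `M`
rounds and no memory cell ever holds more than `b` bits. -/
noncomputable def charge : Cmd → Polynomial ℕ
  | nop => 1
  | set _ i v => Polynomial.C (1 + i.charge + v.charge)
  | seq c d => 1 + c.charge + d.charge
  | ite e c d => Polynomial.C (1 + e.charge) + c.charge + d.charge
  | iter i N c => Polynomial.C (3 + (0 : Expr).charge + (0 : Expr).charge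
        + (Expr.var N - Expr.var i).charge)
      + Polynomial.X * (Polynomial.C (3 + (Expr.var N - Expr.var i).charge + (0 : Expr).charge +
          (Expr.var i + 1).charge) + c.charge)

/-- Total correctness with resource bounds: `c`, started in `s`, halts in a state satisfying `Q`
within the cost accounted for by `charge`, leaves all arrays outside `c.writes` alone, and ends with
at most `b` bits in each memory cell. -/
def Yields (b M : ℕ) (c : Cmd) (s : State) (Q : State → Prop) : Prop :=
  ∃ s' t, Exec c.toProgram s s' t ∧ t ≤ c.charge.eval M * (b + 1) ∧ Bdd b s' ∧
    (∀ a, a ∉ c.writes → s' a = s a) ∧ Q s'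

variable {b M : ℕ} {s : State} {Q : State → Prop}

theorem Yields.mono {c : Cmd} {R : State → Prop} (h : c.Yields b M s Q)
    (hQ : ∀ s', Bdd b s' → (∀ a, a ∉ c.writes → s' a = s a) → Q s' → R s') :
    c.Yields b M s R := by
  obtain ⟨s', t, h1, h2, h3, h4, h5⟩ := h
  exact ⟨s', t, h1, h2, h3, h4, hQ s' h3 h4 h5⟩

theorem yields_nop (hs : Bdd b s) (h : Q s) : nop.Yields b M s Q :=
  ⟨s, 1, .skip s, by simp [charge], hs, fun _ _ => rfl, h⟩

theorem yields_set {a : ℕ} {i v : Expr} (hs : Bdd b s) (hv : v.eval s < 2 ^ b)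
    (h : Q (s.write a (i.eval s) (v.eval s))) : (set a i v).Yields b M s Q := by
  refine ⟨_, _, .store a i v s, ?_, hs.write hv, ?_, h⟩
  · have := i.cost_le hs
    have := v.cost_le hs
    simp only [charge, Polynomial.eval_C]; nlinarith
  · intro a' ha'
    exact State.write_of_ne _ _ _ (by simpa [writes] using ha')

theorem yields_seq {c d : Cmd} (R : State → Prop) (h : c.Yields b M s R)
    (h' : ∀ s', Bdd b s' → (∀ a, a ∉ c.writes → s' a = s a) → R s' → d.Yields b M s' Q) :
    (seq c d).Yields b M s Q := by
  obtain ⟨s', t, h1, h2, h3, h4, h5⟩ := h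
  obtain ⟨s'', t', g1, g2, g3, g4, g5⟩ := h' s' h3 h4 h5
  refine ⟨s'', _, .seq h1 g1, ?_, g3, ?_, g5⟩
  · simp only [charge, Polynomial.eval_add, Polynomial.eval_one]; nlinarith
  · intro a ha
    simp only [writes, List.mem_append, not_or] at ha
    rw [g4 a ha.2, h4 a ha.1]

theorem yields_set_seq {a : ℕ} {i v : Expr} {d : Cmd} (hs : Bdd b s) (hv : v.eval s < 2 ^ b)
    (h : d.Yields b M (s.write a (i.eval s) (v.eval s)) Q) :
    (seq (set a i v) d).Yields b M s Q :=
  yields_seq (fun s' => s' = s.write a (i.eval s) (v.eval s)) (yields_set hs hv rfl)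
    (by rintro _ _ _ rfl; exact h)

theorem yields_ite {e : Expr} {c d : Cmd} (hs : Bdd b s)
    (h1 : e.eval s ≠ 0 → c.Yields b M s Q) (h2 : e.eval s = 0 → d.Yields b M s Q) :
    (ite e c d).Yields b M s Q := by
  have he := e.cost_le hs
  by_cases h : e.eval s = 0
  · obtain ⟨s', t, g1, g2, g3, g4, g5⟩ := h2 h
    refine ⟨s', _, .cond_false h g1, ?_, g3, fun a ha => g4 a ?_, g5⟩
    · simp only [charge, Polynomial.eval_add, Polynomial.eval_C]; nlinarith
    · simp only [writes, List.mem_append, not_or] at ha; exact ha.2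
  · obtain ⟨s', t, g1, g2, g3, g4, g5⟩ := h1 h
    refine ⟨s', _, .cond_true h g1, ?_, g3, fun a ha => g4 a ?_, g5⟩
    · simp only [charge, Polynomial.eval_add, Polynomial.eval_C]; nlinarith
    · simp only [writes, List.mem_append, not_or] at ha; exact ha.1

/-- The invariant rule for bounded loops. -/
theorem yields_iter {i N : ℕ} {c : Cmd} (P : ℕ → State → Prop) (hs : Bdd b s) (hM : s N 0 ≤ M)
    (hMb : M < 2 ^ b) (hi : i ∉ c.writes) (hN : N ∉ c.writes) (hiN : i ≠ N)
    (h0 : P 0 (s.write i 0 0))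
    (hstep : ∀ k < s N 0, ∀ st, Bdd b st → (∀ a, a ∉ i :: c.writes → st a = s a) → st i 0 = k →
      P k st → c.Yields b M st fun st' => P (k + 1) (st'.write i 0 (k + 1)))
    (hQ : ∀ st, P (s N 0) st → (∀ a, a ∉ i :: c.writes → st a = s a) → Q st) :
    (iter i N c).Yields b M s Q := by
  set e : Expr := .var N - .var i with he
  set K := 3 + e.charge + (0 : Expr).charge + (Expr.var i + 1).charge + c.charge.eval M with hK
  -- the loop, started in round `N - d`
  have key : ∀ d ≤ s N 0, ∀ st, Bdd b st → (∀ a, a ∉ i :: c.writes → st a = s a) →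
      st i 0 = s N 0 - d → P (s N 0 - d) st →
      ∃ s' t, Exec (.loop e (.seq c.toProgram (.store i 0 (.var i + 1)))) st s' t ∧
        t ≤ (1 + e.charge + d * K) * (b + 1) ∧ Bdd b s' ∧
        (∀ a, a ∉ i :: c.writes → s' a = s a) ∧ P (s N 0) s' := by
    intro d
    induction d with
    | zero =>
      intro _ st h1 h2 h3 h4
      have hst : st N 0 = s N 0 := by rw [h2 N (by simp [hN, Ne.symm hiN])]
      have hc := e.cost_le h1
      refine ⟨st, _, Exec.loop_stop ?_, ?_, h1, h2, by simpa using h4⟩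
      · simp [he, hst, h3]
      · nlinarith
    | succ d ih =>
      intro hd st h1 h2 h3 h4
      have hst : st N 0 = s N 0 := by rw [h2 N (by simp [hN, Ne.symm hiN])]
      obtain ⟨s1, t1, a1, a2, a3, a4, a5⟩ := hstep _ (by omega) st h1 h2 h3 h4
      have hs1 : s1 i 0 = s N 0 - (d + 1) := by rw [a4 i hi, h3]
      have hv : (Expr.var i + 1).eval s1 = s N 0 - d := by simp [hs1]; omega
      obtain ⟨s2, t2, b1, b2, b3, b4, b5⟩ := ih (by omega) (s1.write i 0 (s N 0 - d))
        (a3.write (by omega))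
        (fun a ha => by
          rw [State.write_of_ne _ _ _ (by simp only [List.mem_cons, not_or] at ha; exact ha.1),
            a4 a (fun h => ha (List.mem_cons_of_mem _ h)), h2 a ha])
        (by simp) (by have : s N 0 - (d + 1) + 1 = s N 0 - d := by omega
                      rwa [this] at a5)
      have hst1 : Exec (.store i 0 (Expr.var i + 1)) s1 (s1.write i 0 (s N 0 - d)) _ :=
        hv ▸ Exec.store i 0 (Expr.var i + 1) s1
      refine ⟨s2, _, .loop_step ?_ (.seq a1 hst1) b1, ?_, b3, b4, b5⟩
      · simp [he, hst, h3]
        omega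
      · have c1 := e.cost_le h1
        have c2 := (0 : Expr).cost_le a3
        have c3 := (Expr.var i + 1).cost_le a3
        rw [hK]
        simp only [hK] at b2
        nlinarith
  have hw : Bdd b (s.write i 0 0) := hs.write (by positivity)
  obtain ⟨s', t, g1, g2, g3, g4, g5⟩ := key (s N 0) le_rfl (s.write i 0 0) hw
    (fun a ha => State.write_of_ne _ _ _ (by simp only [List.mem_cons, not_or] at ha; exact ha.1))
    (by simp) (by simpa using h0)
  refine ⟨s', _, .seq (.store i 0 0 s) g1, ?_, g3, g4, hQ _ g5 g4⟩
  have c1 := (0 : Expr).cost_le hs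
  have c2 : s N 0 * K ≤ M * K := Nat.mul_le_mul_right _ hM
  have : (iter i N c).charge.eval M = 3 + (0 : Expr).charge + (0 : Expr).charge + e.charge
      + M * K := by
    simp [charge, hK, he]
  rw [this]
  nlinarith

end Cmd

end

section

variable {n m : ℕ}

/-! ### Processing capacity of machines -/

/-- The length of the part of the piece `x` that lies between the times `A` and `B`. -/
noncomputable def Piece.within (A B : ℝ) (x : Piece n m) : ℝ :=
  max 0 (min x.finish B - max x.start A)

theorem Piece.within_nonneg (A B : ℝ) (x : Piece n m) : 0 ≤ x.within A B := le_max_left _ _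

theorem Piece.within_add_within {A B C : ℝ} (hAB : A ≤ B) (hBC : B ≤ C) {x : Piece n m}
    (hx : x.start < x.finish) : x.within A C = x.within A B + x.within B C := by
  unfold Piece.within; grind

theorem Piece.within_eq {A B : ℝ} {x : Piece n m} (hx : x.start < x.finish) (hA : A ≤ x.start)
    (hB : x.finish ≤ B) : x.within A B = x.finish - x.start := by
  unfold Piece.within; grind

/-- The length of the part of `[s, f]` between `A` and `B`, as a difference of the end points
clipped to `[A, B]`. -/
theorem clip_eq {A B s f : ℝ} (hAB : A ≤ B) (h : s < f) :
    max 0 (min f B - max s A) = min B (max f A) - max A (min s B) := by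
  grind

/-- An interval `[a, b]` disjoint from `[s, f]` meets `[A, B]` only to the left of `s` or to the right
of `f`. -/
theorem clip_le {A B s f a b : ℝ} (hAB : A ≤ B) (hs : s < f) (ha : a < b) (h : f ≤ a ∨ b ≤ s) :
    max 0 (min b B - max a A) ≤ max 0 (min b (max A (min s B)) - max a A) +
      max 0 (min b B - max a (min B (max f A))) := by
  grind

/-- Pieces that do not overlap fit between `A` and `B` only if their total length does. -/
theorem sum_within_le (l : List (Piece n m))
    (h : l.Pairwise fun x y => x.finish ≤ y.start ∨ y.finish ≤ x.start)
    (hl : ∀ x ∈ l, x.start < x.finish) {A B : ℝ} (hAB : A ≤ B) :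
    (l.map (Piece.within A B)).sum ≤ B - A := by
  induction l generalizing A B with
  | nil => simpa using hAB
  | cons x l ih =>
    rw [List.pairwise_cons] at h
    have hx := hl x (by simp)
    have ih' := fun {A B : ℝ} => ih (A := A) (B := B) h.2 fun y hy => hl y (by simp [hy])
    -- the head piece occupies the interval from `s` to `f`, the others lie to its left or right
    set s := max A (min x.start B) with hs
    set f := min B (max x.finish A) with hf
    have hAs : A ≤ s := le_max_left _ _
    have hfB : f ≤ B := min_le_left _ _
    have hw : x.within A B = f - s := clip_eq hAB hx
    have hsplit : (l.map (Piece.within A B)).sum ≤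
        (l.map (Piece.within A s)).sum + (l.map (Piece.within f B)).sum := by
      rw [← List.sum_map_add]
      refine List.sum_le_sum fun y hy => ?_
      exact clip_le hAB hx (hl y (by simp [hy])) (h.1 y hy)
    have := ih' hAs
    have := ih' hfB
    simp only [List.map_cons, List.sum_cons]
    linarith

theorem sum_map_eq_sum_filter {α κ : Type*} [Fintype κ] [DecidableEq κ] (l : List α) (g : α → κ)
    (f : α → ℝ) : (l.map f).sum = ∑ k, ((l.filter fun x => g x = k).map f).sum := by
  induction l with
  | nil => simp
  | cons x l ih =>
    have : ∀ k, (((x :: l).filter fun x => g x = k).map f).sum =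
        (if g x = k then f x else 0) + ((l.filter fun x => g x = k).map f).sum := by
      intro k
      by_cases h : g x = k <;> simp [h]
    simp [this, Finset.sum_add_distrib, ih]

namespace Problem

variable {I : Problem n m} {σ : Schedule n m}

namespace IsSchedule

theorem exists_piece (h : I.IsSchedule σ) (j : Fin n) : ∃ x ∈ σ, x.job = j := by
  by_contra! hc
  have h1 := h.processed j
  rw [List.filter_eq_nil_iff.2 (by simpa using hc)] at h1
  have := I.p_pos j
  simp only [List.map_nil, List.sum_nil] at h1
  have : I.p j = 0 := by exact_mod_cast h1.symm
  omega

theorem finite_starts (σ : Schedule n m) (j : Fin n) :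
    {t | ∃ x ∈ σ, x.job = j ∧ x.start = t}.Finite :=
  ((List.finite_toSet σ).image Piece.start).subset
    (by rintro _ ⟨x, hx, -, rfl⟩; exact ⟨x, hx, rfl⟩)

theorem finite_finishes (σ : Schedule n m) (j : Fin n) :
    {t | ∃ x ∈ σ, x.job = j ∧ x.finish = t}.Finite :=
  ((List.finite_toSet σ).image Piece.finish).subset
    (by rintro _ ⟨x, hx, -, rfl⟩; exact ⟨x, hx, rfl⟩)

theorem startTime_le {x : Piece n m} (hx : x ∈ σ) : σ.startTime x.job ≤ x.start :=
  csInf_le (finite_starts σ _).bddBelow ⟨x, hx, rfl, rfl⟩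

theorem le_completionTime {x : Piece n m} (hx : x ∈ σ) : x.finish ≤ σ.completionTime x.job :=
  le_csSup (finite_finishes σ _).bddAbove ⟨x, hx, rfl, rfl⟩

theorem le_startTime (h : I.IsSchedule σ) {j : Fin n} {t : ℝ}
    (ht : ∀ x ∈ σ, x.job = j → t ≤ x.start) : t ≤ σ.startTime j := by
  obtain ⟨x, hx, hj⟩ := h.exists_piece j
  refine le_csInf ⟨_, x, hx, hj, rfl⟩ ?_
  rintro _ ⟨y, hy, hyj, rfl⟩
  exact ht y hy hyj

theorem completionTime_le (h : I.IsSchedule σ) {j : Fin n} {t : ℝ}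
    (ht : ∀ x ∈ σ, x.job = j → x.finish ≤ t) : σ.completionTime j ≤ t := by
  obtain ⟨x, hx, hj⟩ := h.exists_piece j
  refine csSup_le ⟨_, x, hx, hj, rfl⟩ ?_
  rintro _ ⟨y, hy, hyj, rfl⟩
  exact ht y hy hyj

theorem completionTime_le_makespan (σ : Schedule n m) (j : Fin n) :
    σ.completionTime j ≤ σ.makespan :=
  le_ciSup (Set.finite_range _).bddAbove j

theorem pairwise_job (h : I.IsSchedule σ) (j : Fin n) :
    (σ.filter fun x => x.job = j).Pairwise
      fun x y => x.finish ≤ y.start ∨ y.finish ≤ x.start := by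
  refine List.Pairwise.imp_of_mem ?_ (h.no_overlap.sublist List.filter_sublist)
  intro x y hx hy hxy
  simp only [List.mem_filter, decide_eq_true_eq] at hx hy
  exact hxy (Or.inr (hx.2.trans hy.2.symm))

theorem pairwise_machine (h : I.IsSchedule σ) (k : Fin m) :
    (σ.filter fun x => x.machine = k).Pairwise
      fun x y => x.finish ≤ y.start ∨ y.finish ≤ x.start := by
  refine List.Pairwise.imp_of_mem ?_ (h.no_overlap.sublist List.filter_sublist)
  intro x y hx hy hxy
  simp only [List.mem_filter, decide_eq_true_eq] at hx hy
  exact hxy (Or.inl (hx.2.trans hy.2.symm))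

/-- No job can be processed faster than one unit of work per unit of time. -/
theorem startTime_add_le_completionTime (h : I.IsSchedule σ) (j : Fin n) :
    σ.startTime j + I.p j ≤ σ.completionTime j := by
  have hpos : ∀ x ∈ σ.filter fun x => x.job = j, x.start < x.finish := fun x hx =>
    h.start_lt_finish x (List.mem_of_mem_filter hx)
  have hle : σ.startTime j ≤ σ.completionTime j := by
    obtain ⟨x, hx, rfl⟩ := h.exists_piece j
    exact (startTime_le hx).trans ((h.start_lt_finish x hx).le.trans (le_completionTime hx))
  have h1 := sum_within_le _ (h.pairwise_job j) hpos hle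
  rw [← h.processed j]
  rw [List.map_congr_left (g := fun x => x.finish - x.start)] at h1
  · linarith
  · intro x hx
    simp only [List.mem_filter, decide_eq_true_eq] at hx
    obtain ⟨hx, rfl⟩ := hx
    exact Piece.within_eq (h.start_lt_finish x hx) (startTime_le hx) (le_completionTime hx)

theorem startTime_lt_completionTime (h : I.IsSchedule σ) (j : Fin n) :
    σ.startTime j < σ.completionTime j := by
  have := h.startTime_add_le_completionTime j
  have : (0 : ℝ) < I.p j := by exact_mod_cast I.p_pos j
  linarith

theorem startTime_nonneg (h : I.IsSchedule σ) (j : Fin n) : 0 ≤ σ.startTime j :=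
  h.le_startTime fun x hx _ => h.start_nonneg x hx

end IsSchedule

end Problem

/-- The amount of work at head at least `x`, if `rem j` units of job `j` are left and the `u`-th
unit of job `j` has head `S j + u`. -/
noncomputable def headWork {ι : Type*} [Fintype ι] (S rem : ι → ℝ) (x : ℝ) : ℝ :=
  ∑ j, min (rem j) (max 0 (S j + rem j - x))

/-- Work with head at least `x` is processed after time `x`, on at most `m` machines at a time. -/
theorem Problem.IsSchedule.headWork_le {I : Problem n m} {σ : Schedule n m} (h : I.IsSchedule σ)
    {S : Fin n → ℕ} (hS : ∀ j, (S j : ℝ) ≤ σ.startTime j) {x : ℝ} (hx : x ≤ σ.makespan) :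
    headWork (fun j => (S j : ℝ)) (fun j => (I.p j : ℝ)) x ≤ m * (σ.makespan - x) := by
  have hjob : ∀ j, min (I.p j : ℝ) (max 0 ((S j : ℝ) + I.p j - x)) ≤
      ((σ.filter fun y => y.job = j).map (Piece.within x σ.makespan)).sum := by
    intro j
    set l := σ.filter fun y => y.job = j
    have hpos : ∀ y ∈ l, y.start < y.finish := fun y hy =>
      h.start_lt_finish y (List.mem_of_mem_filter hy)
    have h1 := sum_within_le l (h.pairwise_job j) hpos (min_le_right (S j : ℝ) x)
    have h2 : (I.p j : ℝ) = (l.map (Piece.within (min (S j : ℝ) x) x)).sum +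
        (l.map (Piece.within x σ.makespan)).sum := by
      rw [← h.processed j, ← List.sum_map_add]
      congr 1
      refine List.map_congr_left fun y hy => ?_
      have hy' := hpos y hy
      simp only [List.mem_filter, decide_eq_true_eq] at hy
      obtain ⟨hy, rfl⟩ := hy
      rw [← Piece.within_add_within (min_le_right _ _) hx hy', Piece.within_eq hy']
      · exact (min_le_left _ _).trans ((hS _).trans (IsSchedule.startTime_le hy))
      · exact (IsSchedule.le_completionTime hy).trans
          (IsSchedule.completionTime_le_makespan σ _)
    have h3 : 0 ≤ (l.map (Piece.within x σ.makespan)).sum :=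
      List.sum_nonneg (by
        simp only [List.mem_map]; rintro _ ⟨y, -, rfl⟩; exact Piece.within_nonneg _ _ _)
    grind
  calc headWork (fun j => (S j : ℝ)) (fun j => (I.p j : ℝ)) x
      ≤ ∑ j, ((σ.filter fun y => y.job = j).map (Piece.within x σ.makespan)).sum :=
        Finset.sum_le_sum fun j _ => hjob j
    _ = ∑ k : Fin m, ((σ.filter fun y => y.machine = k).map (Piece.within x σ.makespan)).sum := by
        rw [← sum_map_eq_sum_filter, ← sum_map_eq_sum_filter]
    _ ≤ ∑ _k : Fin m, (σ.makespan - x) := by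
        refine Finset.sum_le_sum fun k _ => sum_within_le _ (h.pairwise_machine k) ?_ hx
        exact fun y hy => h.start_lt_finish y (List.mem_of_mem_filter hy)
    _ = m * (σ.makespan - x) := by simp [mul_sub]

/-! ### Earliest starts -/

namespace Problem

variable (I : Problem n m)

/-- `I.StartValue j v`: the path recursion of the earliest start schedule, along some path of
the precedence graph from a job without predecessors to `j`, arrives at the value `v`. -/
inductive StartValue : Fin n → ℕ → Prop where
  | source {j : Fin n} : I.IsSource j → StartValue j (I.r j)
  | step {i j : Fin n} {v : ℕ} : StartValue i v → I.G.Adj i j →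
      StartValue j (max (I.r j) (v + I.p i))

variable {I}

/-- Every feasible schedule starts each job at or after the value of some path: otherwise, consider
a job with the smallest start for which this fails. -/
theorem OrFeasible.exists_startValue {σ : Schedule n m} (h : I.OrFeasible σ) (j : Fin n) :
    ∃ v, I.StartValue j v ∧ (v : ℝ) ≤ σ.startTime j := by
  by_contra hj
  obtain ⟨j, hj, hmin⟩ := Set.exists_min_image
    {j | ¬ ∃ v, I.StartValue j v ∧ (v : ℝ) ≤ σ.startTime j} σ.startTime (Set.toFinite _) ⟨j, hj⟩
  refine hj ?_
  by_cases hs : I.IsSource j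
  · exact ⟨_, .source hs, h.release j⟩
  · obtain ⟨i, hi, hij⟩ := h.prec j hs
    have h1 : ∃ v, I.StartValue i v ∧ (v : ℝ) ≤ σ.startTime i := by
      by_contra hc
      have := hmin i hc
      have := h.isSchedule.startTime_lt_completionTime i
      linarith
    obtain ⟨v, hv, hvi⟩ := h1
    refine ⟨_, .step hv hi, ?_⟩
    have := h.isSchedule.startTime_add_le_completionTime i
    push_cast
    exact max_le (h.release j) (by linarith)

theorem IsEarliestStart.le_startValue {S : Fin n → ℕ} (hS : I.IsEarliestStart S) {j : Fin n}
    {v : ℕ} (h : I.StartValue j v) : S j ≤ v := by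
  induction h with
  | source hj => exact (hS.1 _ hj).le
  | @step i j v _ hij ih =>
    rw [hS.2 j fun h => h i hij]
    have : sInf {c | ∃ i, I.G.Adj i j ∧ c = S i + I.p i} ≤ S i + I.p i :=
      Nat.sInf_le ⟨i, hij, rfl⟩
    exact max_le_max le_rfl (by omega)

theorem IsEarliestStart.le_of_adj {S : Fin n → ℕ} (hS : I.IsEarliestStart S) {i j : Fin n}
    (hij : I.G.Adj i j) : S j ≤ max (I.r j) (S i + I.p i) := by
  rw [hS.2 j fun h => h i hij]
  exact max_le_max le_rfl (Nat.sInf_le ⟨i, hij, rfl⟩)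

theorem IsEarliestStart.release_le {S : Fin n → ℕ} (hS : I.IsEarliestStart S) (j : Fin n) :
    I.r j ≤ S j := by
  by_cases h : I.IsSource j
  · exact (hS.1 j h).ge
  · rw [hS.2 j h]; exact le_max_left _ _

/-- The arc from `i` to `j` belongs to the precedence graph and determines the earliest start of
`j`. -/
def Tight (I : Problem n m) (S : Fin n → ℕ) (i j : Fin n) : Prop :=
  I.G.Adj i j ∧ S j = max (I.r j) (S i + I.p i)

theorem Tight.add_le {S : Fin n → ℕ} {i j : Fin n} (h : I.Tight S i j) : S i + I.p i ≤ S j :=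
  h.2 ▸ le_max_right _ _

theorem Tight.lt {S : Fin n → ℕ} {i j : Fin n} (h : I.Tight S i j) : S i < S j := by
  have := h.add_le
  have := I.p_pos i
  omega

theorem IsEarliestStart.tight_iff {S : Fin n → ℕ} (hS : I.IsEarliestStart S) {i j : Fin n} :
    I.Tight S i j ↔ I.G.Adj i j ∧ S i + I.p i ≤ S j := by
  refine ⟨fun h => ⟨h.1, h.add_le⟩, fun h => ⟨h.1, le_antisymm (hS.le_of_adj h.1) ?_⟩⟩
  exact max_le (hS.release_le j) h.2

theorem IsEarliestStart.exists_tight {S : Fin n → ℕ} (hS : I.IsEarliestStart S) {j : Fin n}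
    (hj : ¬ I.IsSource j) : ∃ i, I.Tight S i j := by
  have hne : {c | ∃ i, I.G.Adj i j ∧ c = S i + I.p i}.Nonempty := by
    unfold IsSource at hj
    push Not at hj
    obtain ⟨i, hi⟩ := hj
    exact ⟨_, i, hi, rfl⟩
  obtain ⟨i, hi, hc⟩ := Nat.sInf_mem hne
  exact ⟨i, hi, by rw [hS.2 j hj, hc]⟩

theorem IsEarliestStart.startValue {S : Fin n → ℕ} (hS : I.IsEarliestStart S) (j : Fin n) :
    I.StartValue j (S j) := by
  induction h : S j using Nat.strong_induction_on generalizing j with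
  | _ v ih =>
    by_cases hj : I.IsSource j
    · rw [← h, hS.1 j hj]; exact .source hj
    · obtain ⟨i, hi⟩ := hS.exists_tight hj
      rw [← h, hi.2]
      exact .step (ih _ (h ▸ hi.lt) i rfl) hi.1

theorem IsEarliestStart.eq {S S' : Fin n → ℕ} (hS : I.IsEarliestStart S)
    (hS' : I.IsEarliestStart S') : S = S' :=
  funext fun j => le_antisymm (hS.le_startValue (hS'.startValue j))
    (hS'.le_startValue (hS.startValue j))

/-- If every job is reachable from a job without predecessors, then the smallest path values are
the earliest starts. -/
theorem isEarliestStart_sInf (h : ∀ j, ∃ v, I.StartValue j v) :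
    I.IsEarliestStart fun j => sInf {v | I.StartValue j v} := by
  refine ⟨fun j hj => ?_, fun j hj => ?_⟩
  · have h1 : {v | I.StartValue j v} = {I.r j} := by
      ext v
      simp only [Set.mem_ofPred_eq, Set.mem_singleton_iff]
      refine ⟨fun hv => ?_, ?_⟩
      · cases hv with
        | source => rfl
        | step _ hij => exact absurd hij (hj _)
      · rintro rfl
        exact .source hj
    simp [h1]
  · set c := sInf {c | ∃ i, I.G.Adj i j ∧ c = sInf {v | I.StartValue i v} + I.p i} with hc
    have hmem : I.StartValue j (sInf {v | I.StartValue j v}) := Nat.sInf_mem (h j)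
    refine le_antisymm ?_ ?_
    · have hne : {c | ∃ i, I.G.Adj i j ∧ c = sInf {v | I.StartValue i v} + I.p i}.Nonempty := by
        unfold IsSource at hj
        push Not at hj
        obtain ⟨i, hi⟩ := hj
        exact ⟨_, i, hi, rfl⟩
      obtain ⟨i, hi, hci⟩ := Nat.sInf_mem hne
      refine Nat.sInf_le ?_
      simp only [Set.mem_ofPred_eq]
      rw [hc, hci]
      exact .step (Nat.sInf_mem (h i)) hi
    · change max (I.r j) c ≤ sInf {v | I.StartValue j v}
      generalize sInf {v | I.StartValue j v} = v at hmem ⊢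
      cases hmem with
      | source hs => exact absurd hs hj
      | @step i _ v hv hij =>
        have h1 : c ≤ sInf {v | I.StartValue i v} + I.p i := Nat.sInf_le ⟨i, hij, rfl⟩
        have h2 : sInf {v | I.StartValue i v} ≤ v := Nat.sInf_le hv
        exact max_le_max le_rfl (by omega)

theorem OrFeasible.exists_isEarliestStart {σ : Schedule n m} (h : I.OrFeasible σ) :
    ∃ S, I.IsEarliestStart S :=
  ⟨_, isEarliestStart_sInf fun j => (h.exists_startValue j).imp fun _ hv => hv.1⟩

theorem IsEarliestStart.le_startTime {S : Fin n → ℕ} (hS : I.IsEarliestStart S)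
    {σ : Schedule n m} (h : I.OrFeasible σ) (j : Fin n) : (S j : ℝ) ≤ σ.startTime j := by
  obtain ⟨v, hv, hle⟩ := h.exists_startValue j
  exact le_trans (by exact_mod_cast hS.le_startValue hv) hle

end Problem

end

section

variable {n m : ℕ}

/-! ### Minimal chains -/

namespace Problem

variable {I : Problem n m} {S : Fin n → ℕ}

theorem pairwise_of_chain {l : List (Fin n)} (h : l.IsChain (I.Tight S)) :
    l.Pairwise fun i j => S i + I.p i ≤ S j := by
  have : l.IsChain fun i j => S i + I.p i ≤ S j := h.imp fun _ _ hij => hij.add_le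
  refine @List.IsChain.pairwise _ _ _ ⟨fun hab hbc => ?_⟩ this
  omega

/-- A path as in the definition of a chain of `k`, as a list. -/
def TightList (I : Problem n m) (S : Fin n → ℕ) (k : Fin n) (l : List (Fin n)) : Prop :=
  (∃ j₁, l.head? = some j₁ ∧ I.IsSource j₁) ∧ l.getLast? = some k ∧ l.IsChain (I.Tight S)

theorem IsEarliestStart.isTightPath_iff (hS : I.IsEarliestStart S) {k : Fin n}
    {L : Finset (Fin n)} : I.IsTightPath S k L ↔ ∃ l, I.TightList S k l ∧ l.toFinset = L := by
  constructor
  · rintro ⟨j₁, l, h1, h2, -, h3, h4⟩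
    exact ⟨j₁ :: l, ⟨⟨j₁, rfl, h2⟩, h3, h4⟩, h1⟩
  · rintro ⟨l, ⟨⟨j₁, h1, h2⟩, h3, h4⟩, h5⟩
    cases l with
    | nil => simp at h1
    | cons a l =>
      obtain rfl : a = j₁ := by simpa using h1
      exact ⟨a, l, h5, h2, hS.1 _ h2, h3, h4⟩

theorem tightList_singleton {k : Fin n} (hk : I.IsSource k) : I.TightList S k [k] :=
  ⟨⟨k, rfl, hk⟩, rfl, by simp⟩

theorem TightList.concat {i k : Fin n} {l : List (Fin n)} (h : I.TightList S i l)
    (hik : I.Tight S i k) : I.TightList S k (l ++ [k]) := by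
  obtain ⟨⟨j₁, h1, h2⟩, h3, h4⟩ := h
  refine ⟨⟨j₁, by simp [h1], h2⟩, by simp, ?_⟩
  rw [List.isChain_append]
  refine ⟨h4, by simp, ?_⟩
  intro x hx y hy
  obtain rfl : i = x := by simpa [h3] using hx
  obtain rfl : k = y := by simpa using hy
  exact hik

/-- A chain of a job with predecessors is a chain of a predecessor, followed by the job. -/
theorem TightList.exists_concat {k : Fin n} {l : List (Fin n)} (h : I.TightList S k l)
    (hk : ¬ I.IsSource k) : ∃ i l', I.TightList S i l' ∧ I.Tight S i k ∧ l = l' ++ [k] := by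
  obtain ⟨⟨j₁, h1, h2⟩, h3, h4⟩ := h
  rcases List.eq_nil_or_concat' l with rfl | ⟨l', b, rfl⟩
  · simp at h1
  · obtain rfl : b = k := by simpa using h3
    rw [List.isChain_append] at h4
    cases hl : l'.getLast? with
    | none =>
      obtain rfl : l' = [] := by simpa using hl
      obtain rfl : b = j₁ := by simpa using h1
      exact absurd h2 hk
    | some i =>
      refine ⟨i, l', ⟨⟨j₁, ?_, h2⟩, hl, h4.1⟩, h4.2.2 i hl b (by simp), rfl⟩
      cases l' with
      | nil => simp at hl
      | cons a l' => simpa using h1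

theorem TightList.le {i k : Fin n} {l : List (Fin n)} (h : I.TightList S k l) (hi : i ∈ l) :
    i = k ∨ S i + I.p i ≤ S k := by
  obtain ⟨-, h3, h4⟩ := h
  rcases List.eq_nil_or_concat' l with rfl | ⟨l', b, rfl⟩
  · simp at hi
  · obtain rfl : b = k := by simpa using h3
    have := pairwise_of_chain h4
    rw [List.pairwise_append] at this
    rcases List.mem_append.1 hi with h | h
    · exact Or.inr (this.2.2 i h b (by simp))
    · exact Or.inl (by simpa using h)

theorem TightList.prefix {i k : Fin n} {l : List (Fin n)} (h : I.TightList S k l) (hi : i ∈ l) :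
    ∃ l' ⊆ l, I.TightList S i l' := by
  obtain ⟨⟨j₁, h1, h2⟩, h3, h4⟩ := h
  obtain ⟨l₁, l₂, rfl⟩ := List.append_of_mem hi
  refine ⟨l₁ ++ [i], by simp, ⟨j₁, ?_, h2⟩, by simp, ?_⟩
  · cases l₁ <;> simpa using h1
  · refine h4.prefix ⟨l₂, by simp⟩

/-- In a minimal chain of `k`, the job before `k` is the only one with an arc to `k`: another arc
would be a short cut. -/
theorem IsMinimalChain.exists_unique_adj (hS : I.IsEarliestStart S) {k : Fin n}
    {L : Finset (Fin n)} (hL : I.IsMinimalChain k L) (hk : ¬ I.IsSource k) :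
    ∃ i, I.Tight S i k ∧ ∀ i', (I.G.Adj i' k ∧ i' ∈ L ∧ i' ≠ k) ↔ i' = i := by
  obtain ⟨S', hS', hmin⟩ := hL
  obtain rfl := hS.eq hS'
  obtain ⟨l, hl, rfl⟩ := hS.isTightPath_iff.1 hmin.1
  obtain ⟨i, l', hl', hik, rfl⟩ := hl.exists_concat hk
  have hil' : i ∈ l' := List.mem_of_getLast? hl'.2.1
  have hne : i ≠ k := by rintro rfl; exact lt_irrefl _ hik.lt
  refine ⟨i, hik, fun i' => ⟨?_, ?_⟩⟩
  · rintro ⟨h1, h2, h3⟩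
    by_contra hi'
    have hi'l : i' ∈ l' := by simpa [h3] using h2
    have hlt : S i' + I.p i' ≤ S i := (hl'.le hi'l).resolve_left hi'
    have htight : I.Tight S i' k := hS.tight_iff.2 ⟨h1, by have := hik.lt; omega⟩
    obtain ⟨l₁, hsub, hl₁⟩ := hl'.prefix hi'l
    have hle : (l₁ ++ [k]).toFinset ≤ (l' ++ [k]).toFinset := by
      intro x
      simp only [List.mem_toFinset, List.mem_append]
      exact Or.imp_left fun h => hsub h
    have hmem := hmin.2 (hS.isTightPath_iff.2 ⟨_, hl₁.concat htight, rfl⟩) hle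
      (show i ∈ (l' ++ [k]).toFinset by simp [hil'])
    have hi₁ : i ∈ l₁ := by simpa [hne] using hmem
    have := I.p_pos i'
    have := I.p_pos i
    rcases hl₁.le hi₁ with h | h
    · exact hi' h.symm
    · omega
  · rintro rfl
    exact ⟨hik.1, by simp [hil'], hne⟩

/-- A forest of arcs that determine the earliest starts, given by the predecessor of each job. -/
structure IsTightForest (I : Problem n m) (S : Fin n → ℕ) (par : Fin n → Option (Fin n)) : Prop where
  tight : ∀ {i j}, par j = some i → I.Tight S i j
  eq_none : ∀ {j}, par j = none → I.IsSource j

theorem IsTightForest.ne_none {par : Fin n → Option (Fin n)} (h : I.IsTightForest S par) {j : Fin n}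
    (hj : I.IsSource j) : par j = none := by
  cases hp : par j with
  | none => rfl
  | some i => exact absurd (h.tight hp).1 (hj i)

/-- The arcs that survive in the pruned graph form a forest of tight arcs. -/
theorem IsClosedCollection.exists_forest (hS : I.IsEarliestStart S) {L : Fin n → Finset (Fin n)}
    (hL : I.IsClosedCollection L) :
    ∃ par, I.IsTightForest S par ∧ ∀ i j, (I.prune L).G.Adj i j ↔ par j = some i := by
  classical
  have h : ∀ j, ∃ o : Option (Fin n), (∀ i, o = some i → I.Tight S i j) ∧
      (o = none → I.IsSource j) ∧ ∀ i, (I.prune L).G.Adj i j ↔ o = some i := by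
    intro j
    by_cases hj : I.IsSource j
    · exact ⟨none, by simp, fun _ => hj, fun i => ⟨fun h => absurd h.1 (hj i), by simp⟩⟩
    · obtain ⟨i, hi, hiff⟩ := (hL.1 j).exists_unique_adj hS hj
      refine ⟨some i, by rintro _ ⟨⟩; exact hi, by simp, fun i' => ?_⟩
      rw [Option.some_inj, eq_comm, ← hiff i']
      rfl
  choose par h1 h2 h3 using h
  exact ⟨par, ⟨fun h => h1 _ _ h, fun h => h2 _ h⟩, fun i j => h3 j i⟩

theorem IsTightForest.isOutforest {par : Fin n → Option (Fin n)} (h : I.IsTightForest S par)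
    {G : Digraph (Fin n)} (hG : ∀ i j, G.Adj i j ↔ par j = some i) : IsOutforest G := by
  refine ⟨fun i i' j hi hi' => ?_, fun v hv => ?_⟩
  · rw [hG] at hi hi'
    exact Option.some_inj.1 (hi.symm.trans hi')
  · have : ∀ w, Relation.TransGen G.Adj v w → S v < S w := by
      intro w hw
      induction hw with
      | single h' => exact (h.tight ((hG _ _).1 h')).lt
      | tail _ h' ih => exact ih.trans (h.tight ((hG _ _).1 h')).lt
    exact lt_irrefl _ (this v hv)

open Classical in
/-- The chain of `j` in a forest: `j`, its predecessor, the predecessor of its predecessor, … -/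
noncomputable def forestChain (par : Fin n → Option (Fin n)) (j : Fin n) : Finset (Fin n) :=
  Finset.univ.filter fun i => Relation.ReflTransGen (fun i j => par j = some i) i j

theorem mem_forestChain {par : Fin n → Option (Fin n)} {i j : Fin n} :
    i ∈ forestChain par j ↔ Relation.ReflTransGen (fun i j => par j = some i) i j := by
  simp [forestChain]

theorem mem_forestChain_iff {par : Fin n → Option (Fin n)} {i j : Fin n} :
    i ∈ forestChain par j ↔ i = j ∨ ∃ k, par j = some k ∧ i ∈ forestChain par k := by
  simp only [mem_forestChain]
  rw [Relation.ReflTransGen.cases_tail_iff]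
  constructor
  · rintro (h | ⟨k, h1, h2⟩)
    · exact Or.inl h.symm
    · exact Or.inr ⟨k, h2, h1⟩
  · rintro (h | ⟨k, h1, h2⟩)
    · exact Or.inl h.symm
    · exact Or.inr ⟨k, h2, h1⟩

/-- Along a chain, each job ends before the next one starts in the earliest start schedule. -/
theorem IsTightForest.add_le_of_mem {par : Fin n → Option (Fin n)} (h : I.IsTightForest S par)
    {i j : Fin n} (hi : i ∈ forestChain par j) : i = j ∨ S i + I.p i ≤ S j := by
  rw [mem_forestChain] at hi
  induction hi with
  | refl => exact Or.inl rfl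
  | tail _ hbc ih =>
    have h1 := (h.tight hbc).lt
    have h2 := (h.tight hbc).add_le
    rcases ih with rfl | ih
    · exact Or.inr h2
    · exact Or.inr (ih.trans h1.le)

/-- If each job with predecessors picks, among the tight arcs to it, one from a job with the smallest
earliest start, the chains in the resulting forest are minimal: a chain inside such a chain cannot
skip a job, as the arc that skips it comes from a job with a smaller earliest start. -/
theorem IsTightForest.isClosedCollection (hS : I.IsEarliestStart S)
    {par : Fin n → Option (Fin n)} (h : I.IsTightForest S par)
    (hmin : ∀ {i i' j}, par j = some i → I.Tight S i' j → S i ≤ S i') :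
    I.IsClosedCollection (forestChain par) := by
  refine ⟨fun j => ⟨S, hS, hS.isTightPath_iff.2 ?_, fun L hL hle => ?_⟩, fun j i hi i' hi' => ?_⟩
  · induction hv : S j using Nat.strong_induction_on generalizing j with
    | _ v ih =>
      cases hp : par j with
      | none =>
        refine ⟨[j], tightList_singleton (h.eq_none hp), ?_⟩
        ext i
        rw [mem_forestChain_iff]
        simp [hp]
      | some k =>
        obtain ⟨l, hl, hlk⟩ := ih _ (hv ▸ (h.tight hp).lt) k rfl
        refine ⟨l ++ [j], hl.concat (h.tight hp), ?_⟩
        ext i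
        rw [mem_forestChain_iff]
        simp only [List.toFinset_append, hlk, hp]
        simp
  · obtain ⟨l, hl, rfl⟩ := hS.isTightPath_iff.1 hL
    clear hL
    induction hv : S j using Nat.strong_induction_on generalizing j l with
    | _ v ih =>
      have hjl : j ∈ l := List.mem_of_getLast? hl.2.1
      cases hp : par j with
      | none =>
        intro i hi
        rw [mem_forestChain_iff] at hi
        obtain rfl : i = j := by simpa [hp] using hi
        simpa using hjl
      | some k =>
        have hj : ¬ I.IsSource j := fun hj => (hj k) (h.tight hp).1
        obtain ⟨i, l', hl', hij, rfl⟩ := hl.exists_concat hj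
        have hsub : ∀ x ∈ l', x ∈ forestChain par k := by
          intro x hx
          have hxj : x ≠ j := by
            rintro rfl
            have := hij.lt
            rcases hl'.le hx with rfl | h'
            · omega
            · omega
          have := hle (show x ∈ (l' ++ [j]).toFinset by simp [hx])
          rw [mem_forestChain_iff] at this
          simpa [hxj, hp] using this
        have hik : i = k := by
          have h1 := hsub i (List.mem_of_getLast? hl'.2.1)
          have h2 := hmin hp hij
          have h3 := I.p_pos i
          rcases h.add_le_of_mem h1 with h4 | h4
          · exact h4
          · omega
        subst hik
        have := ih _ (hv ▸ hij.lt) i l' hl'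
          (by intro x hx; exact hsub x (by simpa using hx)) rfl
        intro x hx
        rw [mem_forestChain_iff] at hx
        rcases hx with rfl | ⟨k, hk, hx⟩
        · simp
        · obtain rfl : i = k := by simpa [hp] using hk
          have := this hx
          simp only [List.mem_toFinset] at this
          simp [this]
  · rw [mem_forestChain] at *
    exact hi'.trans hi

theorem IsEarliestStart.exists_isClosedCollection (hS : I.IsEarliestStart S) :
    ∃ L, I.IsClosedCollection L := by
  classical
  have h : ∀ j, ∃ o : Option (Fin n), (∀ i, o = some i → I.Tight S i j ∧
      ∀ i', I.Tight S i' j → S i ≤ S i') ∧ (o = none → I.IsSource j) := by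
    intro j
    by_cases hj : I.IsSource j
    · exact ⟨none, by simp, fun _ => hj⟩
    · obtain ⟨i, hi, hle⟩ := Set.exists_min_image {i | I.Tight S i j} S (Set.toFinite _)
        (hS.exists_tight hj)
      exact ⟨some i, by rintro _ ⟨⟩; exact ⟨hi, hle⟩, by simp⟩
  choose par h1 h2 using h
  refine ⟨forestChain par, IsTightForest.isClosedCollection hS ⟨fun h => (h1 _ _ h).1, fun h => h2 _ h⟩ ?_⟩
  exact fun h => (h1 _ _ h).2 _

/-- AND-feasibility for the forest implies OR-feasibility: every job with predecessors keeps one of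
them. -/
theorem IsTightForest.orFeasible {par : Fin n → Option (Fin n)} (h : I.IsTightForest S par)
    {L : Fin n → Finset (Fin n)} (hL : ∀ i j, (I.prune L).G.Adj i j ↔ par j = some i)
    {σ : Schedule n m} (hσ : (I.prune L).AndFeasible σ) : I.OrFeasible σ := by
  refine ⟨⟨hσ.1.1, hσ.1.2, hσ.1.3, hσ.1.4⟩, hσ.2, fun j hj => ?_⟩
  cases hp : par j with
  | none => exact absurd (h.eq_none hp) hj
  | some i => exact ⟨i, (h.tight hp).1, hσ.prec i j ((hL i j).2 hp)⟩

end Problem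

end

section

variable {n m : ℕ}

/-! ### The level algorithm, backwards in time -/

open Finset in
/-- The function `x ↦ m * x + headWork x` has its maximum at an earliest start or at the latest
head: it increases where at most `m` jobs pass the head `x`, and decreases elsewhere. -/
theorem headWork_le_of_forall_start {S p : Fin n → ℝ} {T : ℝ} (hp : ∀ j, 0 ≤ p j)
    (h1 : ∀ j, S j + p j ≤ T) (h2 : ∀ j, headWork S p (S j) ≤ m * (T - S j)) {x : ℝ} (hx : x ≤ T) :
    headWork S p x ≤ m * (T - x) := by
  set A := univ.filter fun i => S i ≤ x ∧ x < S i + p i with hA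
  have hmemA : ∀ i, i ∈ A ↔ S i ≤ x ∧ x < S i + p i := by simp [hA]
  -- moving from `x` to the right, up to the next earliest start
  have hright : ∀ x', x ≤ x' → (∀ i, x < S i → x' ≤ S i) →
      headWork S p x ≤ headWork S p x' + #A * (x' - x) := by
    intro x' hxx' hi
    have : (#A : ℝ) * (x' - x) = ∑ i, if i ∈ A then x' - x else 0 := by simp [mul_sub]
    rw [this, headWork, headWork, ← sum_add_distrib]
    refine sum_le_sum fun i _ => ?_
    have := hp i
    have h3 := hi i
    by_cases hiA : i ∈ A
    · rw [if_pos hiA]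
      rw [hmemA] at hiA
      grind
    · rw [if_neg hiA]
      rw [hmemA] at hiA
      grind
  rcases le_or_gt #A m with hc | hc
  · have hc' : (#A : ℝ) ≤ m := by exact_mod_cast hc
    by_cases hj : ∃ j, x < S j
    · obtain ⟨j, hj, hmin⟩ := Set.exists_min_image {j | x < S j} S (Set.toFinite _) hj
      have := hright (S j) (le_of_lt hj) hmin
      have := h2 j
      nlinarith [show x < S j from hj]
    · push Not at hj
      have := hright T hx fun i hi => absurd hi (hj i).not_gt
      have h0 : headWork S p T = 0 := by
        refine sum_eq_zero fun i _ => ?_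
        have := h1 i
        have := hp i
        grind
      nlinarith
  · have hne : A.Nonempty := card_pos.1 (by omega)
    obtain ⟨j, hj, hmax⟩ := exists_max_image A S hne
    have hc' : (m : ℝ) ≤ #A := by exact_mod_cast hc.le
    have hjx := ((hmemA j).1 hj).1
    have : headWork S p x + #A * (x - S j) ≤ headWork S p (S j) := by
      have : (#A : ℝ) * (x - S j) = ∑ i, if i ∈ A then x - S j else 0 := by simp [mul_sub]
      rw [this, headWork, headWork, ← sum_add_distrib]
      refine sum_le_sum fun i _ => ?_
      have := hp i
      by_cases hiA : i ∈ A
      · have h4 := hmax i hiA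
        rw [if_pos hiA]
        rw [hmemA] at hiA
        grind
      · rw [if_neg hiA]
        grind
    have := h2 j
    nlinarith

namespace Problem

variable {I : Problem n m} {S : Fin n → ℕ} {par : Fin n → Option (Fin n)}

/-- Backwards in time, job `j` can be processed: some of its work is left, but none of the work of
its successors in the forest. -/
def Pending {R : Type*} [Zero R] [LT R] (par : Fin n → Option (Fin n)) (rem : Fin n → R)
    (j : Fin n) : Prop :=
  0 < rem j ∧ ∀ k, par k = some j → rem k = 0

/-- During the last `δ` units of time before the part of the schedule that is already fixed, `a j`
units of pending work of job `j` are processed, where work with larger heads goes first: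
either all pending jobs are processed all the time; or all machines are busy all the time, and for
some threshold `y` no work with head below `y` is processed, while jobs with work left above `y`
are processed all the time. -/
structure IsPhase (m : ℕ) (S : Fin n → ℕ) (par : Fin n → Option (Fin n)) (rem : Fin n → ℝ) (δ : ℝ)
    (a : Fin n → ℝ) : Prop where
  pos : 0 < δ
  nonneg : ∀ j, 0 ≤ a j
  le : ∀ j, a j ≤ δ
  le_rem : ∀ j, a j ≤ rem j
  pending : ∀ j, 0 < a j → Pending par rem j
  sum_le : ∑ j, a j ≤ m * δ
  greedy : (∀ j, Pending par rem j → a j = δ) ∨ (∑ j, a j = m * δ ∧ ∃ y, ∀ j, Pending par rem j →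
    (a j = δ ∨ S j + rem j - a j ≤ y) ∧ (0 < a j → y ≤ S j + rem j - a j))

/-- Every job with work left lies on the chain of a pending job, namely the last job with work left
along some path. -/
theorem exists_pending (hpar : I.IsTightForest S par) {rem : Fin n → ℝ} (h0 : ∀ j, 0 ≤ rem j)
    {k : Fin n} (hk : 0 < rem k) : ∃ j, Pending par rem j ∧ k ∈ forestChain par j := by
  obtain ⟨j, ⟨hj, hkj⟩, hmax⟩ := Set.exists_max_image {j | 0 < rem j ∧ k ∈ forestChain par j} S
    (Set.toFinite _) ⟨k, hk, mem_forestChain_iff.2 (Or.inl rfl)⟩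
  refine ⟨j, ⟨hj, fun c hc => ?_⟩, hkj⟩
  by_contra hne
  have h1 := hmax c ⟨lt_of_le_of_ne (h0 c) (Ne.symm hne), mem_forestChain_iff.2 (Or.inr ⟨j, hc, hkj⟩)⟩
  have h2 := (hpar.tight hc).lt
  omega

/-- On the chain of `j`, the heads are disjoint intervals, so the work with head at least `x` on it
is no more than the distance from `x` to the head of `j`. -/
theorem sum_forestChain_le (hpar : I.IsTightForest S par) {rem : Fin n → ℝ} (h0 : ∀ j, 0 ≤ rem j)
    (h1 : ∀ j, rem j ≤ I.p j) (x : ℝ) (j : Fin n) :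
    ∑ k ∈ forestChain par j, min (rem k) (max 0 (S k + rem k - x)) ≤ max 0 (S j + rem j - x) := by
  classical
  induction hv : S j using Nat.strong_induction_on generalizing j with
  | _ v ih =>
    subst hv
    have hj := h0 j
    cases hp : par j with
    | none =>
      have : forestChain par j = {j} := by
        ext i; rw [mem_forestChain_iff]; simp [hp]
      rw [this, Finset.sum_singleton]
      exact min_le_right _ _
    | some k =>
      have hk := hpar.tight hp
      have : forestChain par j = insert j (forestChain par k) := by
        ext i; rw [mem_forestChain_iff]; simp [hp]
      rw [this, Finset.sum_insert]
      · have h2 := ih _ hk.lt k rfl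
        have h3 : (S k : ℝ) + I.p k ≤ S j := by exact_mod_cast hk.add_le
        have h4 := h1 k
        grind
      · intro hjk
        have := hk.lt
        have := I.p_pos j
        rcases hpar.add_le_of_mem hjk with rfl | h <;> omega

open Finset in
/-- If the heads of all pending jobs are at most `B`, and at most `m` of them exceed `x`, then
the work with head at least `x` fits between `x` and `B`: it lies on the chains of these jobs. -/
theorem headWork_le_of_card_le (hpar : I.IsTightForest S par) {rem : Fin n → ℝ}
    (h0 : ∀ j, 0 ≤ rem j) (h1 : ∀ j, rem j ≤ I.p j) {x B : ℝ} (hx : x ≤ B) (H : Finset (Fin n))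
    (hH : #H ≤ m) (hB : ∀ j ∈ H, S j + rem j ≤ B)
    (hcover : ∀ k, 0 < rem k → x < S k + rem k → ∃ j ∈ H, k ∈ forestChain par j) :
    headWork (fun j => (S j : ℝ)) rem x ≤ m * (B - x) := by
  set w : Fin n → ℝ := fun k => min (rem k) (max 0 (S k + rem k - x)) with hw
  have hw0 : ∀ k, 0 ≤ w k := fun k => le_min (h0 k) (le_max_left _ _)
  calc headWork (fun j => (S j : ℝ)) rem x = ∑ k, w k := rfl
    _ ≤ ∑ k, ∑ j ∈ H, if k ∈ forestChain par j then w k else 0 := by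
        refine sum_le_sum fun k _ => ?_
        have hnn : ∀ j ∈ H, 0 ≤ if k ∈ forestChain par j then w k else 0 := by
          intro j _; split_ifs; exacts [hw0 k, le_rfl]
        by_cases hk : 0 < rem k ∧ x < S k + rem k
        · obtain ⟨j, hj, hkj⟩ := hcover k hk.1 hk.2
          refine le_trans ?_ (single_le_sum hnn hj)
          rw [if_pos hkj]
        · refine le_trans ?_ (sum_nonneg hnn)
          simp only [hw]
          have := h0 k
          grind
    _ = ∑ j ∈ H, ∑ k ∈ forestChain par j, w k := by
        rw [sum_comm]
        refine sum_congr rfl fun j _ => ?_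
        rw [← sum_filter]
        congr 1
        ext; simp
    _ ≤ ∑ j ∈ H, (B - x) := by
        refine sum_le_sum fun j hj => (sum_forestChain_le hpar h0 h1 x j).trans ?_
        have := hB j hj
        exact max_le (by linarith) (by linarith)
    _ = #H * (B - x) := by simp [mul_sub]
    _ ≤ m * (B - x) := by
        have : (#H : ℝ) ≤ m := by exact_mod_cast hH
        nlinarith

/-- If no work has a head after `B`, then all jobs with work left have their heads by `B`. -/
theorem add_le_of_headWork_le {rem : Fin n → ℝ} {B : ℝ} (h0 : ∀ j, 0 ≤ rem j)
    (hB : headWork (fun j => (S j : ℝ)) rem B ≤ 0) {j : Fin n} (hj : 0 < rem j) :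
    S j + rem j ≤ B := by
  by_contra hc
  have h3 : min (rem j) (max 0 (S j + rem j - B)) ≤ headWork (fun j => (S j : ℝ)) rem B :=
    Finset.single_le_sum (f := fun j => min (rem j) (max 0 (S j + rem j - B)))
      (fun k _ => le_min (h0 k) (le_max_left _ _)) (Finset.mem_univ j)
  have h4 : 0 < min (rem j) (max 0 (S j + rem j - B)) :=
    lt_min hj (lt_max_of_lt_right (by linarith))
  linarith

/-- Processing the work with the largest heads keeps the remaining work within capacity. -/
theorem IsPhase.headWork_le (hm : 0 < m) (hpar : I.IsTightForest S par) {rem : Fin n → ℝ} {B δ : ℝ}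
    {a : Fin n → ℝ} (hph : IsPhase m S par rem δ a) (h0 : ∀ j, 0 ≤ rem j)
    (h1 : ∀ j, rem j ≤ I.p j)
    (hinv : ∀ x ≤ B, headWork (fun j => (S j : ℝ)) rem x ≤ m * (B - x)) :
    (∀ j, Pending par rem j → S j + rem j - a j ≤ B - δ) ∧
    ∀ x ≤ B - δ, headWork (fun j => (S j : ℝ)) (fun j => rem j - a j) x ≤ m * (B - δ - x) := by
  classical
  have hδ := hph.pos
  have hheadB : ∀ j, 0 < rem j → S j + rem j ≤ B := fun j hj =>
    add_le_of_headWork_le h0 (by simpa using hinv B le_rfl) hj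
  have hhead : ∀ j, Pending par rem j → S j + rem j - a j ≤ B - δ := by
    intro j hj
    have hjB := hheadB j hj.1
    rcases hph.greedy with hg | ⟨hsum, y, hy⟩
    · rw [hg j hj]; linarith
    · rcases (hy j hj).1 with h | h
      · rw [h]; linarith
      · refine h.trans ?_
        by_contra hc
        push Not at hc
        -- all machines are busy with work of head at least `y`, too much of it if `y > B - δ`
        have hle : ∑ j, a j ≤ headWork (fun j => (S j : ℝ)) rem (min y B) := by
          refine Finset.sum_le_sum fun i _ => ?_
          rcases (hph.nonneg i).eq_or_lt with ha | ha
          · rw [← ha]; exact le_min (h0 i) (le_max_left _ _)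
          · have h2 := (hy i (hph.pending i ha)).2 ha
            have h3 := hph.le_rem i
            have h4 := min_le_left y B
            exact le_min h3 (le_max_of_le_right (by linarith))
        have h5 := hinv (min y B) (min_le_right _ _)
        have h6 : B - min y B < δ := by
          rcases le_total y B with h | h
          · rw [min_eq_left h]; linarith
          · rw [min_eq_right h]; linarith
        have hm' : (0 : ℝ) < m := by exact_mod_cast hm
        nlinarith
  refine ⟨hhead, fun x hx => ?_⟩
  -- the case that all jobs with work left above `x` are processed all the time
  have htop : (∀ j, Pending par rem j → x < S j + rem j - a j → a j = δ) →
      headWork (fun j => (S j : ℝ)) (fun j => rem j - a j) x ≤ m * (B - δ - x) := by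
    intro hfull
    refine headWork_le_of_card_le hpar (fun j => by linarith [hph.le_rem j])
      (fun j => by linarith [h1 j, hph.nonneg j]) hx
      (Finset.univ.filter fun j => Pending par rem j ∧ x < S j + rem j - a j) ?_ ?_ ?_
    · have h2 : ∑ j ∈ Finset.univ.filter (fun j => Pending par rem j ∧ x < S j + rem j - a j), δ
          ≤ m * δ := by
        refine le_trans ?_ hph.sum_le
        refine le_trans (Finset.sum_le_sum (g := a) ?_)
          (Finset.sum_le_univ_sum_of_nonneg fun i => hph.nonneg i)
        intro i hi
        simp only [Finset.mem_filter, Finset.mem_univ, true_and] at hi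
        exact (hfull i hi.1 hi.2).ge
      rw [Finset.sum_const, nsmul_eq_mul] at h2
      exact_mod_cast le_of_mul_le_mul_right h2 hδ
    · intro j hj
      simp only [Finset.mem_filter, Finset.mem_univ, true_and] at hj
      linarith [hhead j hj.1]
    · intro k hk hxk
      have hk' : 0 < rem k := by linarith [hph.nonneg k]
      obtain ⟨j, hj, hkj⟩ := exists_pending hpar h0 hk'
      refine ⟨j, ?_, hkj⟩
      simp only [Finset.mem_filter, Finset.mem_univ, true_and]
      refine ⟨hj, ?_⟩
      rcases hpar.add_le_of_mem hkj with rfl | hlt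
      · linarith
      · have h2 : (S k : ℝ) + I.p k ≤ S j := by exact_mod_cast hlt
        linarith [h1 k, hph.nonneg k, hph.le_rem j]
  rcases hph.greedy with hg | ⟨hsum, y, hy⟩
  · exact htop fun j hj _ => hg j hj
  · rcases lt_or_ge x y with hxy | hxy
    · -- all work that was processed has head at least `y`, hence larger than `x`
      have h2 : headWork (fun j => (S j : ℝ)) (fun j => rem j - a j) x =
          headWork (fun j => (S j : ℝ)) rem x - ∑ j, a j := by
        rw [headWork, headWork, ← Finset.sum_sub_distrib]
        refine Finset.sum_congr rfl fun j _ => ?_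
        rcases (hph.nonneg j).eq_or_lt with ha | ha
        · rw [← ha]; simp
        · have h3 := (hy j (hph.pending j ha)).2 ha
          rw [max_eq_right (by linarith), max_eq_right (by linarith), ← min_sub_sub_right]
          congr 1; ring
      rw [h2, hsum]
      linarith [hinv x (by linarith)]
    · refine htop fun j hj hxj => ?_
      rcases (hy j hj).1 with h | h
      · exact h
      · linarith

/-- The list `σ` is the part after time `B` of a schedule with makespan at most `T` that respects the
forest; `rem j` units of job `j` are left, and fit before `B`. -/
structure IsTail (I : Problem n m) (S : Fin n → ℕ) (par : Fin n → Option (Fin n)) (T B : ℝ)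
    (rem : Fin n → ℝ) (σ : Schedule n m) : Prop where
  rem_nonneg : ∀ j, 0 ≤ rem j
  rem_le : ∀ j, rem j ≤ I.p j
  started : ∀ k j, par k = some j → rem j < I.p j → rem k = 0
  headWork_le : ∀ x ≤ B, headWork (fun j => (S j : ℝ)) rem x ≤ m * (B - x)
  start_lt_finish : ∀ x ∈ σ, x.start < x.finish
  no_overlap : σ.Pairwise fun x y =>
    (x.machine = y.machine ∨ x.job = y.job) → x.finish ≤ y.start ∨ y.finish ≤ x.start
  le_start : ∀ x ∈ σ, B ≤ x.start
  finish_le : ∀ x ∈ σ, x.finish ≤ T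
  processed : ∀ j, ((σ.filter fun x => x.job = j).map fun x => x.finish - x.start).sum =
    I.p j - rem j
  head_le : ∀ x ∈ σ, (S x.job : ℝ) ≤ x.start
  prec : ∀ x ∈ σ, ∀ y ∈ σ, par y.job = some x.job → x.finish ≤ y.start

/-- The level algorithm starts with an empty schedule, at a time that is no
smaller than the lower bounds. -/
theorem isTail_nil {T : ℝ} (h1 : ∀ j, (S j : ℝ) + I.p j ≤ T)
    (h2 : ∀ j, headWork (fun j => (S j : ℝ)) (fun j => (I.p j : ℝ)) (S j) ≤ m * (T - S j)) :
    I.IsTail S par T T (fun j => I.p j) [] where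
  rem_nonneg := by simp
  rem_le := by simp
  started := fun k j _ h => absurd h (lt_irrefl _)
  headWork_le := fun x hx => headWork_le_of_forall_start (by simp) h1 h2 hx
  start_lt_finish := by simp
  no_overlap := by simp
  le_start := by simp
  finish_le := by simp
  processed := by simp
  head_le := by simp
  prec := by simp

/-- A phase of the level algorithm extends the schedule backwards in time. -/
theorem IsTail.append (hm : 0 < m) (hpar : I.IsTightForest S par) {T B δ : ℝ} {rem a : Fin n → ℝ}
    {σ τ : Schedule n m} (h : I.IsTail S par T B rem σ) (hBT : B ≤ T)
    (hph : IsPhase m S par rem δ a)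
    (hpos : ∀ x ∈ τ, 0 < a x.job) (hlt : ∀ x ∈ τ, x.start < x.finish)
    (hstart : ∀ x ∈ τ, B - δ ≤ x.start) (hfinish : ∀ x ∈ τ, x.finish ≤ B)
    (hover : τ.Pairwise fun x y =>
      (x.machine = y.machine ∨ x.job = y.job) → x.finish ≤ y.start ∨ y.finish ≤ x.start)
    (hproc : ∀ j, ((τ.filter fun x => x.job = j).map fun x => x.finish - x.start).sum = a j) :
    I.IsTail S par T (B - δ) (fun j => rem j - a j) (σ ++ τ) := by
  obtain ⟨hhead, hinv⟩ := hph.headWork_le hm hpar h.rem_nonneg h.rem_le h.headWork_le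
  have hδ := hph.pos
  have hσ : ∀ x ∈ σ, rem x.job < I.p x.job := by
    intro x hx
    have h1 := h.processed x.job
    have h2 : 0 < ((σ.filter fun y => y.job = x.job).map fun x => x.finish - x.start).sum := by
      refine List.sum_pos _ ?_ ?_
      · simp only [List.mem_map, List.mem_filter, decide_eq_true_eq]
        rintro _ ⟨y, ⟨hy, -⟩, rfl⟩
        linarith [h.start_lt_finish y hy]
      · simp only [ne_eq, List.map_eq_nil_iff, List.filter_eq_nil_iff]
        push Not
        exact ⟨x, hx, by simp⟩
    linarith
  refine ⟨fun j => by linarith [hph.le_rem j], fun j => by linarith [h.rem_le j, hph.nonneg j], ?_,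
    hinv, ?_, ?_, ?_, ?_, ?_, ?_, ?_⟩
  · intro k j hkj hj
    have hk : rem k = 0 := by
      rcases (hph.nonneg j).eq_or_lt with ha | ha
      · rw [← ha, sub_zero] at hj
        exact h.started k j hkj hj
      · exact (hph.pending j ha).2 k hkj
    linarith [hph.nonneg k, hph.le_rem k]
  · intro x hx
    rcases List.mem_append.1 hx with hx | hx
    exacts [h.start_lt_finish x hx, hlt x hx]
  · refine List.pairwise_append.2 ⟨h.no_overlap, hover, fun x hx y hy _ => Or.inr ?_⟩
    exact (hfinish y hy).trans (h.le_start x hx)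
  · intro x hx
    rcases List.mem_append.1 hx with hx | hx
    exacts [by linarith [h.le_start x hx], hstart x hx]
  · intro x hx
    rcases List.mem_append.1 hx with hx | hx
    exacts [h.finish_le x hx, (hfinish x hx).trans hBT]
  · intro j
    rw [List.filter_append, List.map_append, List.sum_append, h.processed, hproc]
    ring
  · intro x hx
    rcases List.mem_append.1 hx with hx | hx
    · exact h.head_le x hx
    · have h1 := hhead _ (hph.pending _ (hpos x hx))
      linarith [hstart x hx, hph.le_rem x.job]
  · intro x hx y hy hxy
    rcases List.mem_append.1 hx with hx | hx <;> rcases List.mem_append.1 hy with hy | hy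
    · exact h.prec x hx y hy hxy
    · have h1 := h.started _ _ hxy (hσ x hx)
      have h2 := (hph.pending _ (hpos y hy)).1
      linarith
    · exact (hfinish x hx).trans (h.le_start y hy)
    · have h1 := (hph.pending _ (hpos x hx)).2 _ hxy
      have h2 := (hph.pending _ (hpos y hy)).1
      linarith

theorem IsTail.isSchedule {T B : ℝ} {rem : Fin n → ℝ} {σ : Schedule n m}
    (h : I.IsTail S par T B rem σ) (h0 : ∀ j, rem j = 0) : I.IsSchedule σ where
  start_nonneg := fun x hx => (Nat.cast_nonneg _).trans (h.head_le x hx)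
  start_lt_finish := h.start_lt_finish
  no_overlap := h.no_overlap
  processed := fun j => by rw [h.processed j, h0 j, sub_zero]

theorem IsTail.andFeasible (hS : I.IsEarliestStart S) {L : Fin n → Finset (Fin n)}
    (hL : ∀ i j, (I.prune L).G.Adj i j ↔ par j = some i) {T B : ℝ} {rem : Fin n → ℝ}
    {σ : Schedule n m} (h : I.IsTail S par T B rem σ) (h0 : ∀ j, rem j = 0) :
    (I.prune L).AndFeasible σ := by
  have hσ := h.isSchedule h0
  refine ⟨⟨hσ.1, hσ.2, hσ.3, hσ.4⟩, fun j => ?_, fun i j hij => ?_⟩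
  · refine hσ.le_startTime fun x hx hj => ?_
    refine le_trans ?_ (h.head_le x hx)
    rw [hj]
    exact_mod_cast hS.release_le j
  · refine hσ.le_startTime fun y hy hyj => hσ.completionTime_le fun x hx hxi => ?_
    exact h.prec x hx y hy (by rw [hyj, hxi]; exact (hL i j).1 hij)

theorem IsTail.makespan_le {T B : ℝ} {rem : Fin n → ℝ} {σ : Schedule n m}
    (h : I.IsTail S par T B rem σ) (h0 : ∀ j, rem j = 0) (hT : 0 ≤ T) : σ.makespan ≤ T :=
  Real.iSup_le (fun _ => (h.isSchedule h0).completionTime_le fun x hx _ => h.finish_le x hx) hT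

end Problem

end

section

variable {n m : ℕ}

namespace Problem

/-! ### The optimal makespan -/

/-- The optimal makespan, multiplied by the number of machines. -/
def bound (I : Problem n m) (S : Fin n → ℕ) : ℕ :=
  Finset.univ.sup fun j =>
    max (m * S j + ∑ i, min (I.p i) (S i + I.p i - S j)) (m * (S j + I.p j))

variable {I : Problem n m} {S : Fin n → ℕ} {par : Fin n → Option (Fin n)}

theorem headWork_start (I : Problem n m) (S : Fin n → ℕ) (j : Fin n) :
    headWork (fun j => (S j : ℝ)) (fun j => (I.p j : ℝ)) (S j) =
      ((∑ i, min (I.p i) (S i + I.p i - S j) : ℕ) : ℝ) := by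
  rw [headWork]
  push_cast
  refine Finset.sum_congr rfl fun i _ => ?_
  congr 1
  rcases le_total (S j) (S i + I.p i) with h | h
  · rw [Nat.cast_sub h, max_eq_right]
    · push_cast; ring
    · have : (S j : ℝ) ≤ S i + I.p i := by exact_mod_cast h
      linarith
  · rw [Nat.sub_eq_zero_of_le h, max_eq_left, Nat.cast_zero]
    have : (S i + I.p i : ℝ) ≤ S j := by exact_mod_cast h
    linarith

theorem mul_add_le_bound (I : Problem n m) (S : Fin n → ℕ) (j : Fin n) :
    m * (S j + I.p j) ≤ I.bound S :=
  (le_max_right _ _).trans (Finset.le_sup (f := fun j =>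
    max (m * S j + ∑ i, min (I.p i) (S i + I.p i - S j)) (m * (S j + I.p j))) (Finset.mem_univ j))

theorem headWork_le_bound (I : Problem n m) (S : Fin n → ℕ) (j : Fin n) :
    m * S j + ∑ i, min (I.p i) (S i + I.p i - S j) ≤ I.bound S :=
  (le_max_left _ _).trans (Finset.le_sup (f := fun j =>
    max (m * S j + ∑ i, min (I.p i) (S i + I.p i - S j)) (m * (S j + I.p j))) (Finset.mem_univ j))

/-- The lower bound on the makespan. As the bound is an integer, it suffices to compare it with the
integer part of the right-hand side. -/
theorem OrFeasible.bound_le {σ : Schedule n m} (h : I.OrFeasible σ) (hS : I.IsEarliestStart S) :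
    (I.bound S : ℝ) ≤ m * σ.makespan := by
  have hle := hS.le_startTime h
  have hmk : ∀ j, (S j : ℝ) + I.p j ≤ σ.makespan := fun j => by
    have := h.isSchedule.startTime_add_le_completionTime j
    have := IsSchedule.completionTime_le_makespan σ j
    linarith [hle j]
  have h0 : 0 ≤ σ.makespan := Real.iSup_nonneg fun j =>
    (h.isSchedule.startTime_nonneg j).trans (h.isSchedule.startTime_lt_completionTime j).le
  have hm : (0 : ℝ) ≤ m := by positivity
  have key : I.bound S ≤ ⌊(m : ℝ) * σ.makespan⌋₊ := by
    refine Finset.sup_le fun j _ => max_le ?_ ?_ <;> refine Nat.le_floor ?_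
    · have h1 := h.isSchedule.headWork_le hle (x := S j) (by
        have := hmk j
        have : (0 : ℝ) ≤ I.p j := by positivity
        linarith)
      rw [headWork_start] at h1
      push_cast at h1 ⊢
      linarith
    · push_cast
      exact mul_le_mul_of_nonneg_left (hmk j) hm
  exact (Nat.cast_le.2 key).trans (Nat.floor_le (by positivity))

theorem OrFeasible.orOptimal (hm : 0 < m) {σ : Schedule n m} (h : I.OrFeasible σ)
    (hS : I.IsEarliestStart S) (hσ : σ.makespan ≤ I.bound S / m) : I.OrOptimal σ := by
  refine ⟨h, fun τ hτ => hσ.trans ?_⟩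
  have hm' : (0 : ℝ) < m := by exact_mod_cast hm
  rw [div_le_iff₀ hm', mul_comm]
  exact hτ.bound_le hS

theorem isTail_bound (hm : 0 < m) (I : Problem n m) (S : Fin n → ℕ)
    (par : Fin n → Option (Fin n)) :
    I.IsTail S par (I.bound S / m) (I.bound S / m) (fun j => I.p j) [] := by
  have hm' : (0 : ℝ) < m := by exact_mod_cast hm
  refine isTail_nil (fun j => ?_) fun j => ?_
  · rw [le_div_iff₀ hm', mul_comm]
    exact_mod_cast mul_add_le_bound I S j
  · rw [headWork_start, mul_sub, mul_div_cancel₀ _ hm'.ne', le_sub_iff_add_le, add_comm]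
    exact_mod_cast headWork_le_bound I S j

end Problem

/-! ### McNaughton's wrap-around rule -/

/-- The sum of the first `k` values of `a`. -/
def prefixSum (a : Fin n → ℕ) (k : ℕ) : ℕ := ∑ i : Fin n with i.val < k, a i

theorem prefixSum_zero (a : Fin n → ℕ) : prefixSum a 0 = 0 := by simp [prefixSum]

theorem prefixSum_succ (a : Fin n → ℕ) (k : Fin n) :
    prefixSum a (k + 1) = prefixSum a k + a k := by
  have : (Finset.univ.filter fun i : Fin n => i.val < k.val + 1) =
      insert k (Finset.univ.filter fun i : Fin n => i.val < k.val) := by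
    ext i
    simp only [Finset.mem_filter, Finset.mem_univ, true_and, Finset.mem_insert, Fin.ext_iff]
    omega
  rw [prefixSum, prefixSum, this, Finset.sum_insert (by simp), add_comm]

theorem prefixSum_le (a : Fin n → ℕ) (k : ℕ) : prefixSum a k ≤ ∑ i, a i :=
  Finset.sum_le_sum_of_subset (Finset.filter_subset _ _)

/-- The pieces `τ` process `a i` units of the jobs `i < k` between `base` and `base + dl`, where the
machines are filled one after the other; times are multiples of `1 / D`. -/
structure IsWrap (D base dl : ℕ) (a : Fin n → ℕ) (k : ℕ) (τ : List (CodedPiece n m)) : Prop where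
  d_eq : ∀ x ∈ τ, x.d = D
  job_lt : ∀ x ∈ τ, x.job.val < k
  pos : ∀ x ∈ τ, 0 < a x.job
  le_a : ∀ x ∈ τ, base ≤ x.a
  lt : ∀ x ∈ τ, x.a < x.b
  b_le : ∀ x ∈ τ, x.b ≤ base + dl
  line : ∀ x ∈ τ, x.machine * dl + x.b ≤ base + prefixSum a k
  no_overlap : τ.Pairwise fun x y =>
    (x.machine = y.machine ∨ x.job = y.job) → x.b ≤ y.a ∨ y.b ≤ x.a
  sum : ∀ j, ((τ.filter fun x => x.job = j).map fun x => x.b - x.a).sum =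
    if j.val < k then a j else 0

namespace IsWrap

variable {D base dl : ℕ} {a : Fin n → ℕ} {τ : List (CodedPiece n m)}

theorem nil : IsWrap (m := m) D base dl a 0 [] where
  d_eq := by simp
  job_lt := by simp
  pos := by simp
  le_a := by simp
  lt := by simp
  b_le := by simp
  line := by simp
  no_overlap := by simp
  sum := by simp

theorem skip {k : Fin n} (h : IsWrap D base dl a k τ) (hk : a k = 0) :
    IsWrap D base dl a (k + 1) τ where
  d_eq := h.d_eq
  job_lt := fun x hx => (h.job_lt x hx).trans (Nat.lt_succ_self _)
  pos := h.pos
  le_a := h.le_a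
  lt := h.lt
  b_le := h.b_le
  line := by rw [prefixSum_succ, hk, add_zero]; exact h.line
  no_overlap := h.no_overlap
  sum := fun j => by
    rw [h.sum j]
    by_cases hj : j = k
    · subst hj; simp [hk]
    · have : j.val ≠ k.val := fun h => hj (Fin.ext h)
      simp only [show j.val < k.val + 1 ↔ j.val < k.val by omega]

theorem append {k : Fin n} (h : IsWrap D base dl a k τ) {ν : List (CodedPiece n m)}
    (hk : 0 < a k) (hd : ∀ x ∈ ν, x.d = D) (hjob : ∀ x ∈ ν, x.job = k)
    (hle : ∀ x ∈ ν, base ≤ x.a) (hlt : ∀ x ∈ ν, x.a < x.b) (hb : ∀ x ∈ ν, x.b ≤ base + dl)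
    (hline : ∀ x ∈ ν, x.machine * dl + x.b ≤ base + (prefixSum a k + a k))
    (hline' : ∀ x ∈ ν, base + prefixSum a k ≤ x.machine * dl + x.a)
    (hover : ν.Pairwise fun x y => x.b ≤ y.a ∨ y.b ≤ x.a)
    (hsum : (ν.map fun x => x.b - x.a).sum = a k) : IsWrap D base dl a (k + 1) (τ ++ ν) where
  d_eq := fun x hx => (List.mem_append.1 hx).elim (h.d_eq x) (hd x)
  job_lt := fun x hx => (List.mem_append.1 hx).elim
    (fun hx => (h.job_lt x hx).trans (Nat.lt_succ_self _))
    (fun hx => by rw [hjob x hx]; exact Nat.lt_succ_self _)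
  pos := fun x hx => (List.mem_append.1 hx).elim (h.pos x) fun hx => by rwa [hjob x hx]
  le_a := fun x hx => (List.mem_append.1 hx).elim (h.le_a x) (hle x)
  lt := fun x hx => (List.mem_append.1 hx).elim (h.lt x) (hlt x)
  b_le := fun x hx => (List.mem_append.1 hx).elim (h.b_le x) (hb x)
  line := fun x hx => by
    rw [prefixSum_succ]
    exact (List.mem_append.1 hx).elim (fun hx => by have := h.line x hx; omega) (hline x)
  no_overlap := by
    refine List.pairwise_append.2 ⟨h.no_overlap, hover.imp (by intro x y hxy _; exact hxy), ?_⟩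
    rintro x hx y hy (hxy | hxy)
    · have h1 := h.line x hx
      have h2 := hline' y hy
      rw [hxy] at h1
      omega
    · have := h.job_lt x hx
      rw [hxy, hjob y hy] at this
      omega
  sum := fun j => by
    rw [List.filter_append, List.map_append, List.sum_append, h.sum j]
    by_cases hj : j = k
    · subst hj
      rw [List.filter_eq_self.2 (by simpa using hjob), hsum]
      simp
    · have h1 : j.val ≠ k.val := fun h => hj (Fin.ext h)
      rw [List.filter_eq_nil_iff.2 fun x hx => by simpa [hjob x hx] using Ne.symm hj]
      simp only [show j.val < k.val + 1 ↔ j.val < k.val by omega]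
      simp

end IsWrap

namespace Problem

variable {I : Problem n m} {S : Fin n → ℕ} {par : Fin n → Option (Fin n)}

theorem pending_div_iff {D : ℕ} (hD : 0 < D) {rem : Fin n → ℕ} {j : Fin n} :
    Pending par (fun j => (rem j : ℝ) / D) j ↔ Pending par rem j := by
  have hD' : (0 : ℝ) < D := by exact_mod_cast hD
  simp only [Pending, div_pos_iff_of_pos_right hD', Nat.cast_pos, div_eq_zero_iff, hD'.ne',
    or_false, Nat.cast_eq_zero]

/-- A phase of the level algorithm, with the amounts of work distributed by the wrap-around rule. -/
theorem IsTail.wrap (hm : 0 < m) (hpar : I.IsTightForest S par) {T : ℝ} {D base dl : ℕ} (hD : 0 < D)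
    {rem a : Fin n → ℕ} {σ : Schedule n m} {τ : List (CodedPiece n m)}
    (h : I.IsTail S par T (((base + dl : ℕ) : ℝ) / D) (fun j => (rem j : ℝ) / D) σ)
    (hT : ((base + dl : ℕ) : ℝ) / D ≤ T)
    (hph : IsPhase m S par (fun j => (rem j : ℝ) / D) ((dl : ℝ) / D) (fun j => (a j : ℝ) / D))
    (hle : ∀ j, a j ≤ rem j) (hw : IsWrap D base dl a n τ) :
    I.IsTail S par T ((base : ℝ) / D) (fun j => ((rem j - a j : ℕ) : ℝ) / D)
      (σ ++ τ.map CodedPiece.toPiece) := by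
  have hD' : (0 : ℝ) < D := by exact_mod_cast hD
  have hB : ((base + dl : ℕ) : ℝ) / D - (dl : ℝ) / D = (base : ℝ) / D := by
    push_cast; ring
  have hr : (fun j => ((rem j - a j : ℕ) : ℝ) / D) = fun j => (rem j : ℝ) / D - (a j : ℝ) / D := by
    funext j
    rw [Nat.cast_sub (hle j), sub_div]
  rw [hr, ← hB]
  have hdiv : ∀ {u v : ℕ}, u ≤ v → (u : ℝ) / D ≤ (v : ℝ) / D := fun huv =>
    div_le_div_of_nonneg_right (by exact_mod_cast huv) hD'.le
  refine h.append hm hpar hT hph ?_ ?_ ?_ ?_ ?_ ?_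
  · simp only [List.mem_map]
    rintro _ ⟨x, hx, rfl⟩
    exact div_pos (by exact_mod_cast hw.pos x hx) hD'
  · simp only [List.mem_map]
    rintro _ ⟨x, hx, rfl⟩
    simp only [CodedPiece.toPiece, hw.d_eq x hx]
    exact div_lt_div_of_pos_right (by exact_mod_cast hw.lt x hx) hD'
  · simp only [List.mem_map]
    rintro _ ⟨x, hx, rfl⟩
    simp only [CodedPiece.toPiece, hw.d_eq x hx]
    rw [hB]
    exact hdiv (hw.le_a x hx)
  · simp only [List.mem_map]
    rintro _ ⟨x, hx, rfl⟩
    simp only [CodedPiece.toPiece, hw.d_eq x hx]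
    exact hdiv (hw.b_le x hx)
  · rw [List.pairwise_map]
    refine List.Pairwise.imp_of_mem ?_ hw.no_overlap
    intro x y hx hy hxy hmj
    simp only [CodedPiece.toPiece, hw.d_eq x hx, hw.d_eq y hy]
    exact (hxy hmj).imp hdiv hdiv
  · intro j
    have hsum := hw.sum j
    rw [if_pos j.isLt] at hsum
    rw [← hsum, List.filter_map, List.map_map, Nat.cast_list_sum, List.map_map, div_eq_mul_inv,
      ← List.sum_map_mul_right]
    congr 1
    refine List.map_congr_left fun x hx => ?_
    have hx' := List.mem_of_mem_filter hx
    simp only [Function.comp, CodedPiece.toPiece, hw.d_eq x hx', Nat.cast_sub (hw.lt x hx').le]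
    ring

/-! ### Events of the level algorithm -/

section Level

variable (m S par)

open Classical in
/-- The pending jobs. -/
noncomputable def pendingJobs (rem : Fin n → ℕ) : Finset (Fin n) :=
  Finset.univ.filter (Pending par rem)

/-- The head of the remaining work of job `j`, in units of `1 / D`. -/
def level (D : ℕ) (rem : Fin n → ℕ) (j : Fin n) : ℕ := S j * D + rem j

open Finset in
/-- The `m`-th largest level `h` of the pending jobs, the number `g` of pending jobs at this level and
the number `c` of machines left for them by the jobs at larger levels; if there are fewer than `m`
pending jobs, level `0`, at which there are none. -/
def IsShared (D : ℕ) (rem : Fin n → ℕ) (h g c : ℕ) : Prop :=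
  (h = 0 ∧ g = 1 ∧ c = 1 ∧ #(pendingJobs par rem) ≤ m) ∨
  (#{j ∈ pendingJobs par rem | h < level S D rem j} + c = m ∧
    #{j ∈ pendingJobs par rem | level S D rem j = h} = g ∧ 0 < c ∧ c ≤ g)

/-- The numerator of the time after which a job with level `X` and `r` units of work left would be
completed, if its level is at least the shared level `h`, or met by the jobs at level `h`. -/
def meetNum (h g X r : ℕ) : ℕ := if h < X then r else if X = h then r * g else (h - X) * g

/-- The denominator of the time in `meetNum`. -/
def meetDen (h c X : ℕ) : ℕ := if h < X then 1 else c

/-- The numerator of the time after which a job with level `X` above the shared level `h` would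
fall down to the jobs at level `h`; the denominator is `0` if this never happens. -/
def fallNum (h g X : ℕ) : ℕ := (X - h) * g

/-- The denominator of the time in `fallNum`. -/
def fallDen (h g c X : ℕ) : ℕ := if h < X then g - c else 0

/-- The time until the next event is `nu / de`. -/
structure IsNext (D : ℕ) (rem : Fin n → ℕ) (h g c nu de : ℕ) : Prop where
  meet_le : ∀ j ∈ pendingJobs par rem,
    nu * meetDen h c (level S D rem j) ≤ meetNum h g (level S D rem j) (rem j) * de
  fall_le : ∀ j ∈ pendingJobs par rem,
    nu * fallDen h g c (level S D rem j) ≤ fallNum h g (level S D rem j) * de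
  attained : ∃ j ∈ pendingJobs par rem,
    (nu = meetNum h g (level S D rem j) (rem j) ∧ de = meetDen h c (level S D rem j)) ∨
    (nu = fallNum h g (level S D rem j) ∧ de = fallDen h g c (level S D rem j) ∧ 0 < de)

open Classical in
/-- The work on job `j` until the next event, in units of `1 / (D * (de * g))`. -/
noncomputable def amount (D : ℕ) (rem : Fin n → ℕ) (h g c nu : ℕ) (j : Fin n) : ℕ :=
  if j ∈ pendingJobs par rem then
    if h < level S D rem j then nu * g else if level S D rem j = h then nu * c else 0
  else 0

/-- The potential decreases with each event: a job is completed, or two levels merge. -/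
noncomputable def potential (D : ℕ) (rem : Fin n → ℕ) : ℕ :=
  (n + 1) * (Finset.univ.filter fun j => 0 < rem j).card +
    ((pendingJobs par rem).image (level S D rem)).card

end Level

theorem mem_pendingJobs {rem : Fin n → ℕ} {j : Fin n} :
    j ∈ pendingJobs par rem ↔ Pending par rem j := by simp [pendingJobs]

section

variable {D h g c nu de : ℕ} {rem : Fin n → ℕ}

theorem IsShared.pos (hsh : IsShared m S par D rem h g c) : 0 < c ∧ c ≤ g := by
  rcases hsh with ⟨-, rfl, rfl, -⟩ | ⟨-, -, h1, h2⟩ <;> omega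

theorem IsShared.le (hsh : IsShared m S par D rem h g c) (hn : 0 < n) : g ≤ n := by
  rcases hsh with ⟨-, rfl, -, -⟩ | ⟨-, rfl, -, -⟩
  · exact hn
  · exact (Finset.card_le_univ _).trans (by simp)

theorem IsNext.pos (hsh : IsShared m S par D rem h g c)
    (hnx : IsNext S par D rem h g c nu de) : 0 < nu ∧ 0 < de ∧ de ≤ g := by
  obtain ⟨hc, hcg⟩ := hsh.pos
  obtain ⟨j, hj, ⟨rfl, rfl⟩ | ⟨rfl, rfl, hde⟩⟩ := hnx.attained
  · have hr := (mem_pendingJobs.1 hj).1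
    unfold meetNum meetDen
    have hg : 0 < g := by omega
    refine ⟨?_, ?_⟩
    · split_ifs with h1 h2
      · exact hr
      · positivity
      · exact Nat.mul_pos (by omega) hg
    · split_ifs <;> omega
  · unfold fallDen at hde ⊢
    unfold fallNum
    split_ifs at hde ⊢ with h1
    · exact ⟨Nat.mul_pos (by omega) (by omega), hde, by omega⟩
    · omega

theorem amount_of_not_mem {j : Fin n} (hj : j ∉ pendingJobs par rem) :
    amount S par D rem h g c nu j = 0 := if_neg hj

theorem amount_le_rem (hnx : IsNext S par D rem h g c nu de) (j : Fin n) :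
    amount S par D rem h g c nu j ≤ rem j * (de * g) := by
  unfold amount
  split_ifs with h1 h2 h3
  · have := hnx.meet_le j h1
    rw [meetDen, meetNum, if_pos h2, if_pos h2, mul_one] at this
    calc nu * g ≤ rem j * de * g := Nat.mul_le_mul_right _ this
      _ = _ := by ring
  · have := hnx.meet_le j h1
    rw [meetDen, meetNum, if_neg h2, if_neg h2, if_pos h3] at this
    calc nu * c ≤ rem j * g * de := this
      _ = _ := by ring
  · exact Nat.zero_le _
  · exact Nat.zero_le _

theorem amount_le (hsh : IsShared m S par D rem h g c) (j : Fin n) :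
    amount S par D rem h g c nu j ≤ nu * g := by
  obtain ⟨hc, hcg⟩ := hsh.pos
  unfold amount
  split_ifs
  · exact le_rfl
  · exact Nat.mul_le_mul_left _ hcg
  · exact Nat.zero_le _
  · exact Nat.zero_le _

open Finset in
theorem sum_amount : ∑ j, amount S par D rem h g c nu j =
    #{j ∈ pendingJobs par rem | h < level S D rem j} * (nu * g) +
    #{j ∈ pendingJobs par rem | level S D rem j = h} * (nu * c) := by
  classical
  have h1 : ∀ j, amount S par D rem h g c nu j =
      (if j ∈ pendingJobs par rem ∧ h < level S D rem j then nu * g else 0) +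
      (if j ∈ pendingJobs par rem ∧ level S D rem j = h then nu * c else 0) := by
    intro j
    unfold amount
    by_cases h1 : j ∈ pendingJobs par rem <;> by_cases h2 : h < level S D rem j <;>
      by_cases h3 : level S D rem j = h <;> simp_all
  simp only [h1, sum_add_distrib, ← sum_filter, sum_const, smul_eq_mul]
  congr 3 <;> · ext; simp

open Finset in
theorem sum_amount_le (hsh : IsShared m S par D rem h g c) :
    ∑ j, amount S par D rem h g c nu j ≤ m * (nu * g) := by
  rcases hsh with ⟨rfl, rfl, rfl, hm⟩ | ⟨h1, h2, h3, h4⟩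
  · refine le_trans ?_ (Nat.mul_le_mul_right _ hm)
    rw [sum_amount, ← add_mul]
    refine Nat.mul_le_mul_right _ ?_
    rw [← card_union_of_disjoint]
    · refine card_le_card fun j => ?_
      simp only [mem_union, mem_filter]
      tauto
    · rw [disjoint_filter]
      intro j _ h1 h2
      omega
  · rw [sum_amount, h2, ← h1]
    exact le_of_eq (by ring)

/-- Until the next event, processing jobs above the shared level all the time and sharing the other
machines among the jobs at this level is a phase; its threshold is the shared level at the end. -/
theorem isPhase_amount (hD : 0 < D) (hsh : IsShared m S par D rem h g c)
    (hnx : IsNext S par D rem h g c nu de) :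
    IsPhase m S par (fun j => ((rem j * (de * g) : ℕ) : ℝ) / (D * (de * g) : ℕ))
      (((nu * g : ℕ) : ℝ) / (D * (de * g) : ℕ))
      (fun j => (amount S par D rem h g c nu j : ℝ) / (D * (de * g) : ℕ)) := by
  obtain ⟨hc, hcg⟩ := hsh.pos
  obtain ⟨hnu, hde, -⟩ := hnx.pos hsh
  have hg : 0 < g := by omega
  have hD' : 0 < D * (de * g) := by positivity
  have hDr : (0 : ℝ) < (D * (de * g) : ℕ) := by exact_mod_cast hD'
  have hdiv : ∀ {u v : ℕ}, u ≤ v →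
      (u : ℝ) / (D * (de * g) : ℕ) ≤ (v : ℝ) / (D * (de * g) : ℕ) := fun huv =>
    div_le_div_of_nonneg_right (by exact_mod_cast huv) hDr.le
  have hpend : ∀ j, Pending par (fun j => ((rem j * (de * g) : ℕ) : ℝ) / (D * (de * g) : ℕ)) j ↔
      j ∈ pendingJobs par rem := by
    intro j
    rw [pending_div_iff hD', mem_pendingJobs]
    simp [Pending, hde, hg, hde.ne', hg.ne']
  refine ⟨by positivity, fun j => by positivity, fun j => hdiv (amount_le hsh j),
    fun j => hdiv (amount_le_rem hnx j), fun j hj => ?_, ?_, ?_⟩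
  · rw [hpend]
    by_contra hc
    simp [amount_of_not_mem hc] at hj
  · rw [← Finset.sum_div, ← mul_div_assoc, ← Nat.cast_sum, ← Nat.cast_mul]
    exact hdiv (sum_amount_le hsh)
  · rcases hsh with ⟨rfl, rfl, rfl, hm⟩ | ⟨h1, h2, h3, h4⟩
    · left
      intro j hj
      rw [hpend] at hj
      have : 0 < level S D rem j := by
        have := (mem_pendingJobs.1 hj).1
        unfold level; omega
      rw [amount, if_pos hj, if_pos this]
    · right
      constructor
      · rw [← Finset.sum_div, ← mul_div_assoc, ← Nat.cast_sum, ← Nat.cast_mul, sum_amount, h2, ← h1]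
        congr 2
        ring
      · -- the level of the jobs at the shared level after the phase
        refine ⟨((h * (de * g) : ℕ) - (nu * c : ℕ)) / (D * (de * g) : ℕ), fun j hj => ?_⟩
        rw [hpend] at hj
        have hSj : (S j : ℝ) = ((S j * D * (de * g) : ℕ) : ℝ) / (D * (de * g) : ℕ) := by
          rw [eq_div_iff hDr.ne']; push_cast; ring
        have hX : (S j : ℝ) + ((rem j * (de * g) : ℕ) : ℝ) / (D * (de * g) : ℕ) -
            (amount S par D rem h g c nu j : ℝ) / (D * (de * g) : ℕ) =
            ((level S D rem j * (de * g) : ℕ) - (amount S par D rem h g c nu j : ℝ)) /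
              (D * (de * g) : ℕ) := by
          rw [sub_div, hSj, ← add_div]
          unfold level
          push_cast
          ring
        rw [hX]
        have hm1 := hnx.meet_le j hj
        have hf1 := hnx.fall_le j hj
        rcases lt_trichotomy h (level S D rem j) with hlt | heq | hgt
        · have ha : amount S par D rem h g c nu j = nu * g := by
            rw [amount, if_pos hj, if_pos hlt]
          refine ⟨Or.inl (by rw [ha]), fun _ => div_le_div_of_nonneg_right ?_ hDr.le⟩
          rw [fallDen, fallNum, if_pos hlt] at hf1
          rw [ha, sub_le_sub_iff]
          obtain ⟨e, rfl⟩ := Nat.exists_eq_add_of_le h4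
          obtain ⟨u, hu⟩ := Nat.exists_eq_add_of_lt hlt
          rw [hu] at hf1 ⊢
          rw [show h + u + 1 - h = u + 1 by omega, show c + e - c = e by omega] at hf1
          have : h * (de * (c + e)) + nu * (c + e) ≤ (h + u + 1) * (de * (c + e)) + nu * c := by
            nlinarith
          exact_mod_cast this
        · have ha : amount S par D rem h g c nu j = nu * c := by
            rw [amount, if_pos hj, if_neg (by omega), if_pos heq.symm]
          rw [ha, ← heq]
          exact ⟨Or.inr le_rfl, fun _ => le_rfl⟩
        · have ha : amount S par D rem h g c nu j = 0 := by
            rw [amount, if_pos hj, if_neg (by omega), if_neg (by omega)]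
          rw [ha]
          refine ⟨Or.inr (div_le_div_of_nonneg_right ?_ hDr.le), fun h0 => by simp at h0⟩
          rw [meetDen, meetNum, if_neg (by omega), if_neg (by omega), if_neg (by omega)] at hm1
          rw [Nat.cast_zero, sub_zero, le_sub_iff_add_le]
          obtain ⟨u, hu⟩ := Nat.exists_eq_add_of_lt hgt
          rw [hu] at hm1 ⊢
          rw [show level S D rem j + u + 1 - level S D rem j = u + 1 by omega] at hm1
          have : level S D rem j * (de * g) + nu * c ≤
              (level S D rem j + u + 1) * (de * g) := by nlinarith
          exact_mod_cast this

open Finset in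
/-- At each event a job is completed, which outweighs the levels of the jobs that become pending, or
a level meets the shared level. -/
theorem potential_lt (hsh : IsShared m S par D rem h g c)
    (hnx : IsNext S par D rem h g c nu de) :
    potential S par (D * (de * g)) (fun j => rem j * (de * g) - amount S par D rem h g c nu j) <
      potential S par D rem := by
  classical
  obtain ⟨hc, hcg⟩ := hsh.pos
  obtain ⟨hnu, hde, -⟩ := hnx.pos hsh
  have hg : 0 < g := by omega
  set rem' : Fin n → ℕ := fun j => rem j * (de * g) - amount S par D rem h g c nu j with hrem'
  set A := pendingJobs par rem with hA
  have hsub : (univ.filter fun j => 0 < rem' j) ⊆ univ.filter fun j => 0 < rem j := by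
    intro j
    simp only [mem_filter, mem_univ, true_and, hrem']
    intro hj
    by_contra h0
    simp [Nat.eq_zero_of_not_pos h0] at hj
  have hlev : ((pendingJobs par rem').image (level S (D * (de * g)) rem')).card ≤ n :=
    card_image_le.trans ((card_le_univ _).trans (by simp))
  by_cases heq : (univ.filter fun j => 0 < rem' j) = univ.filter fun j => 0 < rem j
  · -- no job is completed, so the same jobs are pending and two of their levels merge
    have hiff : ∀ j, 0 < rem' j ↔ 0 < rem j := by
      intro j
      simpa using congrArg (j ∈ ·) heq
    have hiff0 : ∀ j, rem' j = 0 ↔ rem j = 0 := by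
      intro j
      have := hiff j
      omega
    have hA' : pendingJobs par rem' = A := by
      ext j
      rw [hA, mem_pendingJobs, mem_pendingJobs, Pending, Pending, hiff]
      simp only [hiff0]
    rw [potential, potential, heq, hA', ← hA]
    refine Nat.add_lt_add_left ?_ _
    set φ : ℕ → ℕ := fun X => X * (de * g) - if h < X then nu * g else if X = h then nu * c else 0
      with hφ
    have himg : A.image (level S (D * (de * g)) rem') = (A.image (level S D rem)).image φ := by
      rw [image_image]
      refine image_congr fun j hj => ?_
      have hj' : j ∈ A := hj
      have hle := amount_le_rem hnx j
      simp only [Function.comp, level, hφ, hrem']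
      have : (if h < S j * D + rem j then nu * g else if S j * D + rem j = h then nu * c else 0) =
          amount S par D rem h g c nu j := by
        rw [amount, if_pos hj']; rfl
      rw [this, add_mul, Nat.add_sub_assoc hle]
      ring
    rw [himg]
    refine lt_of_le_of_ne card_image_le fun hcard => ?_
    have hinj := card_image_iff.1 hcard
    -- a job that changes its position relative to the shared level
    have hmerge : ∃ j ∈ A, level S D rem j ≠ h ∧ φ (level S D rem j) = φ h ∧
        ∃ i ∈ A, level S D rem i = h := by
      have hG : (∃ i ∈ A, level S D rem i = h) ∨ (h = 0 ∧ g = 1 ∧ c = 1) := by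
        rcases hsh with ⟨h1, h2, h3, -⟩ | ⟨-, h2, -, -⟩
        · exact Or.inr ⟨h1, h2, h3⟩
        · left
          obtain ⟨i, hi⟩ := card_pos.1 (h2 ▸ hg)
          rw [mem_filter] at hi
          exact ⟨i, hi⟩
      obtain ⟨j, hj, ⟨hnu', hde'⟩ | ⟨hnu', hde', hdp⟩⟩ := hnx.attained
      · have hr := (hiff j).2 (mem_pendingJobs.1 hj).1
        rcases lt_trichotomy h (level S D rem j) with hlt | heq' | hgt
        · exfalso
          rw [meetNum, if_pos hlt] at hnu'
          rw [meetDen, if_pos hlt] at hde'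
          simp only [hrem', amount] at hr
          rw [if_pos hj, if_pos hlt, hnu', hde'] at hr
          simp at hr
        · exfalso
          rw [meetNum, if_neg (by omega), if_pos heq'.symm] at hnu'
          rw [meetDen, if_neg (by omega)] at hde'
          simp only [hrem', amount] at hr
          rw [if_pos hj, if_neg (by omega), if_pos heq'.symm, hnu', hde'] at hr
          rw [show rem j * (c * g) - rem j * g * c = 0 by
            rw [show rem j * (c * g) = rem j * g * c by ring]; omega] at hr
          omega
        · rw [meetNum, if_neg (by omega), if_neg (by omega)] at hnu'
          rw [meetDen, if_neg (by omega)] at hde'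
          refine ⟨j, hj, hgt.ne, ?_, ?_⟩
          · simp only [hφ]
            rw [if_neg (by omega), if_neg (by omega), if_neg (by omega), if_pos trivial, hnu', hde',
              Nat.sub_zero]
            obtain ⟨u, hu⟩ := Nat.exists_eq_add_of_lt hgt
            rw [show h - level S D rem j = u + 1 by omega]
            refine (Nat.sub_eq_of_eq_add ?_).symm
            rw [hu]; ring
          · rcases hG with h1 | h1
            · exact h1
            · omega
      · rw [fallNum] at hnu'
        have hlt : h < level S D rem j := by
          by_contra hc'
          rw [fallDen, if_neg hc'] at hde'
          omega
        rw [fallDen, if_pos hlt] at hde'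
        refine ⟨j, hj, hlt.ne', ?_, ?_⟩
        · simp only [hφ]
          rw [if_pos hlt, if_neg (by omega), if_pos trivial]
          obtain ⟨u, hu⟩ := Nat.exists_eq_add_of_lt hlt
          obtain ⟨e, rfl⟩ := Nat.exists_eq_add_of_le hcg
          rw [show c + e - c = e by omega] at hde'
          rw [show level S D rem j - h = u + 1 by omega] at hnu'
          subst hde' hnu'
          rw [hu, show (h + u + 1) * (de * (c + de)) = h * (de * (c + de)) +
            (u + 1) * (c + de) * de by ring, show (u + 1) * (c + de) * (c + de) =
            (u + 1) * (c + de) * c + (u + 1) * (c + de) * de by ring]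
          omega
        · rcases hG with h1 | h1
          · exact h1
          · omega
    obtain ⟨j, hj, hne, hφj, i, hi, hih⟩ := hmerge
    refine hne (hinj ?_ ?_ hφj)
    · exact mem_coe.2 (mem_image_of_mem _ hj)
    · rw [← hih]
      exact mem_coe.2 (mem_image_of_mem _ hi)
  · have hlt := card_lt_card (hsub.ssubset_of_ne heq)
    unfold potential
    nlinarith

end

end Problem

end

/-! ### Memory layout -/

/-!
The names below stand for the arrays of the machine: `vIn` and `vOut` hold input and output, `vZ`
the tentative starts plus one, `vS` the earliest starts, `vPar` the forest, `vRem` the remaining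
work in units of `1 / vD`, `vX` the levels, `vAv` the flags of the pending jobs, `vA` the amounts
of work of a round; all others are scalars, kept in cell `0`.
-/

local notation "vIn" => 0
local notation "vOut" => 1
local notation "vN" => 2
local notation "vM" => 3
local notation "vI" => 4
local notation "vJ" => 5
local notation "vK" => 6
local notation "vR" => 7
local notation "vZ" => 8
local notation "vPar" => 9
local notation "vBad" => 10
local notation "vS" => 11
local notation "vW" => 12
local notation "vB" => 13
local notation "vD" => 14
local notation "vRem" => 15
local notation "vP" => 16
local notation "vL" => 17
local notation "vX" => 18
local notation "vAv" => 19
local notation "vH" => 20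
local notation "vG" => 21
local notation "vC" => 22
local notation "vU" => 23
local notation "vV" => 24
local notation "vNu" => 25
local notation "vDe" => 26
local notation "vA" => 27
local notation "vDl" => 28
local notation "vO" => 29
local notation "vQ" => 30
local notation "vOff" => 31
local notation "vSc" => 32
local notation:60 c:61 " ;; " d:60 => Cmd.seq c d

section

variable {n m : ℕ}

namespace Problem
variable (I : Problem n m)

open Classical in
/-- The adjacency matrix as one list, row by row. -/
theorem code_eq : I.code = [n, m] ++ (List.ofFn I.p ++ (List.ofFn I.r ++
    List.ofFn fun k : Fin (n * n) => if I.G.Adj k.divNat k.modNat then 1 else 0)) := by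
  rw [code, List.ofFn_mul]
  simp only [List.append_assoc]
  congr 5
  funext i
  congr 2
  funext j
  have h1 : (i : ℕ) * n + j < n * n := by
    have := i.isLt; have := j.isLt; nlinarith
  have e1 : (⟨i * n + j, h1⟩ : Fin (n * n)).divNat = i := by
    ext; simp only [Fin.coe_divNat]
    rw [mul_comm, Nat.mul_add_div (by omega), Nat.div_eq_of_lt j.isLt, add_zero]
  have e2 : (⟨i * n + j, h1⟩ : Fin (n * n)).modNat = j := by
    ext; simp only [Fin.coe_modNat]
    rw [mul_comm, Nat.mul_add_mod, Nat.mod_eq_of_lt j.isLt]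
  rw [e1, e2]

theorem inputState_zero (k : ℕ) : inputState I.code 0 k = (I.code.length :: I.code).getD k 0 := rfl

theorem inputState_n : inputState I.code 0 1 = n := by
  rw [inputState_zero, code_eq]; rfl
theorem inputState_m : inputState I.code 0 2 = m := by
  rw [inputState_zero, code_eq]; rfl

theorem inputState_p (j : Fin n) : inputState I.code 0 (3 + j) = I.p j := by
  rw [inputState_zero, code_eq, show 3 + (j : ℕ) = j + 2 + 1 by ring]
  simp only [List.getD_cons_succ, List.cons_append, List.nil_append]
  rw [List.getD_append _ _ _ _ (by simp)]
  simp

theorem inputState_r (j : Fin n) : inputState I.code 0 (3 + n + j) = I.r j := by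
  rw [inputState_zero, code_eq, show 3 + n + (j : ℕ) = n + j + 2 + 1 by ring]
  simp only [List.getD_cons_succ, List.cons_append, List.nil_append]
  rw [List.getD_append_right _ _ _ _ (by simp), List.getD_append _ _ _ _ (by simp)]
  simp

open Classical in
theorem inputState_adj (i j : Fin n) : inputState I.code 0 (3 + (n + n) + (i * n + j)) =
    if I.G.Adj i j then 1 else 0 := by
  have h1 : (i : ℕ) * n + j < n * n := by
    have := i.isLt; have := j.isLt; nlinarith
  rw [inputState_zero, code_eq, show 3 + (n + n) + ((i : ℕ) * n + j) = n + (n + (i * n + j)) + 2 + 1 by ring]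
  simp only [List.getD_cons_succ, List.cons_append, List.nil_append]
  rw [List.getD_append_right _ _ _ _ (by simp), List.getD_append_right _ _ _ _ (by simp)]
  simp only [List.length_ofFn, Nat.add_sub_cancel_left]
  rw [List.getD_eq_getElem _ _ (by simpa using h1), List.getElem_ofFn]
  have e1 : (⟨i * n + j, h1⟩ : Fin (n * n)).divNat = i := by
    ext; simp only [Fin.coe_divNat]
    rw [mul_comm, Nat.mul_add_div (by omega), Nat.div_eq_of_lt j.isLt, add_zero]
  have e2 : (⟨i * n + j, h1⟩ : Fin (n * n)).modNat = j := by
    ext; simp only [Fin.coe_modNat]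
    rw [mul_comm, Nat.mul_add_mod, Nat.mod_eq_of_lt j.isLt]
  rw [e1, e2]

end Problem

/-- The state `s` still holds the input, and the number of jobs in `vN`. -/
structure Reads (I : Problem n m) (s : State) : Prop where
  input : s vIn = inputState I.code vIn
  jobs : s vN 0 = n

/-- The processing time of job `j`. -/
def pAt (j : Expr) : Expr := .get vIn (.const 3 + j)

/-- The release date of job `j`. -/
def rAt (j : Expr) : Expr := .get vIn (.const 3 + .var vN + j)

/-- The entry of the adjacency matrix at `(i, j)`. -/
def adjAt (i j : Expr) : Expr :=
  .get vIn (.const 3 + (.var vN + .var vN) + (i * .var vN + j))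

namespace Reads

variable {I : Problem n m} {s s' : State}

theorem congr (h : Reads I s) (h0 : s' vIn = s vIn) (h1 : s' vN = s vN) : Reads I s' :=
  ⟨h0.trans h.input, by rw [h1, h.jobs]⟩

theorem eval_pAt (h : Reads I s) {e : Expr} {j : Fin n} (he : e.eval s = j) :
    (pAt e).eval s = I.p j := by
  simp [pAt, he, h.input, I.inputState_p]

theorem eval_rAt (h : Reads I s) {e : Expr} {j : Fin n} (he : e.eval s = j) :
    (rAt e).eval s = I.r j := by
  simp [rAt, he, h.input, h.jobs, I.inputState_r]

open Classical in
theorem eval_adjAt (h : Reads I s) {e f : Expr} {i j : Fin n} (he : e.eval s = i)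
    (hf : f.eval s = j) : (adjAt e f).eval s = if I.G.Adj i j then 1 else 0 := by
  simp [adjAt, he, hf, h.input, h.jobs, I.inputState_adj]

end Reads

/-! ### Computing the earliest start schedule -/

namespace Cmd

/-- Writes `r j + 1` into `vZ` for the jobs `j` without predecessors and `0` for all others. -/
def initStart : Cmd :=
  iter vJ vN (set vZ (.var vJ) (rAt (.var vJ) + 1)) ;;
  iter vI vN (iter vJ vN (ite (adjAt (.var vI) (.var vJ)) (set vZ (.var vJ) 0) nop))

variable {b M : ℕ} {s : State} {I : Problem n m}

open Classical in
theorem initStart_yields (hs : Bdd b s) (hr : Reads I s) (hn : n ≤ M) (hM : M < 2 ^ b)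
    (hb : ∀ j, I.r j + 1 < 2 ^ b) : initStart.Yields b M s fun s' =>
      ∀ j : Fin n, (I.IsSource j → s' vZ j = I.r j + 1) ∧ (¬ I.IsSource j → s' vZ j = 0) := by
  refine yields_seq (fun s' => ∀ j : Fin n, s' vZ j = I.r j + 1) ?_ ?_
  · refine yields_iter (fun k st => ∀ j : Fin n, j < k → st vZ j = I.r j + 1) hs
      (hr.jobs ▸ hn) hM (by decide) (by decide) (by decide) (by simp) ?_ ?_
    · intro k hk st hst hfr hik hP
      have hrst : Reads I st := hr.congr (hfr _ (by decide)) (hfr _ (by decide))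
      rw [hr.jobs] at hk
      have he := hrst.eval_rAt (e := .var vJ) (j := ⟨k, hk⟩) (by simpa using hik)
      refine yields_set hst (by simpa [he] using hb _) fun j hj => ?_
      simp only [Expr.eval_var, Expr.eval_add, Expr.eval_one, he, hik]
      rw [State.write_of_ne _ _ _ (by decide), State.write_apply]
      split_ifs with h
      · congr 2; exact Fin.ext h.symm
      · exact hP j (by omega)
    · intro st hst _ j
      exact hst j (by rw [hr.jobs]; exact j.isLt)
  · intro s1 hs1 hfr1 hZ
    have hr1 : Reads I s1 := hr.congr (hfr1 _ (by decide)) (hfr1 _ (by decide))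
    refine yields_iter (fun k st => ∀ j : Fin n,
        ((∀ i : Fin n, i < k → ¬ I.G.Adj i j) → st vZ j = I.r j + 1) ∧
        (∀ i : Fin n, i < k → I.G.Adj i j → st vZ j = 0)) hs1
      (hr1.jobs ▸ hn) hM (by decide) (by decide) (by decide) ?_ ?_ ?_
    · intro j
      rw [State.write_of_ne _ _ _ (by decide)]
      exact ⟨fun _ => hZ j, fun i hi => absurd hi (by omega)⟩
    · intro i hi st hst hfr hii hP
      have hrst : Reads I st := hr1.congr (hfr _ (by decide)) (hfr _ (by decide))
      rw [hr1.jobs] at hi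
      refine yields_iter (fun k st' => st' vI 0 = i ∧ ∀ j : Fin n,
        st' vZ j = if (j : ℕ) < k ∧ I.G.Adj ⟨i, hi⟩ j then 0 else st vZ j) hst
        (hrst.jobs ▸ hn) hM (by decide) (by decide) (by decide) ?_ ?_ ?_
      · refine ⟨?_, fun j => ?_⟩
        · rw [State.write_of_ne _ _ _ (by decide), hii]
        · rw [State.write_of_ne _ _ _ (by decide), if_neg (by simp)]
      · rintro j hj st' hst' hfr' hjj ⟨hi', hP'⟩
        have hr' : Reads I st' := hrst.congr (hfr' _ (by decide)) (hfr' _ (by decide))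
        rw [hrst.jobs] at hj
        have he := hr'.eval_adjAt (e := .var vI) (f := .var vJ) (i := ⟨i, hi⟩) (j := ⟨j, hj⟩)
          (by simpa using hi') (by simpa using hjj)
        refine yields_ite hst' (fun hc => ?_) fun hc => ?_
        · refine yields_set hst' (by simp) ⟨?_, fun j' => ?_⟩
          · rw [State.write_of_ne _ _ _ (by decide), State.write_of_ne _ _ _ (by decide), hi']
          · rw [he] at hc
            rw [State.write_of_ne _ _ _ (by decide), State.write_apply]
            simp only [Expr.eval_var, hjj, Expr.eval_zero, hP' j']
            by_cases h : (j' : ℕ) = j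
            · have : j' = ⟨j, hj⟩ := Fin.ext h
              subst this
              simp_all
            · simp only [h, if_false, show j'.val < j + 1 ↔ j'.val < j by omega]
        · refine yields_nop hst' ⟨?_, fun j' => ?_⟩
          · rw [State.write_of_ne _ _ _ (by decide), hi']
          · rw [he] at hc
            rw [State.write_of_ne _ _ _ (by decide), hP' j']
            by_cases h : (j' : ℕ) = j
            · have : j' = ⟨j, hj⟩ := Fin.ext h
              subst this
              simp_all
            · simp only [show j'.val < j + 1 ↔ j'.val < j by omega]
      · rintro st' ⟨-, hP'⟩ - j
        rw [State.write_of_ne _ _ _ (by decide), hP' j, hrst.jobs]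
        refine ⟨fun h => ?_, fun i' hi' hadj => ?_⟩
        · rw [if_neg fun h' => h ⟨i, hi⟩ (by simp) h'.2]
          exact (hP j).1 fun i' hi' => h i' (by omega)
        · by_cases h : (i' : ℕ) = i
          · have : i' = ⟨i, hi⟩ := Fin.ext h
            subst this
            rw [if_pos ⟨j.isLt, hadj⟩]
          · rw [(hP j).2 i' (by omega) hadj, ite_self]
    · intro st hst _ j
      rw [hr1.jobs] at hst
      refine ⟨fun h => (hst j).1 fun i _ => h i, fun h => ?_⟩
      unfold Problem.IsSource at h
      push Not at h
      obtain ⟨i, hi⟩ := h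
      exact (hst j).2 i i.isLt hi

end Cmd

namespace Problem

/-- The number of jobs that start before `j` in the earliest start schedule. -/
def rank (S : Fin n → ℕ) (j : Fin n) : ℕ := (Finset.univ.filter fun i => S i < S j).card

theorem rank_lt_rank {S : Fin n → ℕ} {i j : Fin n} (h : S i < S j) : rank S i < rank S j := by
  refine Finset.card_lt_card ⟨fun k => ?_, fun hsub => ?_⟩
  · simp only [Finset.mem_filter, Finset.mem_univ, true_and]
    exact fun hk => hk.trans h
  · have := hsub (by simpa using h : i ∈ _)
    simp at this

theorem rank_le (S : Fin n → ℕ) (j : Fin n) : rank S j ≤ n :=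
  (Finset.card_le_univ _).trans (by simp)

variable (I : Problem n m)

open Classical in
/-- The tentative starts, plus one, after the arc from `i` to `j` has been taken into account;
the value `0` stands for a job that has not been reached. -/
noncomputable def relaxed (z : Fin n → ℕ) (i j : Fin n) : Fin n → ℕ :=
  if I.G.Adj i j ∧ z i ≠ 0 ∧ (z j = 0 ∨ max (I.r j + 1) (z i + I.p i) < z j) then
    Function.update z j (max (I.r j + 1) (z i + I.p i)) else z

/-- All tentative starts are attained along paths of the precedence graph. -/
def IsSound (z : Fin n → ℕ) : Prop := ∀ j, z j ≠ 0 → I.StartValue j (z j - 1)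

variable {I}

theorem IsSound.relaxed {z : Fin n → ℕ} (hz : I.IsSound z) (i j : Fin n) :
    I.IsSound (I.relaxed z i j) := by
  unfold Problem.relaxed
  split_ifs with h
  · intro j' hj'
    by_cases hjj : j' = j
    · subst hjj
      rw [Function.update_self]
      have := (hz i h.2.1).step h.1
      convert this using 1
      have := h.2.1
      omega
    · rw [Function.update_of_ne hjj] at hj' ⊢
      exact hz j' hj'
  · exact hz

theorem relaxed_eq_of_eq {S z : Fin n → ℕ} (hS : I.IsEarliestStart S) (hz : I.IsSound z)
    (i j : Fin n) {k : Fin n} (hk : z k = S k + 1) : I.relaxed z i j k = S k + 1 := by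
  have h1 := hz.relaxed i j
  unfold relaxed at h1 ⊢
  split_ifs at h1 ⊢ with h
  · by_cases hkj : k = j
    · subst hkj
      have := hS.le_startValue (h1 k (by rw [Function.update_self]; omega))
      rw [Function.update_self] at this ⊢
      omega
    · rwa [Function.update_of_ne hkj]
  · exact hk

/-- A tight arc carries the correct value of its tail to its head. -/
theorem relaxed_eq_of_tight {S z : Fin n → ℕ} (hS : I.IsEarliestStart S) (hz : I.IsSound z)
    {i j : Fin n} (hij : I.Tight S i j) (hi : z i = S i + 1) :
    I.relaxed z i j j = S j + 1 := by
  have h1 := hij.2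
  unfold relaxed
  split_ifs with h
  · rw [Function.update_self, hi, h1]
    omega
  · have h2 : z j ≠ 0 ∧ z j ≤ max (I.r j + 1) (z i + I.p i) := by
      by_contra hc
      exact h ⟨hij.1, by omega, by omega⟩
    have := hS.le_startValue (hz j h2.1)
    omega

theorem relaxed_le {z : Fin n → ℕ} {E B : ℕ} (hE : ∀ j, I.r j + 1 ≤ E) (hE' : ∀ j, I.p j ≤ E)
    (hz : ∀ j, z j ≤ E * (1 + B)) (i j k : Fin n) : I.relaxed z i j k ≤ E * (1 + (B + 1)) := by
  have h1 : E * (1 + (B + 1)) = E * (1 + B) + E := by ring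
  have h2 := hz k
  have h3 := hz i
  have h4 := hE j
  have h5 := hE' i
  have h6 : E ≤ E * (1 + B) := Nat.le_mul_of_pos_right _ (by omega)
  unfold relaxed
  split_ifs with h
  · by_cases hkj : k = j
    · subst hkj
      rw [Function.update_self]
      omega
    · rw [Function.update_of_ne hkj]
      omega
  · omega

end Problem

namespace Cmd

/-- The tentative start of `vJ`, plus one, that results from its predecessor `vI`. -/
def candidate : Expr := (rAt (.var vJ) + 1).max (.get vZ (.var vI) + pAt (.var vI))

/-- Bellman–Ford: takes every arc into account, as often as there are jobs. -/
def relaxAll : Cmd :=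
  iter vK vN (iter vI vN (iter vJ vN
    (ite (adjAt (.var vI) (.var vJ) * .get vZ (.var vI) *
        ((1 - .get vZ (.var vJ)) + candidate.lt (.get vZ (.var vJ))))
      (set vZ (.var vJ) candidate) nop)))

variable {b M : ℕ} {s : State} {I : Problem n m}

/-- The tentative starts in the memory `s`. -/
def starts (s : State) (j : Fin n) : ℕ := s vZ j

theorem relax_yields (hs : Bdd b s) (hr : Reads I s) {i j : Fin n} (hi : s vI 0 = i)
    (hj : s vJ 0 = j) (hb : ∀ k, I.relaxed (starts s) i j k < 2 ^ b) :
    (ite (adjAt (.var vI) (.var vJ) * .get vZ (.var vI) *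
        ((1 - .get vZ (.var vJ)) + candidate.lt (.get vZ (.var vJ))))
      (set vZ (.var vJ) candidate) nop).Yields b M s fun s' =>
        (starts s' : Fin n → ℕ) = I.relaxed (starts s) i j := by
  have he := hr.eval_adjAt (e := .var vI) (f := .var vJ) (i := i) (j := j) (by simpa using hi)
    (by simpa using hj)
  have hc : candidate.eval s = max (I.r j + 1) (starts s i + I.p i) := by
    simp [candidate, hr.eval_rAt (e := .var vJ) (j := j) (by simpa using hj),
      hr.eval_pAt (e := .var vI) (j := i) (by simpa using hi), hi, starts]
  have hcond : (adjAt (.var vI) (.var vJ) * .get vZ (.var vI) *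
      ((1 - .get vZ (.var vJ)) + candidate.lt (.get vZ (.var vJ))) : Expr).eval s ≠ 0 ↔
      I.G.Adj i j ∧ starts s i ≠ 0 ∧
        (starts s j = 0 ∨ max (I.r j + 1) (starts s i + I.p i) < starts s j) := by
    simp only [Expr.eval_mul, Expr.eval_add, Expr.eval_sub, Expr.eval_lt, Expr.eval_get, hc, he,
      Expr.eval_var, Expr.eval_one, hi, hj, starts]
    by_cases h1 : I.G.Adj i j
    · simp only [h1, if_true, one_mul, true_and, ne_eq, mul_eq_zero, not_or]
      split_ifs with h2
      · simp [h2]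
      · simp [h2]
        omega
    · simp [h1]
  refine yields_ite hs (fun h => ?_) fun h => ?_
  · rw [hcond] at h
    have hrel : I.relaxed (starts s) i j =
        Function.update (starts s) j (max (I.r j + 1) (starts s i + I.p i)) := if_pos h
    refine yields_set hs ?_ ?_
    · have := hb j
      rw [hrel, Function.update_self] at this
      rwa [hc]
    · rw [hrel]
      funext k
      simp only [Expr.eval_var, hj, hc, starts, State.write_apply, Function.update_apply, Fin.ext_iff]
  · have h' := mt hcond.2 (not_not.2 h)
    refine yields_nop hs ?_
    rw [Problem.relaxed, if_neg h']

/-- After `k` rounds, the starts of all jobs of rank at most `k` are correct. -/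
theorem relaxAll_yields (hs : Bdd b s) (hr : Reads I s) (hn : n ≤ M) (hM : M < 2 ^ b) {E : ℕ}
    (hE : ∀ j, I.r j + 1 ≤ E) (hE' : ∀ j, I.p j ≤ E) (hb : E * (1 + n * (n * n)) < 2 ^ b)
    (hz : ∀ j : Fin n, (I.IsSource j → s vZ j = I.r j + 1) ∧ (¬ I.IsSource j → s vZ j = 0)) :
    relaxAll.Yields b M s fun s' => I.IsSound (starts s') ∧
      (∀ S, I.IsEarliestStart S → ∀ j, starts s' j = S j + 1) ∧
      ∀ j : Fin n, starts s' j ≤ E * (1 + n * (n * n)) := by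
  refine yields_iter (fun k st => I.IsSound (starts st) ∧
      (∀ S, I.IsEarliestStart S → ∀ j, I.IsSource j ∨ Problem.rank S j ≤ k → starts st j = S j + 1) ∧
      ∀ j : Fin n, starts st j ≤ E * (1 + k * (n * n))) hs
    (hr.jobs ▸ hn) hM (by decide) (by decide) (by decide) ?_ ?_ ?_
  · have : starts (s.write vK 0 0) = (starts s : Fin n → ℕ) := rfl
    rw [this]
    refine ⟨fun j hj => ?_, fun S hS j hj => ?_, fun j => ?_⟩
    · by_cases h : I.IsSource j
      · rw [starts, (hz j).1 h, Nat.add_sub_cancel]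
        exact .source h
      · exact absurd ((hz j).2 h) hj
    · have h : I.IsSource j := by
        rcases hj with h | h
        · exact h
        · by_contra hc
          obtain ⟨i, hi⟩ := hS.exists_tight hc
          have := Problem.rank_lt_rank hi.lt
          omega
      rw [starts, (hz j).1 h, hS.1 j h]
    · have := hE j
      by_cases h : I.IsSource j
      · rw [starts, (hz j).1 h]; omega
      · rw [starts, (hz j).2 h]; omega
  · rintro k hk s1 hs1 hfr1 - ⟨hsnd, hex, hle⟩
    rw [hr.jobs] at hk
    have hr1 : Reads I s1 := hr.congr (hfr1 _ (by decide)) (hfr1 _ (by decide))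
    refine yields_iter (fun i st => I.IsSound (starts st) ∧
        (∀ S, I.IsEarliestStart S → (∀ j, I.IsSource j ∨ Problem.rank S j ≤ k →
          starts st j = S j + 1) ∧
          ∀ i' j, i'.val < i → I.Tight S i' j → Problem.rank S i' ≤ k → starts st j = S j + 1) ∧
        ∀ j : Fin n, starts st j ≤ E * (1 + (k * (n * n) + i * n))) hs1
      (hr1.jobs ▸ hn) hM (by decide) (by decide) (by decide) ?_ ?_ ?_
    · refine ⟨hsnd, fun S hS => ⟨hex S hS, fun i' j hi => absurd hi (by omega)⟩, fun j => ?_⟩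
      rw [zero_mul, add_zero]
      exact hle j
    · rintro i hi s2 hs2 hfr2 hi2 ⟨hsnd2, hex2, hle2⟩
      rw [hr1.jobs] at hi
      have hr2 : Reads I s2 := hr1.congr (hfr2 _ (by decide)) (hfr2 _ (by decide))
      refine yields_iter (fun j st => st vI 0 = i ∧ I.IsSound (starts st) ∧
          (∀ S, I.IsEarliestStart S → (∀ j, I.IsSource j ∨ Problem.rank S j ≤ k →
            starts st j = S j + 1) ∧
            (∀ i' j, i'.val < i → I.Tight S i' j → Problem.rank S i' ≤ k → starts st j = S j + 1) ∧
            ∀ j', j'.val < j → I.Tight S ⟨i, hi⟩ j' → Problem.rank S ⟨i, hi⟩ ≤ k →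
              starts st j' = S j' + 1) ∧
          ∀ j' : Fin n, starts st j' ≤ E * (1 + (k * (n * n) + i * n + j))) hs2
        (hr2.jobs ▸ hn) hM (by decide) (by decide) (by decide) ?_ ?_ ?_
      · refine ⟨by simpa using hi2, hsnd2, fun S hS => ⟨(hex2 S hS).1, (hex2 S hS).2,
          fun j hj => absurd hj (by omega)⟩, fun j => ?_⟩
        rw [add_zero]
        exact hle2 j
      · rintro j hj s3 hs3 hfr3 hj3 ⟨hi3, hsnd3, hex3, hle3⟩
        rw [hr2.jobs] at hj
        have hr3 : Reads I s3 := hr2.congr (hfr3 _ (by decide)) (hfr3 _ (by decide))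
        have hle4 := fun j' => Problem.relaxed_le hE hE' hle3 ⟨i, hi⟩ ⟨j, hj⟩ j'
        refine (relax_yields (i := ⟨i, hi⟩) (j := ⟨j, hj⟩) hs3 hr3 hi3 hj3 fun j' => ?_).mono ?_
        · refine lt_of_le_of_lt ((hle4 j').trans (Nat.mul_le_mul_left _ ?_)) hb
          nlinarith
        · intro s4 _ hfr4 h4
          have : starts (s4.write vJ 0 (j + 1)) = (starts s4 : Fin n → ℕ) := rfl
          refine ⟨?_, ?_⟩
          · rw [State.write_of_ne _ _ _ (by decide), hfr4 _ (by decide), hi3]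
          · rw [this, h4]
            refine ⟨hsnd3.relaxed _ _, fun S hS => ⟨fun j' hj' =>
              Problem.relaxed_eq_of_eq hS hsnd3 _ _ ((hex3 S hS).1 j' hj'), fun i' j' hi' ht hk' =>
              Problem.relaxed_eq_of_eq hS hsnd3 _ _ ((hex3 S hS).2.1 i' j' hi' ht hk'),
              fun j' hj' ht hk' => ?_⟩, hle4⟩
            by_cases h : j'.val = j
            · have : j' = ⟨j, hj⟩ := Fin.ext h
              subst this
              exact Problem.relaxed_eq_of_tight hS hsnd3 ht ((hex3 S hS).1 _ (Or.inr hk'))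
            · exact Problem.relaxed_eq_of_eq hS hsnd3 _ _
                ((hex3 S hS).2.2 j' (by omega) ht hk')
      · rintro s3 ⟨-, hsnd3, hex3, hle3⟩ -
        rw [hr2.jobs] at hex3 hle3
        have : starts (s3.write vI 0 (i + 1)) = (starts s3 : Fin n → ℕ) := rfl
        rw [this]
        refine ⟨hsnd3, fun S hS => ⟨(hex3 S hS).1, fun i' j hi' ht hk' => ?_⟩, fun j => ?_⟩
        · by_cases h : i'.val = i
          · have : i' = ⟨i, hi⟩ := Fin.ext h
            subst this
            exact (hex3 S hS).2.2 j j.isLt ht hk'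
          · exact (hex3 S hS).2.1 i' j (by omega) ht hk'
        · rw [add_mul i, one_mul, ← add_assoc (k * (n * n))]
          exact hle3 j
    · rintro s2 ⟨hsnd2, hex2, hle2⟩ -
      rw [hr1.jobs] at hex2 hle2
      have : starts (s2.write vK 0 (k + 1)) = (starts s2 : Fin n → ℕ) := rfl
      rw [this]
      refine ⟨hsnd2, fun S hS j hj => ?_, fun j => ?_⟩
      · by_cases hj' : I.IsSource j
        · exact (hex2 S hS).1 j (Or.inl hj')
        · obtain ⟨i, hi⟩ := hS.exists_tight hj'
          have := Problem.rank_lt_rank hi.lt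
          have := hj.resolve_left hj'
          exact (hex2 S hS).2 i j i.isLt hi (by omega)
      · rw [add_mul k, one_mul]
        exact hle2 j
  · rintro st ⟨h1, h2, h3⟩ -
    rw [hr.jobs] at h2 h3
    exact ⟨h1, fun S hS j => h2 S hS j (Or.inr (Problem.rank_le S j)), h3⟩

end Cmd

end

section

variable {n m : ℕ}

/-! ### Computing the forest and the optimal makespan -/

/-- The representation of an optional predecessor in memory. -/
def encodeParent : Option (Fin n) → ℕ
  | none => 0
  | some i => i + 1

namespace Cmd

/-- Chooses, for each job, a predecessor with smallest start among those that determine its start. -/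
def parents : Cmd :=
  iter vJ vN (set vPar (.var vJ) 0 ;;
    iter vI vN (ite (adjAt (.var vI) (.var vJ) *
        (.get vZ (.var vI) + pAt (.var vI) : Expr).le (.get vZ (.var vJ)) *
        ((1 - .get vPar (.var vJ)) +
          Expr.lt (.get vZ (.var vI)) (.get vZ (.get vPar (.var vJ) - 1))))
      (set vPar (.var vJ) (.var vI + 1)) nop))

variable {b M : ℕ} {s : State} {I : Problem n m}

/-- The value `v` encodes the best predecessor of `j` among the jobs below `i`. -/
def IsBestParent (I : Problem n m) (S : Fin n → ℕ) (i : ℕ) (j : Fin n) (v : ℕ) : Prop :=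
  ∃ o : Option (Fin n), v = encodeParent o ∧ (∀ i', o = some i' → I.Tight S i' j) ∧
    ∀ i' : Fin n, i'.val < i → I.Tight S i' j → ∃ i₀, o = some i₀ ∧ S i₀ ≤ S i'

theorem parents_yields (hs : Bdd b s) (hr : Reads I s) (hn : n ≤ M) (hM : M < 2 ^ b)
    {S : Fin n → ℕ} (hS : I.IsEarliestStart S) (hZ : ∀ j, starts s j = S j + 1) :
    parents.Yields b M s fun s' => ∃ par, I.IsTightForest S par ∧
      (∀ i i' j, par j = some i → I.Tight S i' j → S i ≤ S i') ∧
      ∀ j : Fin n, s' vPar j = encodeParent (par j) := by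
  refine yields_iter (fun k st => ∀ j : Fin n, j.val < k → IsBestParent I S n j (st vPar j)) hs
    (hr.jobs ▸ hn) hM (by decide) (by decide) (by decide) (by simp) ?_ ?_
  · intro j hj s1 hs1 hfr1 hj1 hP
    rw [hr.jobs] at hj
    refine yields_set_seq hs1 (by simp) ?_
    simp only [Expr.eval_var, hj1, Expr.eval_zero]
    have hs1' : Bdd b (s1.write vPar j 0) := hs1.write (by positivity)
    have hw : ∀ a, a ≠ vPar → s1.write vPar j 0 a = s1 a := fun a ha => State.write_of_ne _ _ _ ha
    have hr1 : Reads I (s1.write vPar j 0) := hr.congr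
      ((hw _ (by decide)).trans (hfr1 _ (by decide)))
      ((hw _ (by decide)).trans (hfr1 _ (by decide)))
    refine yields_iter (fun i st => IsBestParent I S i ⟨j, hj⟩ (st vPar j) ∧
      ∀ j', j' ≠ j → st vPar j' = s1 vPar j') hs1'
      (hr1.jobs ▸ hn) hM (by decide) (by decide) (by decide) ?_ ?_ ?_
    · simp only [State.write_of_ne _ _ _ (show (vPar : ℕ) ≠ vI by decide), State.write_apply]
      exact ⟨⟨none, by simp [encodeParent], by simp, fun i' hi' => absurd hi' (by omega)⟩,
        fun j' hj' => if_neg hj'⟩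
    · rintro i hi s2 hs2 hfr2 hi2 ⟨⟨o, ho, ht, hbest⟩, hother⟩
      rw [hr1.jobs] at hi
      have hr2 : Reads I s2 := hr1.congr (hfr2 _ (by decide)) (hfr2 _ (by decide))
      have hj2 : s2 vJ 0 = j := by rw [hfr2 _ (by decide), hw _ (by decide), hj1]
      have hZ2 : s2 vZ = s vZ := by
        rw [hfr2 _ (by decide), hw _ (by decide), hfr1 _ (by decide)]
      have hZ' : ∀ k : Fin n, s2 vZ k = S k + 1 := fun k => by rw [hZ2]; exact hZ k
      have he := hr2.eval_adjAt (e := .var vI) (f := .var vJ) (i := ⟨i, hi⟩) (j := ⟨j, hj⟩)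
        (by simpa using hi2) (by simpa using hj2)
      have hp := hr2.eval_pAt (e := .var vI) (j := ⟨i, hi⟩) (by simpa using hi2)
      have hcond : (adjAt (.var vI) (.var vJ) *
          (.get vZ (.var vI) + pAt (.var vI) : Expr).le (.get vZ (.var vJ)) *
          ((1 - .get vPar (.var vJ)) +
            Expr.lt (.get vZ (.var vI)) (.get vZ (.get vPar (.var vJ) - 1))) : Expr).eval s2 ≠ 0 ↔
          I.Tight S ⟨i, hi⟩ ⟨j, hj⟩ ∧ ∀ i₀, o = some i₀ → S ⟨i, hi⟩ < S i₀ := by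
        have h1 := hZ' ⟨i, hi⟩
        have h2 := hZ' ⟨j, hj⟩
        simp only at h1 h2
        simp only [Expr.eval_mul, Expr.eval_add, Expr.eval_sub, Expr.eval_lt, Expr.eval_le,
          Expr.eval_get, hp, he, Expr.eval_var, Expr.eval_one, hi2, hj2, h1, h2, ho, hS.tight_iff]
        by_cases hadj : I.G.Adj ⟨i, hi⟩ ⟨j, hj⟩
        · cases o with
          | none =>
            simp [hadj, encodeParent]
            omega
          | some i₀ =>
            simp [hadj, encodeParent, hZ']
            omega
        · simp [hadj]
      refine yields_ite hs2 (fun h => ?_) fun h => ?_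
      · rw [hcond] at h
        refine yields_set hs2 ?_ ?_
        · simp only [Expr.eval_add, Expr.eval_var, Expr.eval_one, hi2]
          omega
        · simp only [Expr.eval_add, Expr.eval_var, Expr.eval_one, hi2, hj2,
            State.write_of_ne _ _ _ (show (vPar : ℕ) ≠ vI by decide), State.write_apply]
          refine ⟨⟨some ⟨i, hi⟩, by simp [encodeParent], by rintro _ ⟨⟩; exact h.1,
            fun i' hi' ht' => ⟨_, rfl, ?_⟩⟩, fun j' hj' => ?_⟩
          · by_cases hii : i'.val = i
            · exact (congrArg S (Fin.ext hii)).ge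
            · obtain ⟨i₀, hi₀, hle⟩ := hbest i' (by omega) ht'
              exact (h.2 i₀ hi₀).le.trans hle
          · rw [if_neg hj']
            exact hother j' hj'
      · have h' := mt hcond.2 (not_not.2 h)
        refine yields_nop hs2 ?_
        simp only [State.write_of_ne _ _ _ (show (vPar : ℕ) ≠ vI by decide)]
        refine ⟨⟨o, ho, ht, fun i' hi' ht' => ?_⟩, hother⟩
        by_cases hii : i'.val = i
        · obtain rfl : i' = ⟨i, hi⟩ := Fin.ext hii
          by_contra hc
          exact h' ⟨ht', fun i₀ hi₀ => not_le.1 fun hle => hc ⟨i₀, hi₀, hle⟩⟩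
        · exact hbest i' (by omega) ht'
    · rintro s2 ⟨hb, hother⟩ -
      rw [hr1.jobs] at hb
      intro j' hj'
      rw [State.write_of_ne _ _ _ (by decide)]
      by_cases h : j'.val = j
      · obtain rfl : j' = ⟨j, hj⟩ := Fin.ext h
        exact hb
      · rw [hother _ h]
        exact hP j' (by omega)
  · intro st hst _
    rw [hr.jobs] at hst
    have := fun j : Fin n => hst j j.isLt
    unfold IsBestParent at this
    choose par h1 h2 h3 using this
    refine ⟨par, ⟨fun h => h2 _ _ h, fun {j} hj => ?_⟩, fun i i' j hi hi' => ?_, h1⟩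
    · by_contra hc
      obtain ⟨i, hi⟩ := hS.exists_tight hc
      obtain ⟨i₀, hi₀, -⟩ := h3 j i i.isLt hi
      rw [hj] at hi₀
      cases hi₀
    · obtain ⟨i₀, hi₀, hle⟩ := h3 j i' i'.isLt hi'
      rw [hi] at hi₀
      cases hi₀
      exact hle

/-- Sets `vBad` if some job has not been reached. -/
def findBad : Cmd :=
  set vBad 0 0 ;; iter vJ vN (ite (.get vZ (.var vJ)) nop (set vBad 0 1))

theorem findBad_yields (hs : Bdd b s) (hr : Reads I s) (hn : n ≤ M) (hM : M < 2 ^ b)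
    (hb : 1 < 2 ^ b) :
    findBad.Yields b M s fun s' => s' vBad 0 = 0 ↔ ∀ j : Fin n, starts s j ≠ 0 := by
  refine yields_set_seq hs (by simp) ?_
  simp only [Expr.eval_zero]
  have hw : ∀ a, a ≠ vBad → s.write vBad 0 0 a = s a := fun a ha => State.write_of_ne _ _ _ ha
  have hr1 : Reads I (s.write vBad 0 0) := hr.congr (hw _ (by decide)) (hw _ (by decide))
  refine yields_iter (fun k st => st vBad 0 = 0 ↔ ∀ j : Fin n, j.val < k → starts s j ≠ 0)
    (hs.write (by positivity)) (hr1.jobs ▸ hn) hM (by decide) (by decide) (by decide) (by simp) ?_ ?_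
  · intro j hj s1 hs1 hfr1 hj1 hP
    rw [hr1.jobs] at hj
    have hZ : s1 vZ j = starts s (⟨j, hj⟩ : Fin n) := by
      rw [hfr1 _ (by decide), hw _ (by decide)]; rfl
    refine yields_ite hs1 (fun h => ?_) fun h => ?_
    · simp only [Expr.eval_get, Expr.eval_var, hj1, hZ] at h
      refine yields_nop hs1 ?_
      rw [State.write_of_ne _ _ _ (by decide), hP]
      refine ⟨fun h' j' hj' => ?_, fun h' j' hj' => h' j' (by omega)⟩
      by_cases hjj : j'.val = j
      · obtain rfl : j' = ⟨j, hj⟩ := Fin.ext hjj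
        exact h
      · exact h' j' (by omega)
    · simp only [Expr.eval_get, Expr.eval_var, hj1, hZ] at h
      refine yields_set hs1 (by simpa using hb) ?_
      rw [State.write_of_ne _ _ _ (by decide)]
      simp only [Expr.eval_zero, Expr.eval_one, State.write_self, one_ne_zero, false_iff]
      exact fun h' => h' ⟨j, hj⟩ (Nat.lt_succ_self _) h
  · intro st hst _
    rw [hr1.jobs] at hst
    rw [hst]
    exact ⟨fun h j => h j j.isLt, fun h j _ => h j⟩

/-- Writes the starts of the earliest start schedule into `vS`. -/
def shiftStart : Cmd := iter vJ vN (set vS (.var vJ) (.get vZ (.var vJ) - 1))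

theorem shiftStart_yields (hs : Bdd b s) (hr : Reads I s) (hn : n ≤ M) (hM : M < 2 ^ b) :
    shiftStart.Yields b M s fun s' => ∀ j : Fin n, s' vS j = starts s j - 1 := by
  refine yields_iter (fun k st => ∀ j : Fin n, j.val < k → st vS j = starts s j - 1) hs
    (hr.jobs ▸ hn) hM (by decide) (by decide) (by decide) (by simp) ?_ ?_
  · intro j hj s1 hs1 hfr1 hj1 hP
    have hZ : s1 vZ j = s vZ j := by rw [hfr1 _ (by decide)]
    refine yields_set hs1 ?_ fun j' hj' => ?_
    · simp only [Expr.eval_sub, Expr.eval_get, Expr.eval_var]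
      exact (Nat.sub_le _ _).trans_lt (hs1 _ _)
    · rw [State.write_of_ne _ _ _ (by decide), State.write_apply]
      simp only [Expr.eval_sub, Expr.eval_get, Expr.eval_var, Expr.eval_one, hj1, hZ]
      split_ifs with h
      · rw [← h]; rfl
      · exact hP j' (by omega)
  · intro st hst _ j
    exact hst j (by rw [hr.jobs]; exact j.isLt)

/-- Computes the optimal makespan, in units of `1 / m`. -/
def computeBound : Cmd :=
  set vB 0 0 ;; iter vJ vN (set vW 0 0 ;;
    iter vI vN (set vW 0 (.var vW + (pAt (.var vI)).min
      (.get vS (.var vI) + pAt (.var vI) - .get vS (.var vJ)))) ;;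
    set vB 0 ((Expr.var vB).max ((.var vM * .get vS (.var vJ) + .var vW : Expr).max
      (.var vM * (.get vS (.var vJ) + pAt (.var vJ))))))

theorem computeBound_yields (hs : Bdd b s) (hr : Reads I s) (hn : n ≤ M) (hM : M < 2 ^ b)
    (hm : s vM 0 = m) {S : Fin n → ℕ} (hS : ∀ j : Fin n, s vS j = S j) (hb : I.bound S < 2 ^ b) :
    computeBound.Yields b M s fun s' => s' vB 0 = I.bound S := by
  set F : Fin n → ℕ := fun j =>
    max (m * S j + ∑ i, min (I.p i) (S i + I.p i - S j)) (m * (S j + I.p j)) with hF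
  have hFle : ∀ j, F j ≤ I.bound S := fun j => Finset.le_sup (f := F) (Finset.mem_univ j)
  refine yields_set_seq hs (by simp) ?_
  simp only [Expr.eval_zero]
  have hw : ∀ a, a ≠ vB → s.write vB 0 0 a = s a := fun a ha => State.write_of_ne _ _ _ ha
  have hr1 : Reads I (s.write vB 0 0) := hr.congr (hw _ (by decide)) (hw _ (by decide))
  refine yields_iter (fun k st => st vB 0 = (Finset.univ.filter fun j : Fin n => j.val < k).sup F)
    (hs.write (by positivity)) (hr1.jobs ▸ hn) hM (by decide) (by decide) (by decide) (by simp) ?_ ?_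
  · intro j hj s1 hs1 hfr1 hj1 hP
    rw [hr1.jobs] at hj
    refine yields_set_seq hs1 (by simp) ?_
    simp only [Expr.eval_zero]
    have hw1 : ∀ a, a ≠ vW → s1.write vW 0 0 a = s1 a := fun a ha => State.write_of_ne _ _ _ ha
    have hr2 : Reads I (s1.write vW 0 0) := hr1.congr
      ((hw1 _ (by decide)).trans (hfr1 _ (by decide)))
      ((hw1 _ (by decide)).trans (hfr1 _ (by decide)))
    set w : Fin n → ℕ := fun i => min (I.p i) (S i + I.p i - S ⟨j, hj⟩) with hwdef
    have hwle : ∑ i, w i ≤ I.bound S :=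
      (Nat.le_add_left _ _).trans ((le_max_left _ _).trans (hFle ⟨j, hj⟩))
    refine yields_seq (fun st => st vW 0 = ∑ i, w i ∧ ∀ a, a ≠ vW → a ≠ vI → st a = s1 a) ?_ ?_
    · refine yields_iter (fun k st => st vW 0 = prefixSum w k) (hs1.write (by positivity))
        (hr2.jobs ▸ hn) hM (by decide) (by decide) (by decide) (by simp [prefixSum]) ?_ ?_
      · intro i hi s2 hs2 hfr2 hi2 hP2
        rw [hr2.jobs] at hi
        have hr3 : Reads I s2 := hr2.congr (hfr2 _ (by decide)) (hfr2 _ (by decide))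
        have hp := hr3.eval_pAt (e := .var vI) (j := ⟨i, hi⟩) (by simpa using hi2)
        have hj2 : s2 vJ 0 = j := by rw [hfr2 _ (by decide), hw1 _ (by decide), hj1]
        have hS2 : ∀ k : Fin n, s2 vS k = S k := fun k => by
          rw [hfr2 _ (by decide), hw1 _ (by decide), hfr1 _ (by decide), hw _ (by decide), hS]
        have h1 := hS2 ⟨i, hi⟩
        have h2 := hS2 ⟨j, hj⟩
        simp only at h1 h2
        have hv : (.var vW + (pAt (.var vI)).min
            (.get vS (.var vI) + pAt (.var vI) - .get vS (.var vJ)) : Expr).eval s2 =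
            prefixSum w (i + 1) := by
          rw [show i + 1 = (⟨i, hi⟩ : Fin n).val + 1 from rfl, prefixSum_succ]
          simp [hp, hi2, hj2, h1, h2, hP2, hwdef]
        refine yields_set hs2 ?_ ?_
        · rw [hv]
          exact ((prefixSum_le _ _).trans hwle).trans_lt hb
        · rw [hv, State.write_of_ne _ _ _ (by decide)]
          simp
      · intro s2 h2 hfr2
        refine ⟨?_, fun a ha ha' => ?_⟩
        · rw [h2, hr2.jobs, prefixSum]
          congr 1
          simp
        · rw [hfr2 a (by simp [writes, ha, ha']), hw1 a ha]
    · rintro s2 hs2 - ⟨hW, hfr2⟩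
      have hr3 : Reads I s2 := hr1.congr
        ((hfr2 _ (by decide) (by decide)).trans (hfr1 _ (by decide)))
        ((hfr2 _ (by decide) (by decide)).trans (hfr1 _ (by decide)))
      have hj2 : s2 vJ 0 = j := by rw [hfr2 _ (by decide) (by decide), hj1]
      have hp := hr3.eval_pAt (e := .var vJ) (j := ⟨j, hj⟩) (by simpa using hj2)
      have hm2 : s2 vM 0 = m := by
        rw [hfr2 _ (by decide) (by decide), hfr1 _ (by decide), hw _ (by decide), hm]
      have hB2 : s2 vB 0 = s1 vB 0 := by rw [hfr2 _ (by decide) (by decide)]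
      have h2 : s2 vS j = S ⟨j, hj⟩ := by
        rw [hfr2 _ (by decide) (by decide), hfr1 _ (by decide), hw _ (by decide)]
        exact hS ⟨j, hj⟩
      have hv : ((Expr.var vB).max ((.var vM * .get vS (.var vJ) + .var vW : Expr).max
          (.var vM * (.get vS (.var vJ) + pAt (.var vJ))))).eval s2 =
          (Finset.univ.filter fun i : Fin n => i.val < j + 1).sup F := by
        have : (Finset.univ.filter fun i : Fin n => i.val < j + 1) =
            insert ⟨j, hj⟩ (Finset.univ.filter fun i : Fin n => i.val < j) := by
          ext i
          simp only [Finset.mem_filter, Finset.mem_univ, true_and, Finset.mem_insert, Fin.ext_iff]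
          omega
        rw [this, Finset.sup_insert, ← hP, sup_comm]
        simp [hp, hj2, hm2, h2, hW, hB2, hF, hwdef]
      refine yields_set hs2 ?_ ?_
      · rw [hv]
        exact (Finset.sup_mono (Finset.filter_subset _ _)).trans_lt hb
      · rw [hv, State.write_of_ne _ _ _ (by decide)]
        simp
  · intro st hst _
    rw [hst, hr1.jobs, Problem.bound]
    congr 1
    simp

end Cmd

end

section

variable {n m : ℕ}

/-! ### Computing the levels -/

open Problem

/-- The data of a round: the problem, a forest, and the remaining work `rem j`, in units of
`1 / D`. -/
structure RoundData (I : Problem n m) (S : Fin n → ℕ) (par : Fin n → Option (Fin n)) (D : ℕ)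
    (rem : Fin n → ℕ) (s : State) : Prop where
  reads : Reads I s
  machines : s vM 0 = m
  start : ∀ j : Fin n, s vS j = S j
  parent : ∀ j : Fin n, s vPar j = encodeParent (par j)
  unit : s vD 0 = D
  rem : ∀ j : Fin n, s vRem j = rem j

variable {I : Problem n m} {S : Fin n → ℕ} {par : Fin n → Option (Fin n)} {D : ℕ}
  {rem : Fin n → ℕ} {b M : ℕ} {s s' : State}

theorem RoundData.congr (h : RoundData I S par D rem s)
    (hs : ∀ a ∈ [vIn, vN, vM, vS, vPar, vD, vRem], s' a = s a) : RoundData I S par D rem s' where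
  reads := h.reads.congr (hs _ (by decide)) (hs _ (by decide))
  machines := by rw [hs _ (by decide), h.machines]
  start := fun j => by rw [hs _ (by decide), h.start]
  parent := fun j => by rw [hs _ (by decide), h.parent]
  unit := by rw [hs _ (by decide), h.unit]
  rem := fun j => by rw [hs _ (by decide), h.rem]

open Classical in
/-- The levels of all jobs, and which of them are pending, are known. -/
structure HasLevels (S : Fin n → ℕ) (par : Fin n → Option (Fin n)) (D : ℕ) (rem : Fin n → ℕ)
    (s : State) : Prop where
  level : ∀ j : Fin n, s vX j = level S D rem j
  pending : ∀ j : Fin n, s vAv (j + 1) = if j ∈ pendingJobs par rem then 1 else 0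

theorem HasLevels.congr (h : HasLevels S par D rem s) (hX : s' vX = s vX) (hAv : s' vAv = s vAv) :
    HasLevels S par D rem s' where
  level := fun j => by rw [hX, h.level]
  pending := fun j => by rw [hAv, h.pending]

namespace Cmd

/-- Computes the level of each job, and marks the pending jobs (with indices shifted by one, like
the entries of `vPar`). -/
def findLevels : Cmd :=
  iter vJ vN (set vX (.var vJ) (.get vS (.var vJ) * .var vD + .get vRem (.var vJ)) ;;
    set vAv (.var vJ + 1) ((0 : Expr).lt (.get vRem (.var vJ)))) ;;
  iter vK vN (ite (.get vRem (.var vK)) (set vAv (.get vPar (.var vK)) 0) nop)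

theorem findLevels_yields (hs : Bdd b s) (hr : RoundData I S par D rem s) (hn : n ≤ M)
    (hM : M < 2 ^ b) (hb : ∀ j, level S D rem j < 2 ^ b) (hb1 : 1 < 2 ^ b) :
    findLevels.Yields b M s fun s' => HasLevels S par D rem s' := by
  classical
  refine yields_seq (fun st => (∀ j : Fin n, st vX j = level S D rem j) ∧
    ∀ j : Fin n, st vAv (j + 1) = if 0 < rem j then 1 else 0) ?_ ?_
  · refine yields_iter (fun k st => ∀ j : Fin n, j.val < k → st vX j = level S D rem j ∧
      st vAv (j + 1) = if 0 < rem j then 1 else 0) hs (hr.reads.jobs ▸ hn) hM (by decide)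
      (by decide) (by decide) (by simp) ?_ ?_
    · intro j hj s1 hs1 hfr1 hj1 hP
      rw [hr.reads.jobs] at hj
      have hr1 : RoundData I S par D rem s1 := hr.congr (by
        intro a ha; exact hfr1 a (by fin_cases ha <;> decide))
      have h1 := hr1.start ⟨j, hj⟩
      have h2 := hr1.rem ⟨j, hj⟩
      simp only at h1 h2
      have hv : (.get vS (.var vJ) * .var vD + .get vRem (.var vJ) : Expr).eval s1 =
          level S D rem ⟨j, hj⟩ := by
        simp [hj1, h1, h2, hr1.unit, level]
      refine yields_set_seq hs1 (by rw [hv]; exact hb _) ?_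
      rw [hv]
      simp only [Expr.eval_var, hj1]
      set s2 := s1.write vX j (level S D rem ⟨j, hj⟩) with hs2
      have hw : ∀ a, a ≠ vX → s2 a = s1 a := fun a ha => State.write_of_ne _ _ _ ha
      have hj2 : s2 vJ 0 = j := by rw [hw _ (by decide), hj1]
      have h3 : s2 vRem j = rem ⟨j, hj⟩ := by rw [hw _ (by decide), h2]
      refine yields_set (hs1.write (hb _)) ?_ fun j' hj' => ?_
      · simp only [Expr.eval_lt]; split_ifs <;> omega
      · have hv2 : ((0 : Expr).lt (.get vRem (.var vJ))).eval s2 =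
            if 0 < rem ⟨j, hj⟩ then 1 else 0 := by
          simp [hj2, h3]
        have ha2 : (.var vJ + 1 : Expr).eval s2 = j + 1 := by simp [hj2]
        have hX2 : ∀ l, s2 vX l = if l = j then level S D rem ⟨j, hj⟩ else s1 vX l :=
          fun l => State.write_apply _ _ _ _ _
        rw [hv2, ha2, State.write_of_ne _ _ _ (by decide), State.write_of_ne _ _ _ (by decide),
          State.write_of_ne _ _ _ (by decide), State.write_apply, hX2, hw _ (by decide)]
        by_cases h : j'.val = j
        · obtain rfl : j' = ⟨j, hj⟩ := Fin.ext h
          exact ⟨if_pos rfl, if_pos rfl⟩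
        · rw [if_neg h, if_neg (by omega)]
          exact hP j' (by omega)
    · intro st hst _
      rw [hr.reads.jobs] at hst
      exact ⟨fun j => (hst j j.isLt).1, fun j => (hst j j.isLt).2⟩
  · rintro s1 hs1 hfr1 ⟨hX, hAv⟩
    have hr1 : RoundData I S par D rem s1 := hr.congr (by
      intro a ha; exact hfr1 a (by fin_cases ha <;> decide))
    refine yields_iter (fun k st => ∀ j : Fin n, st vAv (j + 1) =
      if 0 < rem j ∧ ∀ i : Fin n, i.val < k → 0 < rem i → par i ≠ some j then 1 else 0) hs1
      (hr1.reads.jobs ▸ hn) hM (by decide) (by decide) (by decide) ?_ ?_ ?_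
    · intro j
      rw [State.write_of_ne _ _ _ (by decide), hAv]
      simp
    · intro k hk s2 hs2 hfr2 hk2 hP
      rw [hr1.reads.jobs] at hk
      have hr2 : RoundData I S par D rem s2 := hr1.congr (by
        intro a ha; exact hfr2 a (by fin_cases ha <;> decide))
      have h1 := hr2.rem ⟨k, hk⟩
      have h2 := hr2.parent ⟨k, hk⟩
      simp only at h1 h2
      refine yields_ite hs2 (fun h => ?_) fun h => ?_
      · simp only [Expr.eval_get, Expr.eval_var, hk2, h1] at h
        refine yields_set hs2 (by simp) fun j => ?_
        rw [State.write_of_ne _ _ _ (by decide), State.write_apply, hP]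
        simp only [Expr.eval_get, Expr.eval_var, Expr.eval_zero, hk2, h2]
        have hpk : (j : ℕ) + 1 = encodeParent (par ⟨k, hk⟩) ↔ par ⟨k, hk⟩ = some j := by
          cases hp : par ⟨k, hk⟩ with
          | none => simp [encodeParent]
          | some i => simp [encodeParent, Fin.ext_iff, eq_comm]
        have hiff : (∀ i : Fin n, i.val < k + 1 → 0 < rem i → par i ≠ some j) ↔
            par ⟨k, hk⟩ ≠ some j ∧ ∀ i : Fin n, i.val < k → 0 < rem i → par i ≠ some j := by
          refine ⟨fun h' => ⟨h' ⟨k, hk⟩ (Nat.lt_succ_self _) (by omega),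
            fun i hi => h' i (by omega)⟩, fun h' i hi hri => ?_⟩
          by_cases hik : i.val = k
          · obtain rfl : i = ⟨k, hk⟩ := Fin.ext hik
            exact h'.1
          · exact h'.2 i (by omega) hri
        simp only [hpk, hiff]
        by_cases hp : par ⟨k, hk⟩ = some j <;> simp [hp]
      · simp only [Expr.eval_get, Expr.eval_var, hk2, h1] at h
        refine yields_nop hs2 fun j => ?_
        rw [State.write_of_ne _ _ _ (by decide), hP]
        have hiff : (∀ i : Fin n, i.val < k + 1 → 0 < rem i → par i ≠ some j) ↔
            ∀ i : Fin n, i.val < k → 0 < rem i → par i ≠ some j := by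
          refine ⟨fun h' i hi => h' i (by omega), fun h' i hi hri => ?_⟩
          by_cases hik : i.val = k
          · obtain rfl : i = ⟨k, hk⟩ := Fin.ext hik
            omega
          · exact h' i (by omega) hri
        simp only [hiff]
    · intro s2 h2 hfr2
      refine ⟨fun j => by rw [hfr2 _ (by decide), hX], fun j => ?_⟩
      have hiff : (∀ i : Fin n, i.val < n → 0 < rem i → par i ≠ some j) ↔
          ∀ k, par k = some j → rem k = 0 := by
        refine ⟨fun h k hk => ?_, fun h i _ hi hp => ?_⟩
        · by_contra hc
          exact h k k.isLt (by omega) hk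
        · have := h i hp
          omega
      rw [h2, hr1.reads.jobs]
      simp only [hiff, mem_pendingJobs, Pending]

/-- Finds the `m`-th largest level of the pending jobs. -/
def findShared : Cmd :=
  set vH 0 0 ;; set vG 0 1 ;; set vC 0 1 ;;
  iter vJ vN (set vU 0 0 ;; set vV 0 0 ;;
    iter vI vN (
      set vU 0 (.var vU + .get vAv (.var vI + 1) *
        Expr.lt (.get vX (.var vJ)) (.get vX (.var vI))) ;;
      set vV 0 (.var vV + .get vAv (.var vI + 1) *
        Expr.le (.get vX (.var vJ)) (.get vX (.var vI)))) ;;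
    ite (.get vAv (.var vJ + 1) * (Expr.var vU).lt (.var vM) * (Expr.var vM).le (.var vV))
      (set vH 0 (.get vX (.var vJ)) ;; set vG 0 (.var vV - .var vU) ;;
        set vC 0 (.var vM - .var vU)) nop)

end Cmd

namespace Problem

variable (S par)

/-- The number of pending jobs at levels larger than that of `j`. -/
noncomputable def numAbove (D : ℕ) (rem : Fin n → ℕ) (j : Fin n) : ℕ :=
  ((pendingJobs par rem).filter fun i => level S D rem j < level S D rem i).card

/-- The number of pending jobs at levels at least that of `j`. -/
noncomputable def numFrom (D : ℕ) (rem : Fin n → ℕ) (j : Fin n) : ℕ :=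
  ((pendingJobs par rem).filter fun i => level S D rem j ≤ level S D rem i).card

variable {S par}

open Finset in
theorem isShared_of_lt_of_le {j : Fin n} (h1 : numAbove S par D rem j < m)
    (h2 : m ≤ numFrom S par D rem j) :
    IsShared m S par D rem (level S D rem j)
      (numFrom S par D rem j - numAbove S par D rem j) (m - numAbove S par D rem j) := by
  have h3 : numFrom S par D rem j = numAbove S par D rem j +
      #{i ∈ pendingJobs par rem | level S D rem i = level S D rem j} := by
    rw [numFrom, numAbove, ← card_union_of_disjoint]
    · congr 1
      ext i
      simp only [mem_filter, mem_union]
      rw [le_iff_lt_or_eq, eq_comm (a := level S D rem i)]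
      tauto
    · rw [disjoint_filter]
      intro i _ h h'
      omega
  right
  refine ⟨?_, by omega, by omega, by omega⟩
  rw [← numAbove]
  omega

open Finset in
/-- If no level is the `m`-th largest one, then at most `m` jobs are pending. -/
theorem card_pendingJobs_le (hm : 0 < m)
    (h : ∀ j ∈ pendingJobs par rem, ¬ (numAbove S par D rem j < m ∧ m ≤ numFrom S par D rem j)) :
    #(pendingJobs par rem) ≤ m := by
  by_contra hc
  push Not at hc
  -- the largest level at and above which there are at least `m` pending jobs
  have hne : ((pendingJobs par rem).filter fun j => m ≤ numFrom S par D rem j).Nonempty := by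
    obtain ⟨j, hj, hmin⟩ := exists_min_image (pendingJobs par rem) (level S D rem)
      (card_pos.1 (by omega))
    refine ⟨j, mem_filter.2 ⟨hj, ?_⟩⟩
    rw [numFrom, filter_true_of_mem hmin]
    exact hc.le
  obtain ⟨j, hj, hmax⟩ := exists_max_image _ (level S D rem) hne
  rw [mem_filter] at hj
  have h1 : m ≤ numAbove S par D rem j := by
    by_contra h2
    exact h j hj.1 ⟨by omega, hj.2⟩
  obtain ⟨i, hi, hmin⟩ := exists_min_image
    ((pendingJobs par rem).filter fun i => level S D rem j < level S D rem i) (level S D rem)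
    (card_pos.1 (lt_of_lt_of_le hm h1))
  rw [mem_filter] at hi
  have h2 : m ≤ numFrom S par D rem i := by
    refine h1.trans (card_le_card fun k hk => ?_)
    exact mem_filter.2 ⟨(mem_filter.1 hk).1, hmin k hk⟩
  have := hmax i (mem_filter.2 ⟨hi.1, h2⟩)
  omega

end Problem

theorem prefixSum_eq_sum (a : Fin n → ℕ) : prefixSum a n = ∑ i, a i := by
  rw [prefixSum]; congr 1; simp

namespace Cmd

theorem findShared_yields (hs : Bdd b s) (hr : RoundData I S par D rem s)
    (hl : HasLevels S par D rem s) (hm : 0 < m) (hn : n ≤ M) (hM : M < 2 ^ b) (hb1 : 1 < 2 ^ b) :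
    findShared.Yields b M s fun s' => IsShared m S par D rem (s' vH 0) (s' vG 0) (s' vC 0) := by
  classical
  refine yields_set_seq hs (by simp) ?_
  refine yields_set_seq (hs.write (by simp)) (by simpa using hb1) ?_
  refine yields_set_seq ((hs.write (by simp)).write (by simpa using hb1)) (by simpa using hb1) ?_
  simp only [Expr.eval_zero, Expr.eval_one]
  set s0 := ((s.write vH 0 0).write vG 0 1).write vC 0 1 with hs0
  have hw : ∀ a, a ≠ vH → a ≠ vG → a ≠ vC → s0 a = s a := fun a h1 h2 h3 => by
    rw [hs0, State.write_of_ne _ _ _ h3, State.write_of_ne _ _ _ h2, State.write_of_ne _ _ _ h1]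
  have hb0 : Bdd b s0 :=
    ((hs.write (by positivity)).write (by simpa using hb1)).write (by simpa using hb1)
  have hr0 : RoundData I S par D rem s0 := hr.congr (by
    intro a ha; fin_cases ha <;> exact hw _ (by decide) (by decide) (by decide))
  have hl0 : HasLevels S par D rem s0 := hl.congr
    (hw _ (by decide) (by decide) (by decide)) (hw _ (by decide) (by decide) (by decide))
  refine yields_iter (fun k st => IsShared m S par D rem (st vH 0) (st vG 0) (st vC 0) ∨
    (st vH 0 = 0 ∧ st vG 0 = 1 ∧ st vC 0 = 1 ∧ ∀ j ∈ pendingJobs par rem, j.val < k →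
      ¬ (numAbove S par D rem j < m ∧ m ≤ numFrom S par D rem j))) hb0
      (hr0.reads.jobs ▸ hn) hM (by decide) (by decide) (by decide) ?_ ?_ ?_
  · right
    simp [hs0]
  · intro j hj s1 hs1 hfr1 hj1 hP
    rw [hr0.reads.jobs] at hj
    have hr1 : RoundData I S par D rem s1 := hr0.congr (by
      intro a ha; exact hfr1 a (by fin_cases ha <;> decide))
    have hl1 : HasLevels S par D rem s1 := hl0.congr (hfr1 _ (by decide)) (hfr1 _ (by decide))
    refine yields_set_seq hs1 (by simp) ?_
    refine yields_set_seq (hs1.write (by simp)) (by simp) ?_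
    simp only [Expr.eval_zero]
    set s2 := (s1.write vU 0 0).write vV 0 0 with hs2
    have hb2 : Bdd b s2 := (hs1.write (by positivity)).write (by positivity)
    have hw2 : ∀ a, a ≠ vU → a ≠ vV → s2 a = s1 a := fun a h1 h2 => by
      rw [hs2, State.write_of_ne _ _ _ h2, State.write_of_ne _ _ _ h1]
    have hr2 : RoundData I S par D rem s2 := hr1.congr (by
      intro a ha; fin_cases ha <;> exact hw2 _ (by decide) (by decide))
    have hl2 : HasLevels S par D rem s2 := hl1.congr
      (hw2 _ (by decide) (by decide)) (hw2 _ (by decide) (by decide))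
    have hj2 : s2 vJ 0 = j := by rw [hw2 _ (by decide) (by decide), hj1]
    set u : Fin n → ℕ := fun i => if i ∈ pendingJobs par rem ∧
      level S D rem ⟨j, hj⟩ < level S D rem i then 1 else 0 with hu
    set v : Fin n → ℕ := fun i => if i ∈ pendingJobs par rem ∧
      level S D rem ⟨j, hj⟩ ≤ level S D rem i then 1 else 0 with hv
    have hun : ∑ i, u i = numAbove S par D rem ⟨j, hj⟩ := by
      rw [numAbove, Finset.card_filter, hu, ← Finset.sum_filter, ← Finset.sum_filter]
      congr 1; ext; simp
    have hvn : ∑ i, v i = numFrom S par D rem ⟨j, hj⟩ := by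
      rw [numFrom, Finset.card_filter, hv, ← Finset.sum_filter, ← Finset.sum_filter]
      congr 1; ext; simp
    have hule : ∀ k, prefixSum u k < 2 ^ b := fun k => by
      refine ((prefixSum_le _ _).trans ?_).trans_lt (hn.trans_lt hM)
      rw [hun]
      exact (Finset.card_le_univ _).trans (by simp)
    have hvle : ∀ k, prefixSum v k < 2 ^ b := fun k => by
      refine ((prefixSum_le _ _).trans ?_).trans_lt (hn.trans_lt hM)
      rw [hvn]
      exact (Finset.card_le_univ _).trans (by simp)
    refine yields_seq (fun st => (st vU 0 = numAbove S par D rem ⟨j, hj⟩ ∧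
      st vV 0 = numFrom S par D rem ⟨j, hj⟩) ∧ ∀ a, a ≠ vI → a ≠ vU → a ≠ vV → st a = s2 a) ?_ ?_
    · refine yields_iter (fun k st => st vU 0 = prefixSum u k ∧ st vV 0 = prefixSum v k) hb2
        (hr2.reads.jobs ▸ hn) hM (by decide) (by decide) (by decide) ?_ ?_ ?_
      · simp [prefixSum, hs2]
      · rintro i hi s3 hs3 hfr3 hi3 ⟨hU, hV⟩
        rw [hr2.reads.jobs] at hi
        have hl3 : HasLevels S par D rem s3 := hl2.congr (hfr3 _ (by decide)) (hfr3 _ (by decide))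
        have hj3 : s3 vJ 0 = j := by rw [hfr3 _ (by decide), hj2]
        have x1 := hl3.level ⟨i, hi⟩
        have x2 := hl3.level ⟨j, hj⟩
        have x3 := hl3.pending ⟨i, hi⟩
        simp only at x1 x2 x3
        have e1 : (.var vU + .get vAv (.var vI + 1) *
            Expr.lt (.get vX (.var vJ)) (.get vX (.var vI)) : Expr).eval s3 =
            prefixSum u (i + 1) := by
          rw [show i + 1 = (⟨i, hi⟩ : Fin n).val + 1 from rfl, prefixSum_succ]
          simp only [Expr.eval_add, Expr.eval_mul, Expr.eval_var, Expr.eval_get, Expr.eval_one,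
            Expr.eval_lt, hi3, hj3, x1, x2, x3, hU, hu]
          split_ifs <;> simp_all
        refine yields_set_seq hs3 (by rw [e1]; exact hule _) ?_
        rw [e1]
        simp only [Expr.eval_zero]
        set s4 := s3.write vU 0 (prefixSum u (i + 1)) with hs4
        have hw4 : ∀ a, a ≠ vU → s4 a = s3 a := fun a ha => State.write_of_ne _ _ _ ha
        have e2 : (.var vV + .get vAv (.var vI + 1) *
            Expr.le (.get vX (.var vJ)) (.get vX (.var vI)) : Expr).eval s4 =
            prefixSum v (i + 1) := by
          rw [show i + 1 = (⟨i, hi⟩ : Fin n).val + 1 from rfl, prefixSum_succ]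
          simp only [Expr.eval_add, Expr.eval_mul, Expr.eval_var, Expr.eval_get, Expr.eval_one,
            Expr.eval_le, hw4 _ (show (vV : ℕ) ≠ vU by decide),
            hw4 _ (show (vAv : ℕ) ≠ vU by decide), hw4 _ (show (vX : ℕ) ≠ vU by decide),
            hw4 _ (show (vI : ℕ) ≠ vU by decide), hw4 _ (show (vJ : ℕ) ≠ vU by decide),
            hi3, hj3, x1, x2, x3, hV, hv]
          split_ifs <;> simp_all
        refine yields_set (hs3.write (hule _)) (by rw [e2]; exact hvle _) ?_
        rw [e2]
        simp [hs4]
      · rintro s3 ⟨hU, hV⟩ hfr3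
        rw [hr2.reads.jobs, prefixSum_eq_sum, hun] at hU
        rw [hr2.reads.jobs, prefixSum_eq_sum, hvn] at hV
        refine ⟨⟨hU, hV⟩, fun a h1 h2 h3 => hfr3 a (by simp [writes, h1, h2, h3])⟩
    · rintro s3 hs3 - ⟨⟨hU, hV⟩, hfr3⟩
      have hr3 : RoundData I S par D rem s3 := hr2.congr (by
        intro a ha; fin_cases ha <;> exact hfr3 _ (by decide) (by decide) (by decide))
      have hl3 : HasLevels S par D rem s3 := hl2.congr
        (hfr3 _ (by decide) (by decide) (by decide)) (hfr3 _ (by decide) (by decide) (by decide))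
      have hj3 : s3 vJ 0 = j := by rw [hfr3 _ (by decide) (by decide) (by decide), hj2]
      have x2 := hl3.level ⟨j, hj⟩
      have x3 := hl3.pending ⟨j, hj⟩
      simp only at x2 x3
      have hcond : (.get vAv (.var vJ + 1) * (Expr.var vU).lt (.var vM) *
          (Expr.var vM).le (.var vV) : Expr).eval s3 ≠ 0 ↔ ⟨j, hj⟩ ∈ pendingJobs par rem ∧
          numAbove S par D rem ⟨j, hj⟩ < m ∧ m ≤ numFrom S par D rem ⟨j, hj⟩ := by
        simp only [Expr.eval_mul, Expr.eval_get, Expr.eval_add, Expr.eval_var, Expr.eval_one,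
          Expr.eval_lt, Expr.eval_le, hj3, x3, hU, hV, hr3.machines]
        split_ifs <;> simp_all
      have hold : ∀ a, a ≠ vI → a ≠ vU → a ≠ vV → s3 a = s1 a := fun a h1 h2 h3 => by
        rw [hfr3 a h1 h2 h3, hw2 a h2 h3]
      refine yields_ite hs3 (fun h => ?_) fun h => ?_
      · rw [hcond] at h
        have hsh := isShared_of_lt_of_le h.2.1 h.2.2
        refine yields_set_seq hs3 (by simpa using hs3 _ _) ?_
        have hb4 : Bdd b (s3.write vH (Expr.eval s3 0) ((Expr.get vX (.var vJ)).eval s3)) :=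
          hs3.write (by simpa using hs3 _ _)
        refine yields_set_seq hb4 ?_ ?_
        · simp only [Expr.eval_sub, Expr.eval_var]
          exact (Nat.sub_le _ _).trans_lt (hb4 _ _)
        · refine yields_set (hb4.write ?_) ?_ (Or.inl ?_)
          · simp only [Expr.eval_sub, Expr.eval_var]
            exact (Nat.sub_le _ _).trans_lt (hb4 _ _)
          · simp only [Expr.eval_sub, Expr.eval_var]
            refine (Nat.sub_le _ _).trans_lt (hb4.write ?_ _ _)
            exact (Nat.sub_le _ _).trans_lt (hb4 _ _)
          · simpa [State.write_apply, hj3, x2, hU, hV, hr3.machines] using hsh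
      · have h' := mt hcond.2 (not_not.2 h)
        refine yields_nop hs3 ?_
        simp only [State.write_of_ne _ _ _ (show (vH : ℕ) ≠ vJ by decide),
          State.write_of_ne _ _ _ (show (vG : ℕ) ≠ vJ by decide),
          State.write_of_ne _ _ _ (show (vC : ℕ) ≠ vJ by decide),
          hold _ (show (vH : ℕ) ≠ vI by decide) (by decide) (by decide),
          hold _ (show (vG : ℕ) ≠ vI by decide) (by decide) (by decide),
          hold _ (show (vC : ℕ) ≠ vI by decide) (by decide) (by decide)]
        refine hP.imp_right fun hP => ⟨hP.1, hP.2.1, hP.2.2.1, fun j' hj' hlt => ?_⟩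
        by_cases hjj : j'.val = j
        · obtain rfl : j' = ⟨j, hj⟩ := Fin.ext hjj
          exact fun hc => h' ⟨hj', hc⟩
        · exact hP.2.2.2 j' hj' (by omega)
  · rintro st (h | ⟨h1, h2, h3, h4⟩) -
    · exact h
    · left
      rw [hr0.reads.jobs] at h4
      exact ⟨h1, h2, h3, card_pendingJobs_le hm fun j hj => h4 j hj j.isLt⟩

end Cmd

end

section

variable {n m : ℕ}

/-! ### Computing the next event -/

open Problem

variable {I : Problem n m} {S : Fin n → ℕ} {par : Fin n → Option (Fin n)} {D : ℕ}
  {rem : Fin n → ℕ} {b M : ℕ} {s s' : State}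

/-- Comparing fractions with cross multiplication is transitive, also for the fraction `x / 0`
if `x` is positive. -/
theorem ratio_trans {x y x' y' u v : ℕ} (h : x' * y < x * y') (h' : x * v ≤ u * y) :
    x' * v ≤ u * y' := by
  rcases Nat.eq_zero_or_pos y with rfl | hy
  · have hx : 0 < x := by
      rcases Nat.eq_zero_or_pos x with rfl | hx
      · simp at h
      · exact hx
    have : v = 0 := by
      have h2 : x = 0 ∨ v = 0 := by simpa using h'
      omega
    simp [this]
  · refine Nat.le_of_mul_le_mul_right ?_ hy
    calc x' * v * y = x' * y * v := by ring
      _ ≤ x * y' * v := Nat.mul_le_mul_right _ h.le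
      _ = x * v * y' := by ring
      _ ≤ u * y * y' := Nat.mul_le_mul_right _ h'
      _ = u * y' * y := by ring

theorem Problem.IsShared.level_le {h g c V : ℕ}
    (hsh : IsShared m S par D rem h g c) (hV : ∀ j, level S D rem j ≤ V) : h ≤ V := by
  rcases hsh with ⟨rfl, -⟩ | ⟨-, hg, h1, h2⟩
  · exact Nat.zero_le _
  · obtain ⟨j, hj⟩ := Finset.card_pos.1 (show 0 < Finset.card _ by rw [hg]; omega)
    rw [← (Finset.mem_filter.1 hj).2]
    exact hV j

theorem Problem.meetNum_le {h g r X V : ℕ} (hg : g ≤ n) (hn : 0 < n) (hh : h ≤ V)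
    (hr : r ≤ V) : meetNum h g X r ≤ V * n := by
  unfold meetNum
  split_ifs
  · exact hr.trans (Nat.le_mul_of_pos_right _ hn)
  · exact Nat.mul_le_mul hr hg
  · exact Nat.mul_le_mul (by omega) hg

theorem Problem.fallNum_le {h g X V : ℕ} (hg : g ≤ n) (hX : X ≤ V) :
    fallNum h g X ≤ V * n := Nat.mul_le_mul (by omega) hg

namespace Cmd

/-- Replaces the fraction in `vNu` and `vDe` by the smallest fraction `num / den`, over all pending
jobs `vJ`, if that is smaller. -/
def minRatio (num den : Expr) : Cmd :=
  iter vJ vN (ite (.get vAv (.var vJ + 1) * (num * .var vDe).lt (.var vNu * den))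
    (set vNu 0 num ;; set vDe 0 den) nop)

open Classical in
theorem minRatio_yields {num den : Expr} {fN fD : Fin n → ℕ} {A : Finset (Fin n)} {x₀ y₀ : ℕ}
    (hs : Bdd b s) (hN : s vN 0 = n) (hn : n ≤ M) (hM : M < 2 ^ b)
    (hAv : ∀ j : Fin n, s vAv (j + 1) = if j ∈ A then 1 else 0)
    (hx₀ : s vNu 0 = x₀) (hy₀ : s vDe 0 = y₀)
    (hnum : ∀ (j : Fin n) (st : State), (∀ a, a ≠ vJ → a ≠ vNu → a ≠ vDe → st a = s a) →
      st vJ 0 = j → num.eval st = fN j ∧ den.eval st = fD j)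
    (hfN : ∀ j, fN j < 2 ^ b) (hfD : ∀ j, fD j < 2 ^ b) :
    (minRatio num den).Yields b M s fun s' =>
      (∀ j ∈ A, s' vNu 0 * fD j ≤ fN j * s' vDe 0) ∧ s' vNu 0 * y₀ ≤ x₀ * s' vDe 0 ∧
      ((s' vNu 0 = x₀ ∧ s' vDe 0 = y₀) ∨
        ∃ j ∈ A, s' vNu 0 = fN j ∧ s' vDe 0 = fD j ∧ 0 < s' vDe 0) := by
  refine yields_iter (fun k s' =>
      (∀ j ∈ A, j.val < k → s' vNu 0 * fD j ≤ fN j * s' vDe 0) ∧ s' vNu 0 * y₀ ≤ x₀ * s' vDe 0 ∧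
      ((s' vNu 0 = x₀ ∧ s' vDe 0 = y₀) ∨
        ∃ j ∈ A, s' vNu 0 = fN j ∧ s' vDe 0 = fD j ∧ 0 < s' vDe 0)) hs (hN ▸ hn) hM
      (by simp [writes]) (by simp [writes]) (by decide) ?_ ?_ ?_
  · rw [State.write_of_ne _ _ _ (by decide), State.write_of_ne _ _ _ (by decide), hx₀, hy₀]
    exact ⟨fun j _ h => absurd h (Nat.not_lt_zero _), le_rfl, Or.inl ⟨rfl, rfl⟩⟩
  · rintro j hj s1 hs1 hfr1 hj1 ⟨h1, h2, h3⟩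
    rw [hN] at hj
    have hold : ∀ a, a ≠ vJ → a ≠ vNu → a ≠ vDe → s1 a = s a := fun a g1 g2 g3 =>
      hfr1 a (by simp [writes, g1, g2, g3])
    obtain ⟨e1, e2⟩ := hnum ⟨j, hj⟩ s1 hold hj1
    have hcond : (.get vAv (.var vJ + 1) * (num * .var vDe).lt (.var vNu * den) : Expr).eval s1 ≠ 0
        ↔ ⟨j, hj⟩ ∈ A ∧ fN ⟨j, hj⟩ * s1 vDe 0 < s1 vNu 0 * fD ⟨j, hj⟩ := by
      have h4 := hAv ⟨j, hj⟩
      simp only at h4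
      simp only [Expr.eval_mul, Expr.eval_get, Expr.eval_add, Expr.eval_var, Expr.eval_one,
        Expr.eval_lt, hj1, hold _ (show (vAv : ℕ) ≠ vJ by decide) (by decide) (by decide), h4, e1, e2]
      split_ifs <;> simp_all
    refine yields_ite hs1 (fun h => ?_) fun h => ?_
    · rw [hcond] at h
      obtain ⟨hA, hlt⟩ := h
      refine yields_set_seq hs1 (by rw [e1]; exact hfN _) ?_
      rw [e1]
      simp only [Expr.eval_zero]
      set s2 := s1.write vNu 0 (fN ⟨j, hj⟩) with hs2
      have hw2 : ∀ a, a ≠ vNu → s2 a = s1 a := fun a ha => State.write_of_ne _ _ _ ha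
      have e3 : den.eval s2 = fD ⟨j, hj⟩ := (hnum ⟨j, hj⟩ s2
        (fun a g1 g2 g3 => by rw [hw2 a g2, hold a g1 g2 g3])
        (by rw [hw2 _ (by decide), hj1])).2
      refine yields_set (hs1.write (hfN _)) (by rw [e3]; exact hfD _) ?_
      rw [e3]
      simp only [Expr.eval_zero]
      have e4 : ((s2.write vDe 0 (fD ⟨j, hj⟩)).write vJ 0 (j + 1)) vNu 0 = fN ⟨j, hj⟩ := by
        rw [State.write_of_ne _ _ _ (by decide), State.write_of_ne _ _ _ (by decide), hs2,
          State.write_self]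
      have e5 : ((s2.write vDe 0 (fD ⟨j, hj⟩)).write vJ 0 (j + 1)) vDe 0 = fD ⟨j, hj⟩ := by
        rw [State.write_of_ne _ _ _ (by decide), State.write_self]
      rw [e4, e5]
      refine ⟨fun j' hj' hlt' => ?_, ratio_trans hlt h2, Or.inr ⟨_, hA, rfl, rfl, ?_⟩⟩
      · by_cases hjj : j'.val = j
        · obtain rfl : j' = ⟨j, hj⟩ := Fin.ext hjj
          rfl
        · exact ratio_trans hlt (h1 j' hj' (by omega))
      · by_contra hc
        rw [Nat.eq_zero_of_not_pos hc] at hlt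
        simp at hlt
    · have h' := mt hcond.2 (not_not.2 h)
      refine yields_nop hs1 ?_
      rw [State.write_of_ne _ _ _ (by decide), State.write_of_ne _ _ _ (by decide)]
      refine ⟨fun j' hj' hlt' => ?_, h2, h3⟩
      by_cases hjj : j'.val = j
      · obtain rfl : j' = ⟨j, hj⟩ := Fin.ext hjj
        by_contra hc
        exact h' ⟨hj', not_le.1 hc⟩
      · exact h1 j' hj' (by omega)
  · rintro st ⟨h1, h2, h3⟩ -
    rw [hN] at h1
    exact ⟨fun j hj => h1 j hj j.isLt, h2, h3⟩

/-- Computes the time `vNu / vDe` until the next event, with `vDe = 0` if no job is pending. -/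
def findNext : Cmd :=
  set vNu 0 1 ;; set vDe 0 0 ;;
  minRatio
    ((Expr.var vH).lt (.get vX (.var vJ)) * .get vRem (.var vJ) +
      ((Expr.var vH).le (.get vX (.var vJ)) * Expr.le (.get vX (.var vJ)) (.var vH)) *
        (.get vRem (.var vJ) * .var vG) +
      Expr.lt (.get vX (.var vJ)) (.var vH) * ((.var vH - .get vX (.var vJ)) * .var vG))
    ((Expr.var vH).lt (.get vX (.var vJ)) + Expr.le (.get vX (.var vJ)) (.var vH) * .var vC) ;;
  minRatio ((.get vX (.var vJ) - .var vH) * .var vG)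
    ((Expr.var vH).lt (.get vX (.var vJ)) * (.var vG - .var vC))

theorem findNext_yields {V : ℕ} (hs : Bdd b s) (hr : RoundData I S par D rem s)
    (hl : HasLevels S par D rem s) (hsh : IsShared m S par D rem (s vH 0) (s vG 0) (s vC 0))
    (hn : n ≤ M) (hM : M < 2 ^ b) (hb1 : 1 < 2 ^ b)
    (hV : ∀ j, level S D rem j ≤ V) (hVb : V * n < 2 ^ b) :
    findNext.Yields b M s fun s' =>
      if (pendingJobs par rem).Nonempty then
        IsNext S par D rem (s vH 0) (s vG 0) (s vC 0) (s' vNu 0) (s' vDe 0)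
      else s' vDe 0 = 0 := by
  classical
  set h := s vH 0
  set g := s vG 0
  set c := s vC 0
  obtain ⟨hc, hcg⟩ := hsh.pos
  have hh := hsh.level_le hV
  refine yields_set_seq hs (by simpa using hb1) ?_
  simp only [Expr.eval_zero, Expr.eval_one]
  have hb0 : Bdd b (s.write vNu 0 1) := hs.write hb1
  refine yields_set_seq hb0 (by simp) ?_
  simp only [Expr.eval_zero]
  set s0 := (s.write vNu 0 1).write vDe 0 0 with hs0
  have hw : ∀ a, a ≠ vNu → a ≠ vDe → s0 a = s a := fun a h1 h2 => by
    rw [hs0, State.write_of_ne _ _ _ h2, State.write_of_ne _ _ _ h1]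
  have hnpos : ∀ j : Fin n, 0 < n := fun j => j.pos
  have hgn : ∀ j : Fin n, g ≤ n := fun j => hsh.le j.pos
  have hle2 : ∀ {a}, a ≤ V * n → a < 2 ^ b := fun ha => ha.trans_lt hVb
  have hVn : ∀ j : Fin n, V < 2 ^ b := fun j =>
    (Nat.le_mul_of_pos_right _ j.pos).trans_lt hVb
  have hnb : n < 2 ^ b := hn.trans_lt hM
  have hrem : ∀ j, rem j ≤ V := fun j => (Nat.le_add_left _ _).trans (hV j)
  -- a state that differs from `s` only in scratch variables
  have hev : ∀ (j : Fin n) (st : State), (∀ a, a ≠ vJ → a ≠ vNu → a ≠ vDe → st a = s a) →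
      st vJ 0 = j → st vH 0 = h ∧ st vG 0 = g ∧ st vC 0 = c ∧ st vX j = level S D rem j ∧
        st vRem j = rem j := by
    intro j st hst hj
    refine ⟨by rw [hst _ (by decide) (by decide) (by decide)],
      by rw [hst _ (by decide) (by decide) (by decide)],
      by rw [hst _ (by decide) (by decide) (by decide)], ?_, ?_⟩
    · rw [hst _ (by decide) (by decide) (by decide), hl.level]
    · rw [hst _ (by decide) (by decide) (by decide), hr.rem]
  refine yields_seq _ (minRatio_yields (A := pendingJobs par rem)
    (fN := fun j => meetNum h g (level S D rem j) (rem j))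
    (fD := fun j => meetDen h c (level S D rem j)) (x₀ := 1) (y₀ := 0) (hb0.write (by positivity))
    (by rw [hw _ (by decide) (by decide), hr.reads.jobs]) hn hM
    (fun j => by rw [hw _ (by decide) (by decide), hl.pending])
    (by rw [hs0, State.write_of_ne _ _ _ (by decide), State.write_self])
    (by rw [hs0, State.write_self]) ?_ ?_ ?_) ?_
  · intro j st hst hj
    obtain ⟨e1, e2, e3, e4, e5⟩ := hev j st
      (fun a h1 h2 h3 => by rw [hst a h1 h2 h3, hw a h2 h3]) hj
    simp only [Expr.eval_add, Expr.eval_mul, Expr.eval_sub, Expr.eval_lt, Expr.eval_le,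
      Expr.eval_var, Expr.eval_get, hj, e1, e2, e3, e4, e5, meetNum, meetDen]
    rcases lt_trichotomy h (level S D rem j) with h1 | h1 | h1
    · simp [h1, h1.le, h1.not_ge, h1.not_gt]
    · simp [h1]
    · simp [h1, h1.le, h1.not_ge, h1.not_gt, h1.ne]
  · exact fun j => hle2 (meetNum_le (hgn j) j.pos hh (hrem j))
  · intro j
    simp only [meetDen]
    have := hgn j
    split_ifs <;> omega
  rintro s1 hb1' hfr1 ⟨h1, -, h3⟩
  have hw1 : ∀ a, a ≠ vJ → a ≠ vNu → a ≠ vDe → s1 a = s a := fun a g1 g2 g3 => by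
    rw [hfr1 a (by simp [minRatio, writes, g1, g2, g3]), hw a g2 g3]
  refine (minRatio_yields (A := pendingJobs par rem)
    (fN := fun j => fallNum h g (level S D rem j))
    (fD := fun j => fallDen h g c (level S D rem j)) hb1'
    (by rw [hw1 _ (by decide) (by decide) (by decide), hr.reads.jobs]) hn hM
    (fun j => by rw [hw1 _ (by decide) (by decide) (by decide), hl.pending]) rfl rfl ?_ ?_ ?_).mono
    ?_
  · intro j st hst hj
    obtain ⟨e1, e2, e3, e4, e5⟩ := hev j st
      (fun a h1 h2 h3 => by rw [hst a h1 h2 h3, hw1 a h1 h2 h3]) hj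
    simp only [Expr.eval_mul, Expr.eval_sub, Expr.eval_lt,
      Expr.eval_var, Expr.eval_get, hj, e1, e2, e3, e4, fallNum, fallDen]
    refine ⟨trivial, ?_⟩
    split_ifs <;> simp
  · exact fun j => hle2 (fallNum_le (hgn j) (hV j))
  · intro j
    simp only [fallDen]
    have := hgn j
    split_ifs <;> omega
  rintro s2 - - ⟨g1, g2, g3⟩
  split_ifs with hne
  · have hmeet : ∃ j ∈ pendingJobs par rem, s1 vNu 0 = meetNum h g (level S D rem j) (rem j) ∧
        s1 vDe 0 = meetDen h c (level S D rem j) ∧ 0 < s1 vDe 0 := by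
      refine h3.resolve_left ?_
      rintro ⟨e1, e2⟩
      obtain ⟨j, hj⟩ := hne
      have := h1 j hj
      rw [e1, e2, one_mul, mul_zero] at this
      simp only [meetDen] at this
      split_ifs at this <;> omega
    obtain ⟨i, hi, i1, i2, i3⟩ := hmeet
    refine ⟨fun j hj => ?_, g1, ?_⟩
    · refine Nat.le_of_mul_le_mul_right ?_ i3
      calc s2 vNu 0 * meetDen h c (level S D rem j) * s1 vDe 0
          = s2 vNu 0 * s1 vDe 0 * meetDen h c (level S D rem j) := by ring
        _ ≤ s1 vNu 0 * s2 vDe 0 * meetDen h c (level S D rem j) := Nat.mul_le_mul_right _ g2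
        _ = s1 vNu 0 * meetDen h c (level S D rem j) * s2 vDe 0 := by ring
        _ ≤ meetNum h g (level S D rem j) (rem j) * s1 vDe 0 * s2 vDe 0 :=
            Nat.mul_le_mul_right _ (h1 j hj)
        _ = meetNum h g (level S D rem j) (rem j) * s2 vDe 0 * s1 vDe 0 := by ring
    · rcases g3 with ⟨e1, e2⟩ | ⟨j, hj, e1, e2, e3⟩
      · exact ⟨i, hi, Or.inl ⟨e1.trans i1, e2.trans i2⟩⟩
      · exact ⟨j, hj, Or.inr ⟨e1, e2, e3⟩⟩
  · have hne' : ∀ j, j ∉ pendingJobs par rem := fun j hj => hne ⟨j, hj⟩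
    rcases g3 with ⟨-, e2⟩ | ⟨j, hj, -⟩
    · rcases h3 with ⟨-, e4⟩ | ⟨j, hj, -⟩
      · rw [e2, e4]
      · exact absurd hj (hne' j)
    · exact absurd hj (hne' j)

/-- Passes to the unit of time `1 / (D * (de * g))`, and subtracts the work of this round from the
remaining work. -/
def advance : Cmd :=
  set vSc 0 (.var vDe * .var vG) ;; set vDl 0 (.var vNu * .var vG) ;;
  iter vJ vN (
    set vA (.var vJ) (.get vAv (.var vJ + 1) * ((Expr.var vH).lt (.get vX (.var vJ)) * .var vDl +
      ((Expr.var vH).le (.get vX (.var vJ)) * Expr.le (.get vX (.var vJ)) (.var vH)) *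
        (.var vNu * .var vC))) ;;
    set vRem (.var vJ) (.get vRem (.var vJ) * .var vSc - .get vA (.var vJ))) ;;
  set vB 0 (.var vB * .var vSc - .var vDl) ;;
  set vD 0 (.var vD * .var vSc)

theorem advance_yields {V nu de h g c : ℕ} (hs : Bdd b s) (hr : RoundData I S par D rem s)
    (hl : HasLevels S par D rem s) (hsh : IsShared m S par D rem h g c)
    (hnx : IsNext S par D rem h g c nu de)
    (hh : s vH 0 = h) (hg : s vG 0 = g) (hc : s vC 0 = c) (hnu : s vNu 0 = nu) (hde : s vDe 0 = de)
    (hn : n ≤ M) (hM : M < 2 ^ b)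
    (hV : ∀ j, level S D rem j ≤ V) (hB : s vB 0 ≤ V) (hD : D ≤ V) (h1V : 1 ≤ V)
    (hVb : V * (n * n) < 2 ^ b) :
    advance.Yields b M s fun s' =>
      RoundData I S par (D * (de * g)) (fun j => rem j * (de * g) - amount S par D rem h g c nu j)
        s' ∧ (∀ j : Fin n, s' vA j = amount S par D rem h g c nu j) ∧ s' vDl 0 = nu * g ∧
      s' vB 0 = s vB 0 * (de * g) - nu * g := by
  classical
  obtain ⟨hc0, hcg⟩ := hsh.pos
  obtain ⟨hnu0, hde0, hdeg⟩ := hnx.pos hsh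
  obtain ⟨j₀, hj₀, hatt⟩ := hnx.attained
  have hn0 := j₀.pos
  have hgn := hsh.le hn0
  have hhV := hsh.level_le hV
  have hsc : de * g ≤ n * n := Nat.mul_le_mul (hdeg.trans hgn) hgn
  have hrem : ∀ j, rem j ≤ V := fun j => (Nat.le_add_left _ _).trans (hV j)
  have hnuV : nu ≤ V * n := by
    rcases hatt with ⟨e, -⟩ | ⟨e, -, -⟩
    · rw [e]; exact meetNum_le hgn hn0 hhV (hrem _)
    · rw [e]; exact fallNum_le hgn (hV _)
  have hdl : nu * g < 2 ^ b := by
    refine lt_of_le_of_lt ?_ hVb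
    calc nu * g ≤ V * n * n := Nat.mul_le_mul hnuV hgn
      _ = _ := by ring
  have hscb : de * g < 2 ^ b := by
    refine lt_of_le_of_lt ?_ hVb
    calc de * g ≤ 1 * (n * n) := by simpa using hsc
      _ ≤ _ := Nat.mul_le_mul_right _ h1V
  have hVsc : ∀ {x}, x ≤ V → x * (de * g) < 2 ^ b := fun hx =>
    (Nat.mul_le_mul hx hsc).trans_lt hVb
  have hamb : ∀ j, amount S par D rem h g c nu j < 2 ^ b := fun j =>
    (amount_le hsh j).trans_lt hdl
  refine yields_set_seq hs (by simpa [hde, hg] using hscb) ?_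
  simp only [Expr.eval_zero, Expr.eval_mul, Expr.eval_var, hde, hg]
  have hb1 : Bdd b (s.write vSc 0 (de * g)) := hs.write hscb
  have e0 : (.var vNu * .var vG : Expr).eval (s.write vSc 0 (de * g)) = nu * g := by
    simp only [Expr.eval_mul, Expr.eval_var]
    rw [State.write_of_ne _ _ _ (by decide), State.write_of_ne _ _ _ (by decide), hnu, hg]
  refine yields_set_seq hb1 (by rw [e0]; exact hdl) ?_
  rw [e0]
  simp only [Expr.eval_zero]
  set s0 := (s.write vSc 0 (de * g)).write vDl 0 (nu * g) with hs0
  have hw : ∀ a, a ≠ vDl → a ≠ vSc → s0 a = s a := fun a h1 h2 => by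
    rw [hs0, State.write_of_ne _ _ _ h1, State.write_of_ne _ _ _ h2]
  have hSc0 : s0 vSc 0 = de * g := by
    rw [hs0, State.write_of_ne _ _ _ (by decide), State.write_self]
  have hDl0 : s0 vDl 0 = nu * g := by rw [hs0, State.write_self]
  refine yields_seq (fun st => ∀ j : Fin n, st vA j = amount S par D rem h g c nu j ∧
    st vRem j = rem j * (de * g) - amount S par D rem h g c nu j) ?_ ?_
  · refine yields_iter (fun k st => ∀ j : Fin n,
      (j.val < k → st vA j = amount S par D rem h g c nu j ∧
        st vRem j = rem j * (de * g) - amount S par D rem h g c nu j) ∧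
      (k ≤ j.val → st vRem j = rem j)) (hb1.write hdl)
      (by rw [hw _ (by decide) (by decide), hr.reads.jobs]; exact hn) hM (by decide) (by decide)
      (by decide) ?_ ?_ ?_
    · intro j
      refine ⟨fun h => absurd h (Nat.not_lt_zero _), fun _ => ?_⟩
      rw [State.write_of_ne _ _ _ (by decide), hw _ (by decide) (by decide), hr.rem]
    · intro j hj s1 hs1 hfr1 hj1 hP
      rw [hw _ (by decide) (by decide), hr.reads.jobs] at hj
      have hold : ∀ a, a ≠ vJ → a ≠ vA → a ≠ vRem → a ≠ vDl → a ≠ vSc → s1 a = s a :=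
        fun a h1 h2 h3 h4 h5 => by
          rw [hfr1 a (by simp [writes, h1, h2, h3]), hw a h4 h5]
      have hSc1 : s1 vSc 0 = de * g := by rw [hfr1 _ (by decide), hSc0]
      have hDl1 : s1 vDl 0 = nu * g := by rw [hfr1 _ (by decide), hDl0]
      have ho := fun (a : ℕ) (h : a ≠ vJ ∧ a ≠ vA ∧ a ≠ vRem ∧ a ≠ vDl ∧ a ≠ vSc) =>
        hold a h.1 h.2.1 h.2.2.1 h.2.2.2.1 h.2.2.2.2
      have x1 : s1 vAv (j + 1) = if ⟨j, hj⟩ ∈ pendingJobs par rem then 1 else 0 := by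
        rw [ho vAv (by decide)]; exact hl.pending ⟨j, hj⟩
      have x2 : s1 vX j = level S D rem ⟨j, hj⟩ := by
        rw [ho vX (by decide)]; exact hl.level ⟨j, hj⟩
      have x3 : s1 vH 0 = h := by rw [ho vH (by decide), hh]
      have x4 : s1 vNu 0 = nu := by rw [ho vNu (by decide), hnu]
      have x5 : s1 vC 0 = c := by rw [ho vC (by decide), hc]
      have x6 : s1 vRem j = rem ⟨j, hj⟩ := (hP ⟨j, hj⟩).2 le_rfl
      have e1 : (.get vAv (.var vJ + 1) * ((Expr.var vH).lt (.get vX (.var vJ)) * .var vDl +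
          ((Expr.var vH).le (.get vX (.var vJ)) * Expr.le (.get vX (.var vJ)) (.var vH)) *
            (.var vNu * .var vC)) : Expr).eval s1 = amount S par D rem h g c nu ⟨j, hj⟩ := by
        simp only [Expr.eval_add, Expr.eval_mul, Expr.eval_lt, Expr.eval_le, Expr.eval_one,
          Expr.eval_var, Expr.eval_get, hj1, x1, x2, x3, x4, x5, hDl1, amount]
        by_cases q1 : (⟨j, hj⟩ : Fin n) ∈ pendingJobs par rem
        · rcases lt_trichotomy h (level S D rem ⟨j, hj⟩) with h1 | h1 | h1
          · simp [q1, h1, h1.le, h1.not_ge]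
          · simp [q1, ← h1]
          · simp [q1, h1.not_ge, h1.not_gt, h1.ne]
        · simp [q1]
      refine yields_set_seq hs1 (by rw [e1]; exact hamb _) ?_
      rw [e1]
      simp only [Expr.eval_var, hj1]
      set s2 := s1.write vA j (amount S par D rem h g c nu ⟨j, hj⟩) with hs2
      have hw2 : ∀ a, a ≠ vA → s2 a = s1 a := fun a ha => State.write_of_ne _ _ _ ha
      have hA2 : ∀ l, s2 vA l = if l = j then amount S par D rem h g c nu ⟨j, hj⟩ else s1 vA l :=
        fun l => State.write_apply _ _ _ _ _
      have e2 : (.get vRem (.var vJ) * .var vSc - .get vA (.var vJ) : Expr).eval s2 =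
          rem ⟨j, hj⟩ * (de * g) - amount S par D rem h g c nu ⟨j, hj⟩ := by
        simp only [Expr.eval_sub, Expr.eval_mul, Expr.eval_var, Expr.eval_get,
          hw2 _ (show (vJ : ℕ) ≠ vA by decide), hj1, hw2 _ (show (vRem : ℕ) ≠ vA by decide), x6,
          hw2 _ (show (vSc : ℕ) ≠ vA by decide), hSc1, hA2, if_true]
      refine yields_set (hs1.write (hamb _)) ?_ fun j' => ?_
      · rw [e2]
        exact (Nat.sub_le _ _).trans_lt (hVsc (hrem _))
      · rw [e2, Expr.eval_var, hw2 _ (show (vJ : ℕ) ≠ vA by decide), hj1,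
          State.write_of_ne _ _ _ (by decide), State.write_of_ne _ _ _ (by decide),
          State.write_of_ne _ _ _ (by decide), State.write_apply, hA2,
          hw2 _ (show (vRem : ℕ) ≠ vA by decide)]
        by_cases hjj : j'.val = j
        · obtain rfl : j' = ⟨j, hj⟩ := Fin.ext hjj
          exact ⟨fun _ => ⟨if_pos rfl, if_pos rfl⟩, fun h => absurd h (Nat.not_succ_le_self _)⟩
        · rw [if_neg hjj, if_neg hjj]
          exact ⟨fun h => (hP j').1 (by omega), fun h => (hP j').2 (by omega)⟩
    · intro st hst _ j
      rw [hw _ (by decide) (by decide), hr.reads.jobs] at hst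
      exact (hst j).1 j.isLt
  · intro s1 hb1' hfr1 hP
    have hold : ∀ a, a ≠ vJ ∧ a ≠ vA ∧ a ≠ vRem ∧ a ≠ vDl ∧ a ≠ vSc → s1 a = s a := fun a ha => by
      rw [hfr1 a (by simp [writes, ha.1, ha.2.1, ha.2.2.1]), hw a ha.2.2.2.1 ha.2.2.2.2]
    have e1 : (.var vB * .var vSc - .var vDl : Expr).eval s1 = s vB 0 * (de * g) - nu * g := by
      simp only [Expr.eval_sub, Expr.eval_mul, Expr.eval_var]
      rw [hold vB (by decide), hfr1 vSc (by decide), hSc0, hfr1 vDl (by decide), hDl0]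
    have hBb : s vB 0 * (de * g) - nu * g < 2 ^ b := (Nat.sub_le _ _).trans_lt (hVsc hB)
    refine yields_set_seq hb1' (by rw [e1]; exact hBb) ?_
    rw [e1]
    simp only [Expr.eval_zero]
    set s2 := s1.write vB 0 (s vB 0 * (de * g) - nu * g) with hs2
    have hw2 : ∀ a, a ≠ vB → s2 a = s1 a := fun a ha => State.write_of_ne _ _ _ ha
    have e2 : (.var vD * .var vSc : Expr).eval s2 = D * (de * g) := by
      simp only [Expr.eval_mul, Expr.eval_var]
      rw [hw2 _ (by decide), hold vD (by decide), hr.unit, hw2 _ (by decide), hfr1 vSc (by decide),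
        hSc0]
    refine yields_set (hb1'.write hBb) (by rw [e2]; exact hVsc hD) ?_
    rw [e2]
    simp only [Expr.eval_zero]
    have hw3 : ∀ a, a ≠ vD → a ≠ vB → (s2.write vD 0 (D * (de * g))) a = s1 a := fun a h1 h2 => by
      rw [State.write_of_ne _ _ _ h1, hw2 a h2]
    refine ⟨⟨?_, ?_, ?_, ?_, ?_, ?_⟩, ?_, ?_, ?_⟩
    · exact hr.reads.congr (by rw [hw3 _ (by decide) (by decide), hold vIn (by decide)])
        (by rw [hw3 _ (by decide) (by decide), hold vN (by decide)])
    · rw [hw3 _ (by decide) (by decide), hold vM (by decide), hr.machines]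
    · intro j
      rw [hw3 _ (by decide) (by decide), hold vS (by decide), hr.start]
    · intro j
      rw [hw3 _ (by decide) (by decide), hold vPar (by decide), hr.parent]
    · rw [State.write_self]
    · intro j
      rw [hw3 _ (by decide) (by decide), (hP j).2]
    · intro j
      rw [hw3 _ (by decide) (by decide), (hP j).1]
    · rw [hw3 _ (by decide) (by decide), hfr1 vDl (by decide), hDl0]
    · rw [State.write_of_ne _ _ _ (by decide), hs2, State.write_self]

end Cmd

end

section

variable {n m : ℕ}

/-! ### Writing the schedule -/

open Problem

/-- The pieces `xs` are written in `vOut`, behind the number `1`, and `vP` is the next free cell. -/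
structure Holds (s : State) (xs : List (CodedPiece n m)) : Prop where
  next : s vP 0 = 2 + 5 * xs.length
  one : s vOut 1 = 1
  cells : ∀ k < 5 * xs.length, (xs.flatMap CodedPiece.code)[k]? = some (s vOut (2 + k))

theorem length_flatMap_code (xs : List (CodedPiece n m)) :
    (xs.flatMap CodedPiece.code).length = 5 * xs.length := by
  induction xs with
  | nil => rfl
  | cons x xs ih => simp [CodedPiece.code, ih]; ring

theorem Holds.congr {s s' : State} {xs : List (CodedPiece n m)} (h : Holds s xs)
    (hP : s' vP = s vP) (hO : s' vOut = s vOut) : Holds s' xs where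
  next := by rw [hP, h.next]
  one := by rw [hO, h.one]
  cells := fun k hk => by rw [hO, h.cells k hk]

theorem Holds.hasOutput {s : State} {xs : List (CodedPiece n m)} (h : Holds s xs)
    (h0 : s vOut 0 = 1 + 5 * xs.length) : HasOutput s (1 :: xs.flatMap CodedPiece.code) := by
  intro k hk
  match k with
  | 0 =>
    rw [h0, List.getElem_cons_zero, List.length_cons, length_flatMap_code, add_comm]
  | 1 => exact h.one
  | k + 2 =>
    simp only [List.length_cons, length_flatMap_code] at hk
    have := h.cells k (by omega)
    rw [List.getElem?_eq_some_iff] at this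
    obtain ⟨h1, h2⟩ := this
    rw [List.getElem_cons_succ, List.getElem_cons_succ, h2, add_comm]

variable {I : Problem n m} {S : Fin n → ℕ} {par : Fin n → Option (Fin n)} {D : ℕ}
  {rem : Fin n → ℕ} {b M : ℕ} {s s' : State}

namespace Cmd

/-- Appends a piece to the output, with times in units of `1 / vD`. -/
def emit (job machine start finish : Expr) : Cmd :=
  set vOut (.var vP) job ;; set vOut (.var vP + 1) machine ;;
  set vOut (.var vP + .const 2) start ;; set vOut (.var vP + .const 3) finish ;;
  set vOut (.var vP + .const 4) (.var vD) ;; set vP 0 (.var vP + .const 5)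

theorem emit_yields {xs : List (CodedPiece n m)} {e₁ e₂ e₃ e₄ : Expr} (x : CodedPiece n m)
    (hs : Bdd b s) (hx : Holds s xs) (hD : s vD 0 = x.d) (hP : 2 + 5 * xs.length + 5 < 2 ^ b)
    (he : ∀ st : State, (∀ a, a ≠ vOut → st a = s a) →
      e₁.eval st = x.job ∧ e₂.eval st = x.machine ∧ e₃.eval st = x.a ∧ e₄.eval st = x.b)
    (h1 : x.job.val < 2 ^ b) (h2 : x.machine.val < 2 ^ b) (h3 : x.a < 2 ^ b) (h4 : x.b < 2 ^ b) :
    (emit e₁ e₂ e₃ e₄).Yields b M s fun s' => Holds s' (xs ++ [x]) := by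
  have hxd : x.d < 2 ^ b := hD ▸ hs _ _
  set P := 2 + 5 * xs.length with hPdef
  have h0 : s vP 0 = P := hx.next
  have hold : ∀ {st : State}, (∀ a, a ≠ vOut → st a = s a) → ∀ k v,
      ∀ a, a ≠ vOut → (st.write vOut k v) a = s a := fun hst k v a ha => by
    rw [State.write_of_ne _ _ _ ha, hst a ha]
  have c0 : ∀ a, a ≠ vOut → s a = s a := fun _ _ => rfl
  refine yields_set_seq hs (by rw [(he s c0).1]; exact h1) ?_
  rw [(he s c0).1, Expr.eval_var, h0]
  have c1 := hold c0 P x.job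
  have b1 : Bdd b (s.write vOut P x.job) := hs.write h1
  set s1 := s.write vOut P x.job with hs1
  refine yields_set_seq b1 (by rw [(he s1 c1).2.1]; exact h2) ?_
  rw [(he s1 c1).2.1]
  simp only [Expr.eval_add, Expr.eval_var, Expr.eval_one, c1 vP (by decide), h0]
  have c2 := hold c1 (P + 1) x.machine
  have b2 : Bdd b (s1.write vOut (P + 1) x.machine) := b1.write h2
  set s2 := s1.write vOut (P + 1) x.machine with hs2
  refine yields_set_seq b2 (by rw [(he s2 c2).2.2.1]; exact h3) ?_
  rw [(he s2 c2).2.2.1]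
  simp only [Expr.eval_add, Expr.eval_var, Expr.eval_const, c2 vP (by decide), h0]
  have c3 := hold c2 (P + 2) x.a
  have b3 : Bdd b (s2.write vOut (P + 2) x.a) := b2.write h3
  set s3 := s2.write vOut (P + 2) x.a with hs3
  refine yields_set_seq b3 (by rw [(he s3 c3).2.2.2]; exact h4) ?_
  rw [(he s3 c3).2.2.2]
  simp only [Expr.eval_add, Expr.eval_var, Expr.eval_const, c3 vP (by decide), h0]
  have c4 := hold c3 (P + 3) x.b
  have b4 : Bdd b (s3.write vOut (P + 3) x.b) := b3.write h4
  set s4 := s3.write vOut (P + 3) x.b with hs4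
  have hd4 : (Expr.var vD).eval s4 = x.d := by rw [Expr.eval_var, c4 vD (by decide), hD]
  refine yields_set_seq b4 (by rw [hd4]; exact hxd) ?_
  rw [hd4]
  simp only [Expr.eval_add, Expr.eval_var, Expr.eval_const, c4 vP (by decide), h0]
  have c5 := hold c4 (P + 4) x.d
  have b5 : Bdd b (s4.write vOut (P + 4) x.d) := b4.write hxd
  set s5 := s4.write vOut (P + 4) x.d with hs5
  have hp5 : (.var vP + .const 5 : Expr).eval s5 = P + 5 := by
    simp only [Expr.eval_add, Expr.eval_var, Expr.eval_const, c5 vP (by decide), h0]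
  refine yields_set b5 (by rw [hp5]; omega) ?_
  rw [hp5, Expr.eval_zero]
  have hout : ∀ l, s5 vOut l = if l = P + 4 then x.d else if l = P + 3 then x.b else
      if l = P + 2 then x.a else if l = P + 1 then x.machine.val else if l = P then x.job.val else
        s vOut l := by
    intro l
    rw [hs5, State.write_apply, hs4, State.write_apply, hs3, State.write_apply, hs2,
      State.write_apply, hs1, State.write_apply]
  refine ⟨?_, ?_, fun k hk => ?_⟩
  · rw [State.write_self, List.length_append, List.length_singleton, hPdef]
    ring
  · rw [State.write_of_ne _ _ _ (by decide), hout, if_neg (by omega), if_neg (by omega),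
      if_neg (by omega), if_neg (by omega), if_neg (by omega), hx.one]
  · rw [State.write_of_ne _ _ _ (by decide), List.flatMap_append]
    rw [List.length_append, List.length_singleton] at hk
    by_cases hkl : k < 5 * xs.length
    · rw [List.getElem?_append_left (by rwa [length_flatMap_code]), hx.cells k hkl, hout,
        if_neg (by omega), if_neg (by omega), if_neg (by omega), if_neg (by omega),
        if_neg (by omega)]
    · obtain ⟨i, rfl⟩ := Nat.exists_eq_add_of_le (not_lt.1 hkl)
      rw [List.getElem?_append_right (by rw [length_flatMap_code]; omega), length_flatMap_code,
        Nat.add_sub_cancel_left, hout, ← add_assoc, ← hPdef]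
      have hi : i < 5 := by omega
      interval_cases i <;> simp [CodedPiece.code]

/-- McNaughton's wrap-around rule for the amounts in `vA`, in the `vDl` units of time after `vB`. -/
def wrap : Cmd :=
  set vO 0 0 ;;
  iter vJ vN (ite (.get vA (.var vJ)) (
    set vQ 0 (.var vO / .var vDl) ;;
    set vOff 0 (.var vO - .var vQ * .var vDl) ;;
    emit (.var vJ) (.var vQ) (.var vB + .var vOff)
      (.var vB + Expr.min (.var vDl) (.var vOff + .get vA (.var vJ))) ;;
    ite ((Expr.var vDl).lt (.var vOff + .get vA (.var vJ)))
      (emit (.var vJ) (.var vQ + 1) (.var vB)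
        (.var vB + (.var vOff + .get vA (.var vJ) - .var vDl))) nop ;;
    set vO 0 (.var vO + .get vA (.var vJ))) nop)

theorem wrap_yields {B dl : ℕ} {a : Fin n → ℕ} {xs : List (CodedPiece n m)} (hs : Bdd b s)
    (hx : Holds s xs) (hN : s vN 0 = n) (hn : n ≤ M) (hM : M < 2 ^ b) (hm : m < 2 ^ b)
    (hD : s vD 0 = D) (hD0 : 0 < D) (hB : s vB 0 = B) (hdl : s vDl 0 = dl) (hdl0 : 0 < dl)
    (ha : ∀ j : Fin n, s vA j = a j) (hle : ∀ j, a j ≤ dl) (hsum : ∑ j, a j ≤ m * dl)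
    (hsumb : ∑ j, a j < 2 ^ b) (hb : B + dl < 2 ^ b)
    (hP : 2 + 5 * (xs.length + 2 * n) < 2 ^ b) :
    wrap.Yields b M s fun s' => ∃ τ : List (CodedPiece n m), IsWrap D B dl a n τ ∧
      Holds s' (xs ++ τ) ∧ τ.length ≤ 2 * n := by
  refine yields_set_seq hs (by simp) ?_
  simp only [Expr.eval_zero]
  refine yields_iter (fun k st => st vO 0 = prefixSum a k ∧ ∃ τ : List (CodedPiece n m),
    IsWrap D B dl a k τ ∧ Holds st (xs ++ τ) ∧ τ.length ≤ 2 * k) (hs.write (by positivity))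
    (by rw [State.write_of_ne _ _ _ (by decide), hN]; exact hn) hM (by decide) (by decide)
    (by decide) ?_ ?_ ?_
  · refine ⟨?_, [], IsWrap.nil, ?_, by simp⟩
    · rw [State.write_of_ne _ _ _ (by decide), State.write_self, prefixSum_zero]
    · rw [List.append_nil]
      exact hx.congr (by rw [State.write_of_ne _ _ _ (by decide), State.write_of_ne _ _ _ (by decide)])
        (by rw [State.write_of_ne _ _ _ (by decide), State.write_of_ne _ _ _ (by decide)])
  · rintro j hj s1 hs1 hfr1 hj1 ⟨hO, τ, hτ, hH, hlen⟩
    rw [State.write_of_ne _ _ _ (by decide), hN] at hj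
    have hold : ∀ c, c ∉ [vOut, vJ, vP, vO, vQ, vOff] → s1 c = s c := fun c hc => by
      simp only [List.mem_cons, List.not_mem_nil, or_false, not_or] at hc
      rw [hfr1 c (by simp [writes, emit, hc]), State.write_of_ne _ _ _ hc.2.2.2.1]
    have x1 : s1 vA j = a ⟨j, hj⟩ := by rw [hold vA (by decide)]; exact ha ⟨j, hj⟩
    have x2 : s1 vB 0 = B := by rw [hold vB (by decide), hB]
    have x3 : s1 vDl 0 = dl := by rw [hold vDl (by decide), hdl]
    have x4 : s1 vD 0 = D := by rw [hold vD (by decide), hD]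
    set A := a ⟨j, hj⟩ with hA
    set O := prefixSum a j with hOdef
    have hsucc : prefixSum a (j + 1) = O + A := prefixSum_succ a ⟨j, hj⟩
    have hOA : O + A ≤ ∑ j, a j := hsucc ▸ prefixSum_le _ _
    have hAdl : A ≤ dl := hle _
    have hsuccw : ∀ {ν}, IsWrap D B dl a ((⟨j, hj⟩ : Fin n).val + 1) ν ↔
      IsWrap (m := m) D B dl a (j + 1) ν := Iff.rfl
    refine yields_ite hs1 (fun h => ?_) fun h => ?_
    · rw [Expr.eval_get, Expr.eval_var, hj1, x1] at h
      have hApos : 0 < A := Nat.pos_of_ne_zero h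
      set Q := O / dl with hQ
      have hQO : Q * dl ≤ O := Nat.div_mul_le_self _ _
      have hOQ : O < (Q + 1) * dl := by
        rw [add_mul, one_mul, hQ, mul_comm]
        exact Nat.lt_mul_div_succ O hdl0
      have hQm : Q < m := by
        refine Nat.lt_of_mul_lt_mul_right (a := dl) ?_
        omega
      have eQ : (.var vO / .var vDl : Expr).eval s1 = Q := by
        rw [Expr.eval_div, Expr.eval_var, Expr.eval_var, hO, x3]
      refine yields_set_seq hs1 (by rw [eQ]; omega) ?_
      rw [eQ, Expr.eval_zero]
      have hb2 : Bdd b (s1.write vQ 0 Q) := hs1.write (by omega)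
      have eOff : (.var vO - .var vQ * .var vDl : Expr).eval (s1.write vQ 0 Q) = O - Q * dl := by
        simp only [Expr.eval_sub, Expr.eval_mul, Expr.eval_var]
        rw [State.write_self, State.write_of_ne _ _ _ (by decide), State.write_of_ne _ _ _ (by decide),
          hO, x3]
      set F := O - Q * dl with hF
      rw [add_mul, one_mul] at hOQ
      have hFdl : F < dl := by omega
      refine yields_set_seq hb2 (by rw [eOff]; omega) ?_
      rw [eOff, Expr.eval_zero]
      have hb3 : Bdd b ((s1.write vQ 0 Q).write vOff 0 F) := hb2.write (by omega)
      set s3 := (s1.write vQ 0 Q).write vOff 0 F with hs3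
      have hw3 : ∀ c, c ≠ vQ → c ≠ vOff → s3 c = s1 c := fun c h1 h2 => by
        rw [hs3, State.write_of_ne _ _ _ h2, State.write_of_ne _ _ _ h1]
      have hQ3 : s3 vQ 0 = Q := by rw [hs3, State.write_of_ne _ _ _ (by decide), State.write_self]
      have hF3 : s3 vOff 0 = F := by rw [hs3, State.write_self]
      have hH3 : Holds s3 (xs ++ τ) := hH.congr (hw3 _ (by decide) (by decide))
        (hw3 _ (by decide) (by decide))
      have hnb : n < 2 ^ b := hn.trans_lt hM
      -- values in states that agree with `s3` except for the output
      have hval : ∀ st : State, (∀ c, c ≠ vOut → c ≠ vP → st c = s3 c) → st vJ 0 = j ∧ st vQ 0 = Q ∧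
          st vOff 0 = F ∧ st vA j = A ∧ st vB 0 = B ∧ st vDl 0 = dl ∧ st vO 0 = O ∧
          st vD 0 = D := by
        intro st hst
        refine ⟨?_, ?_, ?_, ?_, ?_, ?_, ?_, ?_⟩ <;> rw [hst _ (by decide) (by decide)] <;>
          assumption
      set x : CodedPiece n m := ⟨⟨j, hj⟩, ⟨Q, hQm⟩, B + F, B + min dl (F + A), D, hD0⟩ with hxdef
      have hlen' : (xs ++ τ).length + 2 ≤ xs.length + 2 * n := by
        rw [List.length_append]; omega
      refine yields_seq _ (emit_yields x hb3 hH3 (hval s3 fun _ _ _ => rfl).2.2.2.2.2.2.2 (by omega)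
        (fun st hst => ?_) (hj.trans hnb) (hQm.trans hm) ?_ ?_) ?_
      · obtain ⟨y1, y2, y3, y4, y5, y6, -, -⟩ := hval st fun c h1 _ => hst c h1
        simp only [Expr.eval_add, Expr.eval_min, Expr.eval_var, Expr.eval_get, y1, y2, y3, y4, y5,
          y6, hxdef]
        exact ⟨trivial, trivial, trivial, trivial⟩
      · show B + F < 2 ^ b
        omega
      · show B + min dl (F + A) < 2 ^ b
        omega
      intro s4 hs4 hfr4 hH4
      have hw4 : ∀ c, c ≠ vOut → c ≠ vP → s4 c = s3 c := fun c h1 h2 =>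
        hfr4 c (by simp [emit, writes, h1, h2])
      obtain ⟨y1, y2, y3, y4, y5, y6, y7, y8⟩ := hval s4 hw4
      -- the pieces of this job
      have hν : ∀ ν : List (CodedPiece n m),
          (ν = [x] ∧ F + A ≤ dl ∨ dl < F + A ∧ ∃ h : Q + 1 < m,
            ν = [x, ⟨⟨j, hj⟩, ⟨Q + 1, h⟩, B, B + (F + A - dl), D, hD0⟩]) →
          IsWrap D B dl a (j + 1) (τ ++ ν) := by
        intro ν hν
        refine hsuccw.1 (hτ.append hApos ?_ ?_ ?_ ?_ ?_ ?_ ?_ ?_ ?_)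
        all_goals
          rcases hν with ⟨rfl, hc⟩ | ⟨hc, hm', rfl⟩
          all_goals
            try
              simp only [hxdef, List.mem_cons, List.not_mem_nil, or_false, forall_eq_or_imp,
                forall_eq, List.pairwise_cons, List.Pairwise.nil, List.map_cons, List.map_nil,
                List.sum_cons, List.sum_nil, add_mul, one_mul, ← hA, ← hOdef, implies_true,
                and_true, IsEmpty.forall_iff]
            try omega
      refine yields_seq (fun st => (∃ τ' : List (CodedPiece n m), IsWrap D B dl a (j + 1) τ' ∧
        Holds st (xs ++ τ') ∧ τ'.length ≤ 2 * (j + 1)) ∧ ∀ c, c ≠ vOut → c ≠ vP → st c = s3 c) ?_ ?_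
      · have hcond : ((Expr.var vDl).lt (.var vOff + .get vA (.var vJ))).eval s4 ≠ 0 ↔
            dl < F + A := by
          simp only [Expr.eval_lt, Expr.eval_add, Expr.eval_var, Expr.eval_get, y1, y3, y4, y6]
          simp
        refine yields_ite hs4 (fun h => ?_) fun h => ?_
        · rw [hcond] at h
          have hQm' : Q + 1 < m := by
            refine Nat.lt_of_mul_lt_mul_right (a := dl) ?_
            rw [add_mul, one_mul]
            omega
          have hl4 : (xs ++ τ ++ [x]).length = (xs ++ τ).length + 1 := by
            rw [List.length_append (as := xs ++ τ), List.length_singleton]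
          refine (emit_yields ⟨⟨j, hj⟩, ⟨Q + 1, hQm'⟩, B, B + (F + A - dl), D, hD0⟩ hs4 hH4 y8
            (by omega) (fun st hst => ?_) (hj.trans hnb) (hQm'.trans hm) ?_ ?_).mono ?_
          · obtain ⟨z1, z2, z3, z4, z5, z6, -, -⟩ := hval st fun c h1 h2 => by
              rw [hst c h1, hw4 c h1 h2]
            simp only [Expr.eval_add, Expr.eval_sub, Expr.eval_one, Expr.eval_var, Expr.eval_get,
              z1, z2, z3, z4, z5, z6]
            exact ⟨trivial, trivial, trivial, trivial⟩
          · show B < 2 ^ b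
            omega
          · show B + (F + A - dl) < 2 ^ b
            omega
          · intro s5 _ hfr5 hH5
            refine ⟨⟨τ ++ [x, ⟨⟨j, hj⟩, ⟨Q + 1, hQm'⟩, B, B + (F + A - dl), D, hD0⟩],
              hν _ (Or.inr ⟨h, hQm', rfl⟩), ?_, ?_⟩, ?_⟩
            · simpa using hH5
            · rw [List.length_append]
              simp only [List.length_cons, List.length_nil]
              omega
            · intro c h1 h2
              rw [hfr5 c (by simp [emit, writes, h1, h2]), hw4 c h1 h2]
        · have h' := mt hcond.2 (not_not.2 h)
          refine yields_nop hs4 ⟨⟨τ ++ [x], hν _ (Or.inl ⟨rfl, not_lt.1 h'⟩), ?_, ?_⟩, hw4⟩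
          · rwa [← List.append_assoc]
          · rw [List.length_append, List.length_singleton]
            omega
      · rintro s5 hs5 - ⟨⟨τ', g1, g2, g3⟩, hw5⟩
        obtain ⟨z1, -, -, z4, -, -, z7, -⟩ := hval s5 hw5
        have eO : (.var vO + .get vA (.var vJ) : Expr).eval s5 = O + A := by
          simp only [Expr.eval_add, Expr.eval_var, Expr.eval_get, z1, z4, z7]
        refine yields_set hs5 (by rw [eO]; omega) ?_
        rw [eO, Expr.eval_zero]
        refine ⟨?_, τ', g1, g2.congr ?_ ?_, g3⟩
        · rw [State.write_of_ne _ _ _ (by decide), State.write_self, hsucc]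
        · rw [State.write_of_ne _ _ _ (by decide), State.write_of_ne _ _ _ (by decide)]
        · rw [State.write_of_ne _ _ _ (by decide), State.write_of_ne _ _ _ (by decide)]
    · rw [Expr.eval_get, Expr.eval_var, hj1, x1] at h
      refine yields_nop hs1 ⟨?_, τ, hsuccw.1 (hτ.skip h), hH.congr ?_ ?_, by omega⟩
      · rw [State.write_of_ne _ _ _ (by decide), hO, hsucc, h, add_zero]
      · rw [State.write_of_ne _ _ _ (by decide)]
      · rw [State.write_of_ne _ _ _ (by decide)]
  · rintro st ⟨-, h⟩ -
    rwa [State.write_of_ne _ _ _ (by decide), hN] at h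

end Cmd

end

section

variable {n m : ℕ}

/-! ### The level algorithm as a program -/

open Problem

variable {I : Problem n m} {S : Fin n → ℕ} {par : Fin n → Option (Fin n)} {D B : ℕ}
  {rem : Fin n → ℕ} {b M k : ℕ} {s s' : State} {xs : List (CodedPiece n m)}

theorem Problem.pendingJobs_nonempty (hpar : I.IsTightForest S par) {j : Fin n} (hj : 0 < rem j) :
    (pendingJobs par rem).Nonempty := by
  obtain ⟨i, hi, -⟩ := exists_pending hpar (rem := fun j => (rem j : ℝ)) (fun j => by positivity)
    (k := j) (by exact_mod_cast hj)
  have h1 : (0 : ℝ) < rem i := hi.1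
  have h2 : ∀ c, par c = some i → (rem c : ℝ) = 0 := hi.2
  exact ⟨i, mem_pendingJobs.2 ⟨by exact_mod_cast h1, fun c hc => by exact_mod_cast h2 c hc⟩⟩

theorem Problem.potential_le : potential S par D rem ≤ n * (n + 2) := by
  classical
  have h1 : (Finset.univ.filter fun j => 0 < rem j).card ≤ n :=
    (Finset.card_le_univ _).trans (by simp)
  have h2 : ((pendingJobs par rem).image (level S D rem)).card ≤ n :=
    Finset.card_image_le.trans ((Finset.card_le_univ _).trans (by simp))
  unfold potential
  nlinarith

theorem Problem.eq_zero_of_potential (h : potential S par D rem = 0) (j : Fin n) : rem j = 0 := by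
  unfold potential at h
  by_contra hj
  have : 0 < (Finset.univ.filter fun j => 0 < rem j).card :=
    Finset.card_pos.2 ⟨j, by simpa using Nat.pos_of_ne_zero hj⟩
  have : 0 < (n + 1) * (Finset.univ.filter fun j => 0 < rem j).card := by positivity
  omega

theorem Problem.potential_eq_zero (h : ∀ j, rem j = 0) : potential S par D rem = 0 := by
  classical
  have h1 : pendingJobs par rem = ∅ := by
    ext j; simp [mem_pendingJobs, Pending, h]
  simp [potential, h, h1]

/-- The situation after `k` rounds of the level algorithm: the pieces `xs` are scheduled, after time
`B / D`, and `rem j / D` units of job `j` are left; all numbers have grown by at most the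
factor `n * n + 1` per round. -/
structure Progress (I : Problem n m) (S : Fin n → ℕ) (par : Fin n → Option (Fin n)) (k D B : ℕ)
    (rem : Fin n → ℕ) (xs : List (CodedPiece n m)) (s : State) : Prop where
  data : RoundData I S par D rem s
  base : s vB 0 = B
  unit_pos : 0 < D
  unit_le : D ≤ m * (n * n + 1) ^ k
  base_le : B ≤ I.bound S * (n * n + 1) ^ k
  base_mul_le : B * m ≤ I.bound S * D
  tail : I.IsTail S par ((I.bound S : ℝ) / m) ((B : ℝ) / D) (fun j => (rem j : ℝ) / D)
    (xs.map CodedPiece.toPiece)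
  holds : Holds s xs
  length : xs.length ≤ 2 * n * k
  potential_le : potential S par D rem + k ≤ n * (n + 2) ∨ potential S par D rem = 0

theorem Progress.level_le (h : Progress I S par k D B rem xs s) (j : Fin n) :
    level S D rem j ≤ I.bound S * (n * n + 1) ^ k := by
  have hD : (0 : ℝ) < D := by exact_mod_cast h.unit_pos
  have h1 : rem j ≤ I.p j * D := by
    have := h.tail.rem_le j
    rw [div_le_iff₀ hD] at this
    exact_mod_cast this
  calc level S D rem j ≤ S j * D + I.p j * D := Nat.add_le_add_left h1 _
    _ = (S j + I.p j) * D := by ring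
    _ ≤ (S j + I.p j) * (m * (n * n + 1) ^ k) := Nat.mul_le_mul_left _ h.unit_le
    _ = m * (S j + I.p j) * (n * n + 1) ^ k := by ring
    _ ≤ _ := Nat.mul_le_mul_right _ (mul_add_le_bound I S j)

/-- The work of one round fits before time `B / D`. -/
theorem Progress.mul_le {h g c nu de : ℕ} (hp : Progress I S par k D B rem xs s) (hm : 0 < m)
    (hpar : I.IsTightForest S par) (hsh : IsShared m S par D rem h g c)
    (hnx : IsNext S par D rem h g c nu de) :
    nu * g ≤ B * (de * g) ∧
    I.IsTail S par ((I.bound S : ℝ) / m) (((B * (de * g) : ℕ) : ℝ) / (D * (de * g) : ℕ))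
      (fun j => ((rem j * (de * g) : ℕ) : ℝ) / (D * (de * g) : ℕ)) (xs.map CodedPiece.toPiece) := by
  obtain ⟨hc, hcg⟩ := hsh.pos
  obtain ⟨hnu, hde, -⟩ := hnx.pos hsh
  have hg : 0 < g := by omega
  have hD : (0 : ℝ) < D := by exact_mod_cast hp.unit_pos
  have hF : (0 : ℝ) < (de * g : ℕ) := by exact_mod_cast Nat.mul_pos hde hg
  have hdiv : ∀ x : ℕ, ((x * (de * g) : ℕ) : ℝ) / (D * (de * g) : ℕ) = (x : ℝ) / D := by
    intro x
    rw [Nat.cast_mul, Nat.cast_mul D, mul_div_mul_right _ _ hF.ne']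
  have hph := isPhase_amount hp.unit_pos hsh hnx
  have htail : I.IsTail S par ((I.bound S : ℝ) / m) (((B * (de * g) : ℕ) : ℝ) / (D * (de * g) : ℕ))
      (fun j => ((rem j * (de * g) : ℕ) : ℝ) / (D * (de * g) : ℕ))
      (xs.map CodedPiece.toPiece) := by
    simp only [hdiv]
    exact hp.tail
  refine ⟨?_, htail⟩
  obtain ⟨j, hj, -⟩ := hnx.attained
  have hj' : Pending par (fun j => ((rem j * (de * g) : ℕ) : ℝ) / (D * (de * g) : ℕ)) j := by
    simp only [hdiv]
    exact (pending_div_iff hp.unit_pos).2 (mem_pendingJobs.1 hj)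
  have h1 := (hph.headWork_le hm hpar htail.rem_nonneg htail.rem_le htail.headWork_le).1 j hj'
  have h2 := hph.le_rem j
  have h3 : (0 : ℝ) ≤ S j := by positivity
  have h4 : ((nu * g : ℕ) : ℝ) / (D * (de * g) : ℕ) ≤
      ((B * (de * g) : ℕ) : ℝ) / (D * (de * g) : ℕ) := by linarith
  rw [div_le_div_iff_of_pos_right (by rw [Nat.cast_mul]; positivity)] at h4
  exact_mod_cast h4

namespace Cmd

/-- One round of the level algorithm; nothing happens if no job is pending. -/
def round : Cmd :=
  findLevels ;; findShared ;; findNext ;; ite (.var vDe) (advance ;; wrap) nop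

theorem round_yields {V K : ℕ} (hs : Bdd b s) (hp : Progress I S par k D B rem xs s) (hm : 0 < m)
    (hpar : I.IsTightForest S par) (hk : k < K) (hn : n ≤ M) (hM : M < 2 ^ b)
    (hb1 : 1 < 2 ^ b) (hV : m * (n * n + 1) ^ K ≤ V) (hV' : I.bound S * (n * n + 1) ^ K ≤ V)
    (hVb : V * (n * n * n + 1) < 2 ^ b) (hP : 2 + 5 * (2 * n * K) < 2 ^ b) :
    round.Yields b M s fun s' => ∃ D B rem xs, Progress I S par (k + 1) D B rem xs s' := by
  have hpow : (n * n + 1) ^ k ≤ (n * n + 1) ^ K := Nat.pow_le_pow_right (by omega) hk.le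
  have hlV : ∀ j, level S D rem j ≤ V := fun j =>
    (hp.level_le j).trans ((Nat.mul_le_mul_left _ hpow).trans hV')
  have hBV : B ≤ V := hp.base_le.trans ((Nat.mul_le_mul_left _ hpow).trans hV')
  have hDV : D ≤ V := hp.unit_le.trans ((Nat.mul_le_mul_left _ hpow).trans hV)
  have h1V : 1 ≤ V := hp.unit_pos.trans_le hDV
  have hmV : m ≤ V := (Nat.le_mul_of_pos_right _ (by positivity)).trans hV
  have hVb0 : V < 2 ^ b := lt_of_le_of_lt (Nat.le_mul_of_pos_right _ (by positivity)) hVb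
  have hn3 : ∀ {x}, x ≤ n * n * n + 1 → V * x < 2 ^ b := fun hx =>
    (Nat.mul_le_mul_left _ hx).trans_lt hVb
  have hnn : n ≤ n * n := Nat.le_mul_self n
  have hnnn : n * n ≤ n * n * n := by nlinarith
  refine yields_seq _ (findLevels_yields hs hp.data hn hM (fun j => (hlV j).trans_lt hVb0) hb1) ?_
  intro s1 hs1 hfr1 hl1
  have hr1 : RoundData I S par D rem s1 := hp.data.congr (by
    intro a ha; exact hfr1 a (by fin_cases ha <;> decide))
  refine yields_seq _ (findShared_yields hs1 hr1 hl1 hm hn hM hb1) ?_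
  intro s2 hs2 hfr2 hsh
  have hr2 : RoundData I S par D rem s2 := hr1.congr (by
    intro a ha; exact hfr2 a (by fin_cases ha <;> decide))
  have hl2 : HasLevels S par D rem s2 := hl1.congr (hfr2 _ (by decide)) (hfr2 _ (by decide))
  refine yields_seq _ (findNext_yields hs2 hr2 hl2 hsh hn hM hb1 hlV (hn3 (by omega))) ?_
  intro s3 hs3 hfr3 hnx
  have hr3 : RoundData I S par D rem s3 := hr2.congr (by
    intro a ha; exact hfr3 a (by fin_cases ha <;> decide))
  have hl3 : HasLevels S par D rem s3 := hl2.congr (hfr3 _ (by decide)) (hfr3 _ (by decide))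
  have hold : ∀ a ∈ [vOut, vB, vP], s3 a = s a := by
    intro a ha
    fin_cases ha <;> rw [hfr3 _ (by decide), hfr2 _ (by decide), hfr1 _ (by decide)]
  have hH3 : Holds s3 xs := hp.holds.congr (hold _ (by decide)) (hold _ (by decide))
  have hB3 : s3 vB 0 = B := by rw [hold _ (by decide), hp.base]
  rw [← hfr3 vH (by decide), ← hfr3 vG (by decide), ← hfr3 vC (by decide)] at hnx
  rw [← hfr3 vH (by decide), ← hfr3 vG (by decide), ← hfr3 vC (by decide)] at hsh
  split_ifs at hnx with hne
  · set h := s3 vH 0 with hh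
    set g := s3 vG 0 with hg
    set c := s3 vC 0 with hc
    set nu := s3 vNu 0 with hnu
    set de := s3 vDe 0 with hde
    obtain ⟨hc0, hcg⟩ := hsh.pos
    obtain ⟨hnu0, hde0, hdeg⟩ := hnx.pos hsh
    have hg0 : 0 < g := by omega
    have hn0 : 0 < n := hne.choose.pos
    have hgn := hsh.le hn0
    have hsc : de * g ≤ n * n + 1 := (Nat.mul_le_mul (hdeg.trans hgn) hgn).trans (Nat.le_succ _)
    obtain ⟨hmul, htail⟩ := hp.mul_le hm hpar hsh hnx
    refine yields_ite hs3 (fun _ => ?_) fun hc => absurd hc hde0.ne'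
    refine yields_seq _ (advance_yields hs3 hr3 hl3 hsh hnx rfl rfl rfl rfl rfl hn hM hlV
      (hB3.trans_le hBV) hDV h1V (hn3 (by omega))) ?_
    rintro s4 hs4 hfr4 ⟨hr4, hA4, hdl4, hB4⟩
    rw [hB3] at hB4
    set D' := D * (de * g) with hD'
    set rem' := fun j => rem j * (de * g) - amount S par D rem h g c nu j with hrem'
    set B' := B * (de * g) - nu * g with hB'
    have hBV' : B * (de * g) ≤ V * (n * n + 1) := Nat.mul_le_mul hBV hsc
    have hD'0 : 0 < D' := Nat.mul_pos hp.unit_pos (Nat.mul_pos hde0 hg0)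
    have hBb : V * (n * n + 1) < 2 ^ b := hn3 (by omega)
    have hdlV : nu * g ≤ V * (n * n) := by
      refine hmul.trans (Nat.mul_le_mul hBV (Nat.mul_le_mul (hdeg.trans hgn) hgn))
    have hlen : xs.length + 2 * n ≤ 2 * n * K := by
      calc xs.length + 2 * n ≤ 2 * n * k + 2 * n := Nat.add_le_add_right hp.length _
        _ = 2 * n * (k + 1) := by ring
        _ ≤ _ := Nat.mul_le_mul_left _ hk
    refine (wrap_yields (D := D') (B := B') (dl := nu * g) (xs := xs)
      (a := amount S par D rem h g c nu) hs4
      (hH3.congr (hfr4 _ (by decide)) (hfr4 _ (by decide))) hr4.reads.jobs hn hM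
      (hmV.trans_lt hVb0) hr4.unit hD'0 hB4 hdl4 (Nat.mul_pos hnu0 hg0) hA4
      (amount_le hsh) (sum_amount_le hsh) ?_ (by omega) (by omega)).mono ?_
    · calc ∑ j, amount S par D rem h g c nu j ≤ ∑ _j : Fin n, V * (n * n) :=
          Finset.sum_le_sum fun j _ => (amount_le hsh j).trans hdlV
        _ = V * (n * n * n) := by simp; ring
        _ < _ := hn3 (by omega)
    · rintro s5 - hfr5 ⟨τ, hτ, hH5, hlenτ⟩
      refine ⟨D', B', rem', xs ++ τ, ?_⟩
      have hBeq : B' + nu * g = B * (de * g) := by omega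
      have hpot := potential_lt hsh hnx
      refine ⟨hr4.congr fun a ha => hfr5 a (by fin_cases ha <;> decide),
        by rw [hfr5 _ (by decide), hB4], hD'0, ?_, ?_, ?_, ?_, hH5, ?_, ?_⟩
      · calc D' ≤ m * (n * n + 1) ^ k * (n * n + 1) := Nat.mul_le_mul hp.unit_le hsc
          _ = _ := by ring
      · calc B' ≤ B * (de * g) := Nat.sub_le _ _
          _ ≤ I.bound S * (n * n + 1) ^ k * (n * n + 1) := Nat.mul_le_mul hp.base_le hsc
          _ = _ := by ring
      · calc B' * m ≤ B * (de * g) * m := Nat.mul_le_mul_right _ (Nat.sub_le _ _)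
          _ = B * m * (de * g) := by ring
          _ ≤ I.bound S * D * (de * g) := Nat.mul_le_mul_right _ hp.base_mul_le
          _ = _ := by ring
      · rw [List.map_append]
        refine IsTail.wrap hm hpar hD'0 (rem := fun j => rem j * (de * g)) (dl := nu * g)
          (by rw [hBeq]; exact htail) ?_ (isPhase_amount hp.unit_pos hsh hnx)
          (amount_le_rem hnx) hτ
        rw [hBeq, div_le_div_iff₀ (by exact_mod_cast hD'0) (by exact_mod_cast hm)]
        have : B * (de * g) * m ≤ I.bound S * D' := by
          calc B * (de * g) * m = B * m * (de * g) := by ring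
            _ ≤ I.bound S * D * (de * g) := Nat.mul_le_mul_right _ hp.base_mul_le
            _ = _ := by ring
        exact_mod_cast this
      · rw [List.length_append]
        have := hp.length
        have : 2 * n * (k + 1) = 2 * n * k + 2 * n := by ring
        omega
      · have := hp.potential_le
        change potential S par D' rem' + (k + 1) ≤ _ ∨ potential S par D' rem' = 0
        change potential S par D' rem' < _ at hpot
        omega
  · refine yields_ite hs3 (fun hc => absurd hnx hc) fun _ => yields_nop hs3 ?_
    have hz : ∀ j, rem j = 0 := fun j => by
      by_contra hj
      exact hne (pendingJobs_nonempty hpar (Nat.pos_of_ne_zero hj))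
    have hk' : ∀ x, x * (n * n + 1) ^ k ≤ x * (n * n + 1) ^ (k + 1) := fun x =>
      Nat.mul_le_mul_left _ (Nat.pow_le_pow_right (by omega) (by omega))
    exact ⟨D, B, rem, xs, hr3, hB3, hp.unit_pos, hp.unit_le.trans (hk' _), hp.base_le.trans (hk' _),
      hp.base_mul_le, hp.tail, hH3, hp.length.trans (Nat.mul_le_mul_left _ (by omega)),
      Or.inr (potential_eq_zero hz)⟩

/-- Schedules the jobs, given the earliest start times and a forest. -/
def solve : Cmd :=
  set vM 0 (.get vIn (.const 2)) ;; computeBound ;; set vD 0 (.var vM) ;;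
  iter vJ vN (set vRem (.var vJ) (pAt (.var vJ) * .var vM)) ;;
  set vOut 1 1 ;; set vP 0 (.const 2) ;; set vL 0 (.var vN * (.var vN + .const 2)) ;;
  iter vR vL round ;; set vOut 0 (.var vP - 1)

theorem solve_yields {V : ℕ} (hs : Bdd b s) (hr : Reads I s) (hm : 0 < m)
    (hpar : I.IsTightForest S par) (hS : ∀ j : Fin n, s vS j = S j)
    (hp : ∀ j : Fin n, s vPar j = encodeParent (par j)) (hn : n * (n + 2) ≤ M) (hM : M < 2 ^ b)
    (hV : m * (n * n + 1) ^ (n * (n + 2)) ≤ V) (hV' : I.bound S * (n * n + 1) ^ (n * (n + 2)) ≤ V)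
    (hVb : V * (n * n * n + 1) < 2 ^ b) (hP : 2 + 5 * (2 * n * (n * (n + 2))) < 2 ^ b) :
    solve.Yields b M s fun s' => ∃ xs : List (CodedPiece n m),
      HasOutput s' (1 :: xs.flatMap CodedPiece.code) ∧ ∃ B rem,
        I.IsTail S par ((I.bound S : ℝ) / m) B rem (xs.map CodedPiece.toPiece) ∧
        ∀ j, rem j = 0 := by
  set K := n * (n + 2) with hK
  have hnK : n ≤ K := by rw [hK]; exact Nat.le_mul_of_pos_right _ (by omega)
  have hnM : n ≤ M := hnK.trans hn
  have hpow : 1 ≤ (n * n + 1) ^ K := Nat.one_le_pow _ _ (by omega)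
  have hmV : m ≤ V := (Nat.le_mul_of_pos_right _ hpow).trans hV
  have hUV : I.bound S ≤ V := (Nat.le_mul_of_pos_right _ hpow).trans hV'
  have hVb0 : V < 2 ^ b := lt_of_le_of_lt (Nat.le_mul_of_pos_right _ (by positivity)) hVb
  have hb2 : 2 < 2 ^ b := by omega
  have e0 : (.get vIn (.const 2) : Expr).eval s = m := by
    rw [Expr.eval_get, Expr.eval_const, hr.input, I.inputState_m]
  refine yields_set_seq hs (by rw [e0]; omega) ?_
  rw [e0, Expr.eval_zero]
  have hb1 : Bdd b (s.write vM 0 m) := hs.write (by omega)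
  set s1 := s.write vM 0 m with hs1
  have hw1 : ∀ a, a ≠ vM → s1 a = s a := fun a ha => State.write_of_ne _ _ _ ha
  have hr1 : Reads I s1 := hr.congr (hw1 _ (by decide)) (hw1 _ (by decide))
  refine yields_seq _ (computeBound_yields hb1 hr1 hnM hM (by rw [hs1, State.write_self])
    (fun j => by rw [hw1 _ (by decide), hS]) (hUV.trans_lt hVb0)) ?_
  intro s2 hb2' hfr2 hB2
  have hr2 : Reads I s2 := hr1.congr (hfr2 _ (by decide)) (hfr2 _ (by decide))
  have hM2 : s2 vM 0 = m := by rw [hfr2 _ (by decide), hs1, State.write_self]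
  refine yields_set_seq hb2' (by rw [Expr.eval_var, hM2]; omega) ?_
  rw [Expr.eval_var, hM2, Expr.eval_zero]
  have hb3 : Bdd b (s2.write vD 0 m) := hb2'.write (by omega)
  set s3 := s2.write vD 0 m with hs3
  have hw3 : ∀ a, a ≠ vD → s3 a = s2 a := fun a ha => State.write_of_ne _ _ _ ha
  have hr3 : Reads I s3 := hr2.congr (hw3 _ (by decide)) (hw3 _ (by decide))
  refine yields_seq (fun st => ∀ j : Fin n, st vRem j = I.p j * m) ?_ ?_
  · refine yields_iter (fun k st => ∀ j : Fin n, j.val < k → st vRem j = I.p j * m) hb3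
      (hr3.jobs ▸ hnM) hM (by decide) (by decide) (by decide) (by simp) ?_ ?_
    · intro j hj s4 hs4 hfr4 hj4 hP4
      rw [hr3.jobs] at hj
      have hr4 : Reads I s4 := hr3.congr (hfr4 _ (by decide)) (hfr4 _ (by decide))
      have e1 : (pAt (.var vJ) * .var vM : Expr).eval s4 = I.p ⟨j, hj⟩ * m := by
        rw [Expr.eval_mul, hr4.eval_pAt (j := ⟨j, hj⟩) (by simpa using hj4), Expr.eval_var,
          hfr4 _ (by decide), hw3 _ (by decide), hM2]
      refine yields_set hs4 ?_ fun j' hj' => ?_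
      · rw [e1]
        refine lt_of_le_of_lt ?_ (hUV.trans_lt hVb0)
        refine le_trans ?_ (mul_add_le_bound I S ⟨j, hj⟩)
        rw [mul_comm]
        exact Nat.mul_le_mul_left _ (Nat.le_add_left _ _)
      · rw [e1, State.write_of_ne _ _ _ (by decide), State.write_apply, Expr.eval_var, hj4]
        split_ifs with h
        · obtain rfl : j' = ⟨j, hj⟩ := Fin.ext h
          rfl
        · exact hP4 j' (by omega)
    · intro st hst _ j
      exact hst j (by rw [hr3.jobs]; exact j.isLt)
  intro s4 hb4 hfr4 hR4
  refine yields_set_seq hb4 (by rw [Expr.eval_one]; omega) ?_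
  rw [Expr.eval_one]
  have hb5 : Bdd b (s4.write vOut 1 1) := hb4.write (by omega)
  refine yields_set_seq hb5 (by rw [Expr.eval_const]; omega) ?_
  rw [Expr.eval_const, Expr.eval_zero]
  have hb6 : Bdd b ((s4.write vOut 1 1).write vP 0 2) := hb5.write (by omega)
  set s6 := (s4.write vOut 1 1).write vP 0 2 with hs6
  have hw6 : ∀ a, a ≠ vOut → a ≠ vP → s6 a = s4 a := fun a h1 h2 => by
    rw [hs6, State.write_of_ne _ _ _ h2, State.write_of_ne _ _ _ h1]
  have hN6 : s6 vN 0 = n := by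
    rw [hw6 _ (by decide) (by decide), hfr4 _ (by decide), hr3.jobs]
  have e2 : (.var vN * (.var vN + .const 2) : Expr).eval s6 = K := by
    rw [Expr.eval_mul, Expr.eval_add, Expr.eval_var, Expr.eval_const, hN6]
  refine yields_set_seq hb6 (by rw [e2]; omega) ?_
  rw [e2, Expr.eval_zero]
  have hb7 : Bdd b (s6.write vL 0 K) := hb6.write (by omega)
  set s7 := s6.write vL 0 K with hs7
  have hw7 : ∀ a, a ≠ vL → s7 a = s6 a := fun a ha => State.write_of_ne _ _ _ ha
  have hL7 : s7 vL 0 = K := State.write_self _ _ _ _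
  have hmr : (0 : ℝ) < m := by exact_mod_cast hm
  have h0 : Progress I S par 0 m (I.bound S) (fun j => I.p j * m) [] s7 := by
    have hw : ∀ a ∈ [vIn, vN, vM, vPar, vS, vB, vD], s7 a = s3 a := by
      intro a ha
      fin_cases ha <;> rw [hw7 _ (by decide), hw6 _ (by decide) (by decide), hfr4 _ (by decide)]
    refine ⟨⟨hr3.congr (hw _ (by decide)) (hw _ (by decide)), ?_, ?_, ?_, ?_, ?_⟩, ?_, hm,
      by simp, by simp, le_rfl, ?_, ⟨?_, ?_, by simp⟩, by simp, Or.inl potential_le⟩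
    · rw [hw _ (by decide), hw3 _ (by decide), hM2]
    · intro j
      rw [hw _ (by decide), hw3 _ (by decide), hfr2 _ (by decide), hw1 _ (by decide), hS]
    · intro j
      rw [hw _ (by decide), hw3 _ (by decide), hfr2 _ (by decide), hw1 _ (by decide), hp]
    · rw [hw _ (by decide), hs3, State.write_self]
    · intro j
      rw [hw7 _ (by decide), hw6 _ (by decide) (by decide), hR4]
    · rw [hw _ (by decide), hw3 _ (by decide), hB2]
    · have : (fun j => ((I.p j * m : ℕ) : ℝ) / m) = fun j => (I.p j : ℝ) := by
        funext j
        rw [Nat.cast_mul, mul_div_cancel_right₀ _ hmr.ne']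
      rw [this]
      exact isTail_bound hm I S par
    · rw [hw7 _ (by decide), hs6, State.write_self]; rfl
    · rw [hw7 _ (by decide), hs6, State.write_of_ne _ _ _ (by decide), State.write_self]
  refine yields_seq (fun st => ∃ D B rem xs, Progress I S par K D B rem xs st) ?_ ?_
  · refine yields_iter (fun k st => ∃ D B rem xs, Progress I S par k D B rem xs st) hb7
      (by rw [hL7]; exact hn) hM (by decide) (by decide) (by decide) ?_ ?_ ?_
    · refine ⟨_, _, _, _, ⟨h0.data.congr fun a ha => ?_, ?_, h0.3, h0.4, h0.5, h0.6, h0.7,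
        h0.holds.congr ?_ ?_, h0.9, h0.10⟩⟩
      · exact State.write_of_ne _ _ _ (by fin_cases ha <;> decide)
      · rw [State.write_of_ne _ _ _ (by decide), h0.base]
      · exact State.write_of_ne _ _ _ (by decide)
      · exact State.write_of_ne _ _ _ (by decide)
    · rintro k hk st hst - - ⟨D, B, rem, xs, h⟩
      rw [hL7] at hk
      refine (round_yields hst h hm hpar hk hnM hM (by omega) hV hV' hVb hP).mono ?_
      rintro st' - - ⟨D', B', rem', xs', h'⟩
      refine ⟨D', B', rem', xs', ⟨h'.data.congr fun a ha => ?_, ?_, h'.3, h'.4, h'.5, h'.6, h'.7,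
        h'.holds.congr ?_ ?_, h'.9, h'.10⟩⟩
      · exact State.write_of_ne _ _ _ (by fin_cases ha <;> decide)
      · rw [State.write_of_ne _ _ _ (by decide), h'.base]
      · exact State.write_of_ne _ _ _ (by decide)
      · exact State.write_of_ne _ _ _ (by decide)
    · rintro st h -
      rwa [hL7] at h
  rintro s8 hb8 - ⟨D, B, rem, xs, h⟩
  have e3 : (.var vP - 1 : Expr).eval s8 = 1 + 5 * xs.length := by
    rw [Expr.eval_sub, Expr.eval_var, Expr.eval_one, h.holds.next]
    omega
  have hlen := h.length
  refine yields_set hb8 (by rw [e3]; omega) ⟨xs, Holds.hasOutput ⟨?_, ?_, fun k hk => ?_⟩ ?_, _, _,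
    h.tail, fun j => ?_⟩
  · rw [State.write_of_ne _ _ _ (by decide), h.holds.next]
  · rw [State.write_apply, Expr.eval_zero, if_neg (by decide), h.holds.one]
  · rw [State.write_apply, Expr.eval_zero, if_neg (by omega), h.holds.cells k hk]
  · rw [e3, Expr.eval_zero, State.write_self]
  · have : rem j = 0 := by
      refine eq_zero_of_potential (S := S) (par := par) (D := D) ?_ j
      have := h.potential_le
      omega
    rw [this, Nat.cast_zero, zero_div]

end Cmd

end

section

variable {n m : ℕ}

/-! ### The size of the input -/

theorem length_le_bitLength (l : List ℕ) : l.length ≤ bitLength l := by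
  induction l with
  | nil => simp
  | cons x l ih => simp only [bitLength, List.map_cons, List.sum_cons, List.length_cons] at *; omega

theorem lt_two_pow_bitLength {l : List ℕ} {x : ℕ} (hx : x ∈ l) : x < 2 ^ bitLength l := by
  refine Nat.size_le.1 ?_
  have : Nat.size x + 1 ≤ (l.map fun x => Nat.size x + 1).sum :=
    List.single_le_sum (by simp) _ (List.mem_map_of_mem hx)
  exact le_trans (Nat.le_succ _) this

theorem bdd_inputState (l : List ℕ) : Bdd (bitLength l) (inputState l) := by
  intro a k
  unfold inputState
  split_ifs
  · by_cases hk : k < (l.length :: l).length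
    · rw [List.getD_eq_getElem _ _ hk]
      rcases List.mem_cons.1 (List.getElem_mem hk) with h | h
      · rw [h]
        exact (length_le_bitLength l).trans_lt Nat.lt_two_pow_self
      · exact lt_two_pow_bitLength h
    · rw [List.getD_eq_default _ _ (not_lt.1 hk)]
      positivity
  · positivity

theorem Bdd.mono {b b' : ℕ} {s : State} (h : Bdd b s) (hb : b ≤ b') : Bdd b' s := fun a k =>
  (h a k).trans_le (Nat.pow_le_pow_right (by norm_num) hb)

namespace Problem

variable {I : Problem n m} {S : Fin n → ℕ} {par : Fin n → Option (Fin n)}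

theorem mul_add_two_le_bitLength (I : Problem n m) : n * (n + 2) ≤ bitLength I.code := by
  classical
  refine le_trans ?_ (length_le_bitLength _)
  rw [code_eq]
  simp only [List.length_append, List.length_cons, List.length_nil, List.length_ofFn]
  nlinarith

theorem bound_le_pow {X : ℕ} (hX : 2 ≤ X) (hn : n ≤ X) (hm : m ≤ X) (hp : ∀ j, I.p j ≤ X)
    (hS : ∀ j, S j ≤ X ^ 4) : I.bound S ≤ X ^ 6 := by
  have h1 : X * X ^ 4 + X * X ≤ X ^ 6 := by
    have h2 : 1 * (X * X) ≤ X ^ 3 * (X * X) := Nat.mul_le_mul_right _ (Nat.one_le_pow _ _ (by omega))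
    have h3 : 2 * X ^ 5 ≤ X * X ^ 5 := Nat.mul_le_mul_right _ hX
    calc X * X ^ 4 + X * X ≤ X * X ^ 4 + X ^ 3 * (X * X) := by omega
      _ = 2 * X ^ 5 := by ring
      _ ≤ X * X ^ 5 := h3
      _ = X ^ 6 := by ring
  refine Finset.sup_le fun j _ => max_le (le_trans (Nat.add_le_add ?_ ?_) h1) (le_trans ?_ h1)
  · exact Nat.mul_le_mul hm (hS j)
  · calc ∑ i, min (I.p i) (S i + I.p i - S j) ≤ ∑ _i : Fin n, X :=
          Finset.sum_le_sum fun i _ => (min_le_left _ _).trans (hp i)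
      _ = n * X := by simp
      _ ≤ X * X := Nat.mul_le_mul_right _ hn
  · rw [mul_add]
    exact Nat.add_le_add (Nat.mul_le_mul hm (hS j)) (Nat.mul_le_mul hm (hp j))

/-! ### Correctness of the transformation to an outforest -/

/-- A complete schedule found by the level algorithm is optimal for both kinds of constraints. -/
theorem IsTail.optimal (hm : 0 < m) (hS : I.IsEarliestStart S) (hpar : I.IsTightForest S par)
    {L : Fin n → Finset (Fin n)} (hL : ∀ i j, (I.prune L).G.Adj i j ↔ par j = some i) {B : ℝ}
    {rem : Fin n → ℝ} {σ : Schedule n m} (h : I.IsTail S par ((I.bound S : ℝ) / m) B rem σ)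
    (h0 : ∀ j, rem j = 0) : I.OrOptimal σ ∧ (I.prune L).AndOptimal σ := by
  have hand := h.andFeasible hS hL h0
  have hopt := (hpar.orFeasible hL hand).orOptimal hm hS (h.makespan_le h0 (by positivity))
  exact ⟨hopt, hand, fun τ hτ => hopt.2 τ (hpar.orFeasible hL hτ)⟩

theorem IsTightForest.prune_adj_iff (hS : I.IsEarliestStart S) (hpar : I.IsTightForest S par)
    (hL : I.IsClosedCollection (forestChain par)) (i j : Fin n) :
    (I.prune (forestChain par)).G.Adj i j ↔ par j = some i := by
  obtain ⟨par', h1, h2⟩ := hL.exists_forest hS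
  suffices par' = par by rw [h2, this]
  funext j
  cases hp : par j with
  | none => exact h1.ne_none (hpar.eq_none hp)
  | some i =>
    refine (h2 i j).1 ⟨(hpar.tight hp).1, mem_forestChain_iff.2 (Or.inr ⟨i, hp,
      mem_forestChain_iff.2 (Or.inl rfl)⟩), ?_⟩
    rintro rfl
    exact lt_irrefl _ (hpar.tight hp).lt

/-- The level algorithm, run on a memory that holds the given forest, yields a complete
schedule. -/
theorem IsTightForest.exists_isTail (hm : 0 < m) (hpar : I.IsTightForest S par) :
    ∃ (σ : Schedule n m) (B : ℝ) (rem : Fin n → ℝ),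
      I.IsTail S par ((I.bound S : ℝ) / m) B rem σ ∧ ∀ j, rem j = 0 := by
  set K := n * (n + 2) with hK
  set V := (m + I.bound S) * (n * n + 1) ^ K with hV
  set b := bitLength I.code + (∑ j, S j) + n + K + V * (n * n * n + 1) + (2 + 5 * (2 * n * K))
    with hb
  have hlt : ∀ {x}, x ≤ b → x < 2 ^ b := fun hx => hx.trans_lt Nat.lt_two_pow_self
  set s : State := fun a k =>
    if a = vIn then inputState I.code vIn k
    else if a = vN then n
    else if h : k < n then
      if a = vS then S ⟨k, h⟩ else if a = vPar then encodeParent (par ⟨k, h⟩) else 0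
    else 0 with hs
  have hbdd : Bdd b s := by
    intro a k
    simp only [hs]
    split_ifs with h1 h2 h3 h4 h5
    · exact (bdd_inputState I.code).mono (by omega) _ _
    · exact hlt (by omega)
    · have : S ⟨k, h3⟩ ≤ ∑ j, S j :=
        Finset.single_le_sum (f := S) (fun _ _ => Nat.zero_le _) (Finset.mem_univ _)
      exact hlt (by omega)
    · refine hlt ?_
      cases par ⟨k, h3⟩ with
      | none => exact Nat.zero_le _
      | some i =>
        have := i.isLt
        simp only [encodeParent]
        omega
    · positivity
    · positivity
  have hVm : m * (n * n + 1) ^ K ≤ V := Nat.mul_le_mul_right _ (Nat.le_add_right _ _)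
  have hVb : I.bound S * (n * n + 1) ^ K ≤ V := Nat.mul_le_mul_right _ (Nat.le_add_left _ _)
  obtain ⟨s', t, -, -, -, -, xs, -, B, rem, h1, h2⟩ :=
    Cmd.solve_yields (I := I) (S := S) (par := par) (M := K) (V := V) hbdd ⟨rfl, rfl⟩ hm hpar
      (fun j => by simp [hs]) (fun j => by simp [hs]) le_rfl (hlt (by omega)) hVm hVb
      (hlt (by omega)) (hlt (by rw [← hK]; omega))
  exact ⟨_, B, rem, h1, h2⟩

end Problem

/-! ### The whole program -/

namespace Cmd

/-- The algorithm: earliest start times, a forest of tight arcs, and an optimal schedule for it. -/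
def main : Cmd :=
  set vN 0 (.get vIn 1) ;; initStart ;; relaxAll ;; findBad ;;
  ite (.var vBad) (set vOut 0 1) (parents ;; shiftStart ;; solve)

open Problem

theorem main_yields (hm : 0 < m) (I : Problem n m) :
    main.Yields ((bitLength I.code + 1) * (2 * bitLength I.code + 10)) (bitLength I.code)
      (inputState I.code) fun s =>
        (¬ (∃ σ, I.OrFeasible σ) ∧ HasOutput s [0]) ∨
        ∃ (L : Fin n → Finset (Fin n)) (xs : List (CodedPiece n m)),
          HasOutput s (1 :: xs.flatMap CodedPiece.code) ∧
          I.OrOptimal (xs.map CodedPiece.toPiece) ∧ I.IsClosedCollection L ∧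
          (I.prune L).AndOptimal (xs.map CodedPiece.toPiece) := by
  classical
  set l := bitLength I.code with hl
  set b := (l + 1) * (2 * l + 10) with hb
  set s := inputState I.code with hs
  set K := n * (n + 2) with hK
  set X := 2 ^ (l + 1) with hX
  have hKl : K ≤ l := I.mul_add_two_le_bitLength
  have hnK : n ≤ K := Nat.le_mul_of_pos_right _ (by omega)
  have hbl : l ≤ b := by rw [hb]; nlinarith
  have hbs : Bdd b s := (bdd_inputState _).mono hbl
  have hlX : 2 ^ l ≤ X := Nat.pow_le_pow_right (by norm_num) (Nat.le_succ _)
  have hX2 : 2 ≤ X := by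
    calc 2 = 2 ^ 1 := rfl
      _ ≤ X := Nat.pow_le_pow_right (by norm_num) (by omega)
  have hXb : X ^ (2 * K + 10) ≤ 2 ^ b := by
    rw [hX, ← pow_mul]
    exact Nat.pow_le_pow_right (by norm_num) (Nat.mul_le_mul_left _ (by omega))
  have hXlt : ∀ {i}, i < 2 * K + 10 → X ^ i < 2 ^ b := fun hi =>
    (Nat.pow_lt_pow_right (by omega) hi).trans_le hXb
  have hsl : Bdd l s := bdd_inputState I.code
  have hnX : n + 1 ≤ X := by
    have := hsl 0 1
    rw [hs, I.inputState_n] at this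
    omega
  have hmX : m ≤ X := by
    have := hsl 0 2
    rw [hs, I.inputState_m] at this
    omega
  have hpX : ∀ j, I.p j ≤ 2 ^ l := fun j => by
    have := hsl 0 (3 + j)
    rw [hs, I.inputState_p] at this
    exact this.le
  have hrX : ∀ j, I.r j + 1 ≤ 2 ^ l := fun j => by
    have := hsl 0 (3 + n + j)
    rw [hs, I.inputState_r] at this
    exact this
  have hnn : n * n + 1 ≤ X ^ 2 := by nlinarith
  have hn3 : n * n * n + 1 ≤ X ^ 3 := by
    calc n * n * n + 1 ≤ (n + 1) * ((n + 1) * (n + 1)) := by nlinarith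
      _ ≤ X * (X * X) := Nat.mul_le_mul hnX (Nat.mul_le_mul hnX hnX)
      _ = X ^ 3 := by ring
  have hE : 2 ^ l * (1 + n * (n * n)) ≤ X ^ 4 := by
    calc 2 ^ l * (1 + n * (n * n)) = 2 ^ l * (n * n * n + 1) := by ring
      _ ≤ X * X ^ 3 := Nat.mul_le_mul hlX hn3
      _ = X ^ 4 := by ring
  have h1b : 1 < 2 ^ b := Nat.one_lt_two_pow (by rw [hb]; positivity)
  have hlb : l < 2 ^ b := hbl.trans_lt Nat.lt_two_pow_self
  have hnl : n ≤ l := hnK.trans hKl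
  have hN : (.get vIn 1 : Expr).eval s = n := I.inputState_n
  refine yields_set_seq hbs (by rw [hN]; omega) ?_
  rw [hN, Expr.eval_zero]
  have hb0 : Bdd b (s.write vN 0 n) := hbs.write (by omega)
  have hr0 : Reads I (s.write vN 0 n) :=
    ⟨State.write_of_ne _ _ _ (by decide), State.write_self _ _ _ _⟩
  refine yields_seq _ (initStart_yields hb0 hr0 hnl hlb fun j => ?_) ?_
  · exact (hrX j).trans_lt (hlX.trans_lt (by simpa using hXlt (i := 1) (by omega)))
  intro s1 hb1 hfr1 hz1
  have hr1 : Reads I s1 := hr0.congr (hfr1 _ (by decide)) (hfr1 _ (by decide))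
  refine yields_seq _ (relaxAll_yields hb1 hr1 hnl hlb hrX hpX (hE.trans_lt (hXlt (by omega))) hz1)
    ?_
  rintro s2 hb2 hfr2 ⟨hsound, hcomp, hle⟩
  have hr2 : Reads I s2 := hr1.congr (hfr2 _ (by decide)) (hfr2 _ (by decide))
  refine yields_seq _ (findBad_yields hb2 hr2 hnl hlb h1b) ?_
  intro s3 hb3 hfr3 hbad
  have hr3 : Reads I s3 := hr2.congr (hfr3 _ (by decide)) (hfr3 _ (by decide))
  have hst : (starts s3 : Fin n → ℕ) = starts s2 := by
    funext j
    rw [starts, starts, hfr3 _ (by decide)]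
  refine yields_ite hb3 (fun h => ?_) fun h => ?_
  · rw [Expr.eval_var] at h
    refine yields_set hb3 h1b (Or.inl ⟨?_, ?_⟩)
    · rintro ⟨σ, hσ⟩
      obtain ⟨S, hS⟩ := hσ.exists_isEarliestStart
      exact h (hbad.2 fun j => by rw [hcomp S hS]; omega)
    · intro k hk
      match k with
      | 0 => simp
      | 1 =>
        rw [Expr.eval_zero, State.write_apply, if_neg (by decide), hfr3 _ (by decide),
          hfr2 _ (by decide), hfr1 _ (by decide), State.write_of_ne _ _ _ (by decide)]
        rfl
      | k + 2 => simp at hk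
  · rw [Expr.eval_var, hbad] at h
    have hS := isEarliestStart_sInf fun j => ⟨_, hsound j (h j)⟩
    set S : Fin n → ℕ := fun j => sInf {v | I.StartValue j v} with hSdef
    have hZ : ∀ j, starts s3 j = S j + 1 := fun j => by rw [hst, hcomp S hS]
    refine yields_seq _ (parents_yields hb3 hr3 hnl hlb hS hZ) ?_
    rintro s4 hb4 hfr4 ⟨par, hpar, hmin, hpar4⟩
    have hr4 : Reads I s4 := hr3.congr (hfr4 _ (by decide)) (hfr4 _ (by decide))
    refine yields_seq _ (shiftStart_yields hb4 hr4 hnl hlb) ?_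
    intro s5 hb5 hfr5 hS5
    have hr5 : Reads I s5 := hr4.congr (hfr5 _ (by decide)) (hfr5 _ (by decide))
    have hbound : I.bound S ≤ X ^ 6 := by
      refine bound_le_pow hX2 (by omega) hmX (fun j => (hpX j).trans hlX) fun j => ?_
      have h1 := hle j
      rw [hcomp S hS] at h1
      omega
    have hpow : (n * n + 1) ^ K ≤ X ^ (2 * K) := by
      rw [pow_mul X 2 K]
      exact Nat.pow_le_pow_left hnn K
    have hV : ∀ {x}, x ≤ X ^ 6 → x * (n * n + 1) ^ K ≤ X ^ (2 * K + 6) := fun hx => by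
      rw [add_comm (2 * K), pow_add]
      exact Nat.mul_le_mul hx hpow
    refine (solve_yields (V := X ^ (2 * K + 6)) hb5 hr5 hm hpar (fun j => ?_) (fun j => ?_)
      (M := l) hKl hlb (hV ?_) (hV hbound) ?_ ?_).mono ?_
    · have : starts s4 j = S j + 1 := by
        rw [← hZ j, starts, starts, hfr4 _ (by decide)]
      rw [hS5, this, Nat.add_sub_cancel]
    · rw [hfr5 _ (by decide), hpar4]
    · exact hmX.trans (Nat.le_self_pow (by norm_num) _)
    · calc X ^ (2 * K + 6) * (n * n * n + 1) ≤ X ^ (2 * K + 6) * X ^ 3 := Nat.mul_le_mul_left _ hn3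
        _ = X ^ (2 * K + 9) := by ring
        _ < 2 ^ b := hXlt (by omega)
    · have hK2 : n * (n + 2) ≤ X * (2 * X) := Nat.mul_le_mul (by omega) (by omega)
      have hX7 : 2 * X ^ 7 ≤ X * X ^ 7 := Nat.mul_le_mul_right _ hX2
      have h4 : 2 ^ 4 ≤ X ^ 4 := Nat.pow_le_pow_left hX2 4
      have h3 : 1 ≤ X ^ 3 := Nat.one_le_pow _ _ (by omega)
      refine lt_of_le_of_lt ?_ (hXlt (i := 8) (by omega))
      calc 2 + 5 * (2 * n * K) ≤ 2 + 5 * (2 * X * (X * (2 * X))) := by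
            refine Nat.add_le_add_left (Nat.mul_le_mul_left _ (Nat.mul_le_mul ?_ hK2)) _
            omega
        _ = 2 + 20 * X ^ 3 := by ring
        _ ≤ 2 * (2 ^ 4 * X ^ 3) := by omega
        _ ≤ 2 * (X ^ 4 * X ^ 3) := Nat.mul_le_mul_left _ (Nat.mul_le_mul_right _ h4)
        _ = 2 * X ^ 7 := by ring
        _ ≤ X * X ^ 7 := hX7
        _ = X ^ 8 := by ring
    · rintro s6 - - ⟨xs, hout, B, rem, htail, h0⟩
      have hL := hpar.isClosedCollection hS (fun {i i' j} => hmin i i' j)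
      obtain ⟨h1, h2⟩ := htail.optimal hm hS hpar (hpar.prune_adj_iff hS hL) h0
      exact Or.inr ⟨_, xs, hout, h1, hL, h2⟩

end Cmd

end

end OrSched

theorem theorem2 :
    -- a polynomial-time algorithm
    (∃ (A : OrSched.Program) (q : Polynomial ℕ),
      ∀ (n m : ℕ), 0 < m → ∀ I : OrSched.Problem n m,
        ∃ (s : OrSched.State) (t : ℕ),
          OrSched.Exec A (OrSched.inputState I.code) s t ∧
          t ≤ q.eval (OrSched.bitLength I.code) ∧
          ((¬ (∃ σ, I.OrFeasible σ) ∧ OrSched.HasOutput s [0]) ∨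
            ∃ (L : Fin n → Finset (Fin n)) (x : List (OrSched.CodedPiece n m)),
              OrSched.HasOutput s (1 :: x.flatMap OrSched.CodedPiece.code) ∧
              I.OrOptimal (x.map OrSched.CodedPiece.toPiece) ∧
              I.IsClosedCollection L ∧
              (I.prune L).AndOptimal (x.map OrSched.CodedPiece.toPiece))) ∧
    -- the transformation to an outforest with AND-precedence constraints is correct
    (∀ (n m : ℕ), 0 < m → ∀ I : OrSched.Problem n m, (∃ σ, I.OrFeasible σ) →
      (∃ L, I.IsClosedCollection L) ∧
      ∀ L, I.IsClosedCollection L →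
        OrSched.IsOutforest (I.prune L).G ∧
        (∃ σ, (I.prune L).AndOptimal σ) ∧
        (∀ σ, (I.prune L).AndFeasible σ → I.OrFeasible σ) ∧
        (∀ σ, (I.prune L).AndOptimal σ → I.OrOptimal σ)) := by
  refine ⟨⟨OrSched.Cmd.main.toProgram, OrSched.Cmd.main.charge *
    ((Polynomial.X + 1) * (2 * Polynomial.X + 10) + 1), fun n m hm I => ?_⟩,
    fun n m hm I ⟨σ, hσ⟩ => ?_⟩
  · obtain ⟨s, t, h1, h2, -, -, h3⟩ := OrSched.Cmd.main_yields hm I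
    exact ⟨s, t, h1, by simpa using h2, h3⟩
  · obtain ⟨S, hS⟩ := hσ.exists_isEarliestStart
    refine ⟨hS.exists_isClosedCollection, fun L hL => ?_⟩
    obtain ⟨par, hpar, hadj⟩ := hL.exists_forest hS
    obtain ⟨τ, B, rem, hτ, h0⟩ := hpar.exists_isTail hm
    obtain ⟨h1, h2⟩ := hτ.optimal hm hS hpar hadj h0
    exact ⟨hpar.isOutforest hadj, ⟨τ, h2⟩, fun σ hσ => hpar.orFeasible hadj hσ,
      fun σ hσ => ⟨hpar.orFeasible hadj hσ.1, fun ν hν => (hσ.2 τ h2.1).trans (h1.2 ν hν)⟩⟩
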